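/- All digraphs are finite and simple: no loops and at most one arc from $u$ to $v$, while opposite arcs $(u,v)$ and $(v,u)$ may both be present. A directed cycle has length at least $2$. Write $\overleftrightarrow{K}_n$ for the complete digraph on $n$ vertices (both arcs between any two distinct vertices). Consider the following digraphs, up to isomorphism. - $\mathcal D_1'$: for $n\ge 1$, the digraph obtained by identifying one vertex of a copy of $\overleftrightarrow{K}_{n+1}$ with one vertex of another copy of $\overleftrightarrow{K}_{n+1}$. - $\mathcal D_2$: for $n\ge 1$, all digraphs obtained from $n+1$ independent vertices and an arbitrary digraph $D_2$ on $n$ vertices by adding both arcs between each of the independent vertices and each vertex of $D_2$. - $\mathcal D_3'$: all digraphs on the five vertices $v_0,v_1,x,y,z$ whose arcs are $(v_0,x),(x,v_1),(v_1,y),(y,v_0),(x,y),(y,x)$, both arcs between $z$ and $v_i$ for $i=0,1$, and possibly $(v_0,v_1)$, or $(v_1,v_0)$, or both. - $D_4$: the digraph on $\{c,y_1,y_2,y_3,z_1,z_2,z_3\}$ whose arcs are (indices modulo $3$) $(c,y_i),(y_i,c)$, $(y_i,y_{i+1})$, $(y_i,z_i)$, $(z_i,y_{i+1})$ for all $i$,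 and $(z_i,z_j)$ for all $i\ne j$. **Theorem 5.1.** Let $D$ be a digraph with $|D|\ge 2$ such that $d^+(u)+d^-(v)\ge |D|-1$ for all vertices $u,v$ of $D$ (the case $u=v$ included). Then $D$ has a directed Hamilton cycle unless $D\in\mathcal D_1'$, $D\in\mathcal D_2$, $D\in\mathcal D_3'$ or $D=D_4$; in these exceptional cases $D$ has no directed Hamilton cycle. -/

import Mathlib

namespace HamiltonDigraph

/-- A digraph is simple if it has no loops.  (A `Digraph` has at most one arc from `u` to `v`;
opposite arcs `(u, v)` and `(v, u)` may both be present.) -/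
def Simple {V : Type*} (D : Digraph V) : Prop :=
  ∀ v, ¬ D.Adj v v

/-- The out-degree `d⁺(v)`. -/
noncomputable def outDegree {V : Type*} (D : Digraph V) (v : V) : ℕ :=
  {w | D.Adj v w}.ncard

/-- The in-degree `d⁻(v)`. -/
noncomputable def inDegree {V : Type*} (D : Digraph V) (v : V) : ℕ :=
  {w | D.Adj w v}.ncard

/-- `f 0, f 1, …, f (k - 1), f 0` is a directed cycle of length `k ≥ 2` in `D`: the vertices are
distinct, and there is an arc from each one to the next, indices being read modulo `k`. -/
def IsDirectedCycle {V : Type*} (D : Digraph V) (k : ℕ) (f : ZMod k → V) : Prop :=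
  2 ≤ k ∧ Function.Injective f ∧ ∀ i, D.Adj (f i) (f (i + 1))

/-- `D` has a directed Hamilton cycle: a directed cycle through all vertices. -/
def HasHamiltonCycle {V : Type*} (D : Digraph V) : Prop :=
  ∃ (k : ℕ) (f : ZMod k → V), IsDirectedCycle D k f ∧ Function.Surjective f

/-- Two digraphs are isomorphic. -/
def Isomorphic {V W : Type*} (D : Digraph V) (H : Digraph W) : Prop :=
  Nonempty (D.Adj ≃r H.Adj)

/-- The (loopless) complete digraph on `V`: both arcs between any two distinct vertices. -/
def complete (V : Type*) : Digraph V where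
  Adj u v := u ≠ v

/-- The digraph obtained by identifying one vertex of the complete digraph on `n + 1` vertices
with one vertex of the complete digraph on `m + 1` vertices.  The two complete digraphs live on
`Option (Fin n)` and `Option (Fin m)`, and their vertices `none` are identified. -/
def gluedComplete (n m : ℕ) : Digraph (Option (Fin n ⊕ Fin m)) where
  Adj x y :=
    (∃ a b : Option (Fin n), (complete (Option (Fin n))).Adj a b ∧
      x = a.map Sum.inl ∧ y = b.map Sum.inl) ∨
    (∃ a b : Option (Fin m), (complete (Option (Fin m))).Adj a b ∧
      x = a.map Sum.inr ∧ y = b.map Sum.inr)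

/-- The digraph obtained from `n + 1` independent vertices and a digraph `H` on `n` vertices by
adding both arcs between each of the independent vertices and each vertex of `H`. -/
def independentJoin (n : ℕ) (H : Digraph (Fin n)) : Digraph (Fin (n + 1) ⊕ Fin n) where
  Adj
    | .inl _, .inl _ => False
    | .inl _, .inr _ => True
    | .inr _, .inl _ => True
    | .inr a, .inr b => H.Adj a b

/-- The digraph on the four vertices `v₀ = 0`, `v₁ = 1`, `2`, `3` consisting of the directed
cycle `v₀ → 2 → v₁ → 3 → v₀` and both arcs between `2` and `3`. -/
def fourVertex : Digraph (Fin 4) where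
  Adj u v := (u, v) ∈ ([(0, 2), (2, 1), (1, 3), (3, 0), (2, 3), (3, 2)] : List (Fin 4 × Fin 4))

/-- The digraph obtained from `fourVertex` and the complete digraph on `n` vertices by adding both
arcs between `v₀`, `v₁` and each vertex of the complete digraph, and adding the arcs in `E`
(to be used with `E ⊆ {(v₀, v₁), (v₁, v₀)}`). -/
def fourVertexJoin (n : ℕ) (E : Set (Fin 4 × Fin 4)) : Digraph (Fin 4 ⊕ Fin n) where
  Adj
    | .inl a, .inl b => fourVertex.Adj a b ∨ (a, b) ∈ E
    | .inl a, .inr _ => a = 0 ∨ a = 1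
    | .inr _, .inl b => b = 0 ∨ b = 1
    | .inr x, .inr y => (complete (Fin n)).Adj x y

/-- The exceptional digraph on seven vertices: a vertex `0` joined by both arcs to the vertices of
the directed triangle `1 → 2 → 3 → 1`; a complete digraph on `4, 5, 6`; and the arcs
`1 → 4 → 2`, `2 → 5 → 3`, `3 → 6 → 1`. -/
def sevenVertex : Digraph (Fin 7) where
  Adj u v := (u, v) ∈
    ([(0, 1), (1, 0), (0, 2), (2, 0), (0, 3), (3, 0),
      (1, 2), (2, 3), (3, 1),
      (4, 5), (5, 4), (5, 6), (6, 5), (4, 6), (6, 4),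
      (1, 4), (4, 2), (2, 5), (5, 3), (3, 6), (6, 1)] : List (Fin 7 × Fin 7))

/-- Two complete digraphs of the same order `n + 1`, `n ≥ 1`, sharing exactly one vertex. -/
def IsGluedCompleteEq {V : Type*} (D : Digraph V) : Prop :=
  ∃ n : ℕ, 1 ≤ n ∧ Isomorphic D (gluedComplete n n)

/-- `n + 1` independent vertices completely joined to an arbitrary simple digraph on `n ≥ 1`
vertices. -/
def IsIndependentJoin {V : Type*} (D : Digraph V) : Prop :=
  ∃ n : ℕ, 1 ≤ n ∧ ∃ H : Digraph (Fin n), Simple H ∧ Isomorphic D (independentJoin n H)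

/-- The digraphs on five vertices made of `fourVertex` and a single further vertex. -/
def IsFourVertexJoinOne {V : Type*} (D : Digraph V) : Prop :=
  ∃ E : Set (Fin 4 × Fin 4), E ⊆ {(0, 1), (1, 0)} ∧ Isomorphic D (fourVertexJoin 1 E)

end HamiltonDigraph

/-! Suppose `D` is not Hamiltonian, let `a` be its minimum out-degree and `b = |V| - 1 - a`. By
hypothesis all in-degrees are at least `b`; this is `Extremal`. Take a longest cycle `c`, of length
`m`, and a longest path `p 0, …, p l` among the vertices off it. The end of a longest path in `D`,
or in its reverse, has all its out-neighbours on that path, so `m ≥ max a b + 1`; as `m + l + 1 ≤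
|V| = a + b + 1`, it follows that `l < min a b`. Hence `p 0` has in-neighbours and `p l` has
out-neighbours on the cycle. Since `m` is maximal, `c (t - 1) → p 0` and `p l → c t` never hold
together, and some `l` consecutive positions are of neither kind. Counting gives `a + b ≤ m + l`, so
equality holds everywhere (`CyclePath.count`) and cycle and path exhaust `V`.

If `l ≥ 1`, the neighbours of the ends of `p` on the cycle form two intervals. Exchanging `p` with a
stretch of the cycle yields `m = a + 1`, and by reversal `m = b + 1` (`length_eq`, `eq_of_normal`).
So `m = l + 2`, and `D` consists of two complete digraphs sharing a vertex.

If `l = 0`, the missed vertex can replace a vertex of the cycle, which gives a `Frame` with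
interchangeable ends `e 0` and `e (M + 1)`. When a cycle misses just `u`, each of its arcs `(t, s)`
has exactly one of `t → u`, `u → s` (`Extremal.adj_or_adj`). If in every frame the in-neighbours of
`e (M + 1)` are the odd vertices, then rotating the frame makes every even vertex an end, and `D` is
an independent join. Any other frame leads by rotation or reversal to one without the arc `e 1 → e
(M + 1)`. Explicit Hamilton cycles and degree counts then force `M = 3` or `M = 5` and provide an
alternating frame (`alternating_of_star`). A finite analysis on 5 and 7 vertices finds the remaining
exceptions.

The exceptional digraphs are not Hamiltonian because of a cut vertex, a too large independent set,
or an exhaustive search. -/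

namespace HamiltonDigraph

/-! ### Paths as lists, and the cycles closing them -/

/-- There is a path from `s` to `t` for the relation `r` whose set of vertices is `P`. -/
def PathOn {α : Type*} (r : α → α → Prop) (s t : α) (P : α → Prop) : Prop :=
  ∃ l : List α, l.Nodup ∧ l.IsChain r ∧ l.head? = some s ∧ l.getLast? = some t ∧ ∀ x, x ∈ l ↔ P x

namespace PathOn

variable {α β : Type*} {r : α → α → Prop} {s t s' t' : α} {P Q : α → Prop}

theorem single (r : α → α → Prop) (s : α) : PathOn r s s (fun x => x = s) :=
  ⟨[s], by simp, by simp, by simp, by simp, by simp⟩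

theorem congr (h : PathOn r s t P) (hPQ : ∀ x, P x ↔ Q x) : PathOn r s t Q := by
  obtain ⟨l, h1, h2, h3, h4, h5⟩ := h
  exact ⟨l, h1, h2, h3, h4, fun x => (h5 x).trans (hPQ x)⟩

theorem app (h : PathOn r s t P) (h' : PathOn r s' t' Q) (hr : r t s')
    (hd : ∀ x, P x → Q x → False) : PathOn r s t' (fun x => P x ∨ Q x) := by
  obtain ⟨l, h1, h2, h3, h4, h5⟩ := h
  obtain ⟨l', h1', h2', h3', h4', h5'⟩ := h'
  refine ⟨l ++ l', ?_, ?_, ?_, ?_, ?_⟩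
  · rw [List.nodup_append']
    exact ⟨h1, h1', fun x hx hx' => hd x ((h5 x).1 hx) ((h5' x).1 hx')⟩
  · rw [List.isChain_append]
    refine ⟨h2, h2', ?_⟩
    intro x hx y hy
    simp_all
  · simp [List.head?_append, h3]
  · simp [List.getLast?_append, h4']
  · intro x
    simp [h5, h5']

theorem seg {r : ℤ → ℤ → Prop} {i j : ℤ} (hij : i ≤ j) (h : ∀ k, i ≤ k → k < j → r k (k + 1)) :
    PathOn r i j (fun x => i ≤ x ∧ x ≤ j) := by
  induction j, hij using Int.leInduction with
  | base => exact (single r i).congr (fun x => by omega)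
  | succ j hj ih =>
    exact ((ih (fun k h1 h2 => h k h1 (by omega))).app (single r (j + 1)) (h j hj (by omega))
      (by intro x; omega)).congr (fun x => by omega)

theorem map {R : β → β → Prop} {e : α → β} (h : PathOn (fun i j => R (e i) (e j)) s t P)
    (he : ∀ x y, P x → P y → e x = e y → x = y) :
    PathOn R (e s) (e t) (fun y => ∃ x, P x ∧ e x = y) := by
  obtain ⟨l, h1, h2, h3, h4, h5⟩ := h
  refine ⟨l.map e, ?_, ?_, ?_, ?_, ?_⟩
  · exact (List.nodup_map_iff_inj_on h1).2
      (fun x hx y hy => he x y ((h5 x).1 hx) ((h5 y).1 hy))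
  · rw [List.isChain_map]; exact h2
  · simp [h3]
  · simp [h4]
  · intro y
    simp [h5]

/-- A path closed up by an arc is a directed cycle. -/
theorem exists_cycle (h : PathOn r s t P) (hts : r t s) (hst : s ≠ t) :
    ∃ (k : ℕ) (f : ZMod k → α), 2 ≤ k ∧ k = {x | P x}.ncard ∧ Function.Injective f ∧
      (∀ i, r (f i) (f (i + 1))) ∧ f 0 = s ∧ f (-1) = t ∧ ∀ x, P x ↔ ∃ i, f i = x := by
  obtain ⟨l, h1, h2, h3, h4, h5⟩ := h
  have hl : 2 ≤ l.length := by
    rcases l with _ | ⟨x, _ | ⟨y, l⟩⟩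
    · simp at h3
    · simp at h3 h4; exact absurd (h3.symm.trans h4) hst
    · simp
  obtain ⟨k, hk⟩ : ∃ k, l.length = k + 1 := ⟨l.length - 1, by omega⟩
  have h0 : l[0] = s := by
    rw [List.head?_eq_getElem?, List.getElem?_eq_getElem (by omega)] at h3
    exact Option.some.inj h3
  have hL : l[k] = t := by
    rw [List.getLast?_eq_getElem?, List.getElem?_eq_getElem (by omega)] at h4
    simpa [hk] using Option.some.inj h4
  have hlt : ∀ i : ZMod (k + 1), i.val < l.length := fun i => by
    rw [hk]; exact ZMod.val_lt i
  have hval : ((-1 : ZMod (k + 1))).val = k := ZMod.val_neg_one k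
  refine ⟨k + 1, fun i => l[i.val]'(hlt i), by omega, ?_, ?_, ?_, ?_, ?_, ?_⟩
  · classical
    have : {x | P x} = (l.toFinset : Set α) := by ext x; simp [h5]
    rw [this, Set.ncard_coe_finset, List.toFinset_card_of_nodup h1, hk]
  · intro i j hij
    have := (List.Nodup.getElem_inj_iff h1).1 hij
    exact ZMod.val_injective _ this
  · intro i
    -- The index `k` is `-1` in `ZMod (k + 1)`; only there does the step wrap around and use the
    -- closing arc.
    by_cases hi : i.val = k
    · have : i = -1 := ZMod.val_injective _ (by rw [hi, hval])
      subst this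
      simp only [hval, neg_add_cancel, ZMod.val_zero, h0, hL, hts]
    · have hik : i.val < k := by have := hlt i; omega
      have hv : (i + 1).val = i.val + 1 := by
        rw [ZMod.val_add, ZMod.val_one'' (by omega), Nat.mod_eq_of_lt (by omega)]
      simp only [hv]
      exact List.isChain_iff_getElem.1 h2 _ (by omega)
  · simp [h0]
  · simp only [hval, hL]
  · intro x
    rw [← h5, List.mem_iff_getElem]
    constructor
    · rintro ⟨i, hi, rfl⟩
      refine ⟨(i : ZMod (k + 1)), ?_⟩
      simp only [ZMod.val_cast_of_lt (show i < k + 1 by omega)]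
    · rintro ⟨i, rfl⟩
      exact ⟨_, _, rfl⟩

end PathOn

/-! ### Extremal digraphs and cycles missing one vertex -/

section Cycle

variable {V : Type*} {D : Digraph V}

theorem PathOn.hasHamiltonCycle {s t : V} {P : V → Prop} (h : PathOn D.Adj s t P)
    (hts : D.Adj t s) (hst : s ≠ t) (hP : ∀ x, P x) : HasHamiltonCycle D := by
  obtain ⟨k, f, h2, -, hf, hadj, -, -, hsurj⟩ := h.exists_cycle hts hst
  exact ⟨k, f, ⟨h2, hf, hadj⟩, fun x => (hsurj x).1 (hP x)⟩

/-- The digraph with all arcs reversed. -/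
def rev (D : Digraph V) : Digraph V where
  Adj u v := D.Adj v u

theorem hasHamiltonCycle_of_rev (h : HasHamiltonCycle (rev D)) : HasHamiltonCycle D := by
  obtain ⟨k, f, ⟨h2, hf, hadj⟩, hs⟩ := h
  refine ⟨k, fun i => f (-i), ⟨h2, hf.comp neg_injective, fun i => ?_⟩, hs.comp neg_surjective⟩
  have := hadj (-(i + 1))
  simpa [rev, neg_add] using this

variable [Fintype V]

theorem card_out_add_card_not (D : Digraph V) (u : V) :
    outDegree D u + {w | ¬ D.Adj u w}.ncard = Fintype.card V := by
  rw [← Nat.card_eq_fintype_card]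
  exact Set.ncard_add_ncard_compl _

theorem card_in_add_card_not (D : Digraph V) (u : V) :
    inDegree D u + {w | ¬ D.Adj w u}.ncard = Fintype.card V := by
  rw [← Nat.card_eq_fintype_card]
  exact Set.ncard_add_ncard_compl _

/-- A non-Hamiltonian loopless digraph on `a + b + 1` vertices with all out-degrees at least `a`
and all in-degrees at least `b`. -/
structure Extremal (D : Digraph V) (a b : ℤ) : Prop where
  irrefl : ∀ v, ¬ D.Adj v v
  card : (Fintype.card V : ℤ) = a + b + 1
  out : ∀ v, a ≤ outDegree D v
  inn : ∀ v, b ≤ inDegree D v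
  non : ¬ HasHamiltonCycle D

theorem Extremal.rev {a b : ℤ} (h : Extremal D a b) : Extremal (rev D) b a where
  irrefl := h.irrefl
  card := by rw [h.card]; ring
  out := h.inn
  inn := h.out
  non := fun h' => h.non (hasHamiltonCycle_of_rev h')

/-- If a cycle misses just one vertex `u`, then for each arc `(t, s)` of the cycle one of the arcs
`(t, u)` and `(u, s)` is present. -/
theorem Extremal.adj_or_adj {a b : ℤ} (hE : Extremal D a b) {s t u : V} {P : V → Prop}
    (h : PathOn D.Adj s t P) (hts : D.Adj t s) (hP : ∀ x, P x ↔ x ≠ u) :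
    D.Adj t u ∨ D.Adj u s := by
  classical
  have hst : s ≠ t := fun e => hE.irrefl s (by rw [e] at hts; rwa [e])
  obtain ⟨k, f, h2, hk, hf, hadj, hf0, hf1, hsurj⟩ := h.exists_cycle hts hst
  have : NeZero k := ⟨by omega⟩
  have hfu : ∀ i, f i ≠ u := fun i => (hP _).1 ((hsurj _).2 ⟨i, rfl⟩)
  have hex : ∀ x, x ≠ u → ∃ i, f i = x := fun x hx => (hsurj x).1 ((hP x).2 hx)
  have hcard : Fintype.card V = k + 1 := by
    have h1 : {x | P x} = ({u} : Set V)ᶜ := by ext x; simp [hP]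
    have h3 := Set.ncard_add_ncard_compl ({u} : Set V)
    rw [← h1, ← hk, Set.ncard_singleton, Nat.card_eq_fintype_card] at h3
    omega
  -- Otherwise `u` fits between `f i` and `f (i + 1)`: the cycle is cut open at that arc, run once
  -- around from `f (i + 1)` to `f i`, and closed through `u`.
  have hno : ∀ i, D.Adj (f i) u → ¬ D.Adj u (f (i + 1)) := by
    intro i hi hi'
    apply hE.non
    have hp : PathOn D.Adj (f (i + 1)) (f i) (fun x => x ≠ u) := by
      have hr := PathOn.map (R := D.Adj) (e := fun z : ℤ => f (i + 1 + (z : ZMod k)))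
        (PathOn.seg (r := fun x y : ℤ => D.Adj (f (i + 1 + (x : ZMod k))) (f (i + 1 + (y : ZMod k))))
          (i := 0) (j := (k : ℤ) - 1)
          (by omega) (fun z _ _ => by have := hadj (i + 1 + z); push_cast; rwa [← add_assoc]))
        (by
          intro x y hx hy hxy
          have h1 := hf hxy
          have h3 : ((x : ℤ) : ZMod k) = (y : ℤ) := add_left_cancel h1
          rw [ZMod.intCast_eq_intCast_iff_dvd_sub] at h3
          obtain ⟨d, hd⟩ := h3
          have hd0 : d = 0 := by
            by_contra hne
            have : (k : ℤ) ≤ |y - x| := by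
              rw [hd, abs_mul, Nat.abs_cast]
              have := Int.one_le_abs hne
              nlinarith
            have := abs_lt.2 (show -(k : ℤ) < y - x ∧ y - x < k by omega)
            omega
          rw [hd0] at hd; omega)
      have e0 : f (i + 1 + ((0 : ℤ) : ZMod k)) = f (i + 1) := by simp
      have e1 : f (i + 1 + (((k : ℤ) - 1 : ℤ) : ZMod k)) = f i := by simp
      simp only [e0, e1] at hr
      refine hr.congr (fun x => ⟨?_, fun hx => ?_⟩)
      · rintro ⟨z, -, rfl⟩; exact hfu _
      · obtain ⟨j, rfl⟩ := hex x hx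
        refine ⟨((j - (i + 1)).val : ℤ), ⟨by positivity, ?_⟩, ?_⟩
        · have := ZMod.val_lt (j - (i + 1)); omega
        · simp
    refine (hp.app (PathOn.single _ u) hi (fun x h1 h2 => h1 h2)).hasHamiltonCycle hi' (hfu _)
      (fun x => ?_)
    tauto
  by_contra hcon
  push Not at hcon
  -- By `hno` the sets `A + 1` and `B` are disjoint. The arc `(t, s)` goes from index `-1` to index
  -- `0`, so if both arcs at `u` are missing then `0` lies in neither set and `|A| + |B| < k = |V| -
  -- 1 = a + b`, against the degree bounds at `u`.
  set A : Finset (ZMod k) := Finset.univ.filter (fun i => D.Adj (f i) u)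
  set B : Finset (ZMod k) := Finset.univ.filter (fun i => D.Adj u (f i))
  have hA : inDegree D u = A.card := by
    rw [← Finset.card_image_of_injective A hf, inDegree, ← Set.ncard_coe_finset]
    congr 1
    ext x
    simp only [Set.mem_ofPred_eq, Finset.coe_image, Set.mem_image, A, Finset.coe_filter,
      Finset.mem_univ, true_and]
    constructor
    · intro hx
      obtain ⟨j, rfl⟩ := hex x (fun e => hE.irrefl u (by rwa [e] at hx))
      exact ⟨j, hx, rfl⟩
    · rintro ⟨j, hj, rfl⟩; exact hj
  have hB : outDegree D u = B.card := by
    rw [← Finset.card_image_of_injective B hf, outDegree, ← Set.ncard_coe_finset]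
    congr 1
    ext x
    simp only [Set.mem_ofPred_eq, Finset.coe_image, Set.mem_image, B, Finset.coe_filter,
      Finset.mem_univ, true_and]
    constructor
    · intro hx
      obtain ⟨j, rfl⟩ := hex x (fun e => hE.irrefl u (by rwa [e] at hx))
      exact ⟨j, hx, rfl⟩
    · rintro ⟨j, hj, rfl⟩; exact hj
  have hd : Disjoint (A.image (· + 1)) B := by
    rw [Finset.disjoint_left]
    intro x hx hx'
    simp only [Finset.mem_image, A, B, Finset.mem_filter, Finset.mem_univ, true_and] at hx hx'
    obtain ⟨j, hj, rfl⟩ := hx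
    exact hno j hj hx'
  have h0 : (0 : ZMod k) ∉ A.image (· + 1) ∪ B := by
    simp only [Finset.mem_union, Finset.mem_image, A, B, Finset.mem_filter, Finset.mem_univ,
      true_and, not_or, not_exists, not_and]
    refine ⟨fun x hx hx' => ?_, by rw [hf0]; exact hcon.2⟩
    have : x = -1 := eq_neg_of_add_eq_zero_left hx'
    rw [this, hf1] at hx
    exact hcon.1 hx
  have hlt : (A.image (· + 1) ∪ B).card < k := by
    have := Finset.card_lt_univ_of_notMem h0
    rwa [ZMod.card] at this
  rw [Finset.card_union_of_disjoint hd, Finset.card_image_of_injective _ (add_left_injective 1)]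
    at hlt
  have h3 := hE.out u
  have h4 := hE.inn u
  have h5 := hE.card
  rw [hB] at h3
  rw [hA] at h4
  omega

end Cycle

end HamiltonDigraph
namespace HamiltonDigraph

/-! ### Counting tools -/

section Counting

theorem card_le_length {Z : Finset ℤ} {Y : List ℤ} (h : ∀ k ∈ Z, k ∈ Y) : Z.card ≤ Y.length :=
  (Finset.card_le_card (fun k hk => List.mem_toFinset.2 (h k hk))).trans (List.toFinset_card_le Y)

theorem length_le_card {Z : Finset ℤ} {X : List ℤ} (hX : X.Nodup) (h : ∀ k ∈ X, k ∈ Z) :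
    X.length ≤ Z.card := by
  rw [← List.toFinset_card_of_nodup hX]
  exact Finset.card_le_card (fun k hk => h k (List.mem_toFinset.1 hk))

/-- `X` and `Z \ Y` are disjoint subsets of `T`. In applications `Z` has known cardinality, `Y`
lists the exceptions to `Z ⊆ T`, and `X` lists additional elements of `T`. -/
theorem length_add_card_le {Z T : Finset ℤ} {X Y : List ℤ} (hX : X.Nodup)
    (h1 : ∀ k ∈ X, k ∈ T ∧ (k ∈ Z → k ∈ Y)) (h2 : ∀ k ∈ Z, k ∉ Y → k ∈ T) :
    X.length + Z.card ≤ T.card + Y.length := by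
  have hsub : X.toFinset ∪ (Z \ Y.toFinset) ⊆ T := by
    intro k hk
    rcases Finset.mem_union.1 hk with hk | hk
    · exact (h1 k (List.mem_toFinset.1 hk)).1
    · rw [Finset.mem_sdiff, List.mem_toFinset] at hk
      exact h2 k hk.1 hk.2
  have hd : Disjoint X.toFinset (Z \ Y.toFinset) := by
    rw [Finset.disjoint_left]
    intro k hk hk'
    rw [Finset.mem_sdiff, List.mem_toFinset] at hk'
    exact hk'.2 ((h1 k (List.mem_toFinset.1 hk)).2 hk'.1)
  have h3 := Finset.card_le_card hsub
  rw [Finset.card_union_of_disjoint hd, List.toFinset_card_of_nodup hX] at h3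
  have h4 := Finset.le_card_sdiff Y.toFinset Z
  have h5 := List.toFinset_card_le Y
  omega

/-- A predicate that changes from true to false does so at some step. -/
theorem exists_descent {p : ℤ → Prop} {i k : ℤ} (hik : i ≤ k) (hi : p i) (hk : ¬ p k) :
    ∃ j, i ≤ j ∧ j < k ∧ p j ∧ ¬ p (j + 1) := by
  by_contra hcon
  push Not at hcon
  have : ∀ l, i ≤ l → l ≤ k → p l := by
    intro l hl
    induction l, hl using Int.leInduction with
    | base => exact fun _ => hi
    | succ l hl ih => exact fun h => hcon l hl (by omega) (ih (by omega))
  exact hk (this k hik le_rfl)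

end Counting

/-! ### Frames: basic relations, counts and symmetries -/

variable {V : Type*} [Fintype V] {D : Digraph V} {a b M : ℤ} {e : ℤ → V}

/-- An enumeration `e 0, …, e (M + 1)` of the vertices for which both `e 0, e 1, …, e M` and
`e 1, …, e M, e (M + 1)` are directed cycles, as well as `e 0, …, e (M + 1)` being a path. -/
structure Frame (D : Digraph V) (M : ℤ) (e : ℤ → V) : Prop where
  pos : 1 ≤ M
  inj : ∀ i j, 0 ≤ i → i ≤ M + 1 → 0 ≤ j → j ≤ M + 1 → e i = e j → i = j
  card : (Fintype.card V : ℤ) = M + 2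
  step : ∀ i, 0 ≤ i → i ≤ M → D.Adj (e i) (e (i + 1))
  last : D.Adj (e M) (e 0)
  first : D.Adj (e (M + 1)) (e 1)

namespace Frame

theorem image_univ (hF : Frame D M e) [DecidableEq V] :
    (Finset.Icc 0 (M + 1)).image e = Finset.univ := by
  apply Finset.eq_univ_of_card
  rw [Finset.card_image_of_injOn, Int.card_Icc]
  · have := hF.card; omega
  · intro i hi j hj hij
    simp only [Finset.coe_Icc, Set.mem_Icc] at hi hj
    exact hF.inj i j hi.1 hi.2 hj.1 hj.2 hij

theorem surj (hF : Frame D M e) (x : V) : ∃ i, 0 ≤ i ∧ i ≤ M + 1 ∧ e i = x := by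
  classical
  have hx := Finset.mem_univ x
  rw [← hF.image_univ, Finset.mem_image] at hx
  obtain ⟨i, hi, rfl⟩ := hx
  rw [Finset.mem_Icc] at hi
  exact ⟨i, hi.1, hi.2, rfl⟩

theorem seg (hF : Frame D M e) {i j : ℤ} (hi : 0 ≤ i) (hij : i ≤ j) (hj : j ≤ M + 1) :
    PathOn (fun x y => D.Adj (e x) (e y)) i j (fun x => i ≤ x ∧ x ≤ j) :=
  PathOn.seg hij (fun k h1 h2 => hF.step k (by omega) (by omega))

theorem ham (hF : Frame D M e) (hE : Extremal D a b) {s t : ℤ} {P : ℤ → Prop}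
    (h : PathOn (fun x y => D.Adj (e x) (e y)) s t P) (hP : ∀ x, P x ↔ 0 ≤ x ∧ x ≤ M + 1) :
    ¬ D.Adj (e t) (e s) := by
  intro hts
  refine hE.non ((h.map (fun x y hx hy => ?_)).hasHamiltonCycle hts ?_ (fun x => ?_))
  · exact hF.inj x y ((hP x).1 hx).1 ((hP x).1 hx).2 ((hP y).1 hy).1 ((hP y).1 hy).2
  · intro h; rw [h] at hts; exact hE.irrefl _ hts
  · obtain ⟨i, h0, h1, rfl⟩ := hF.surj x
    exact ⟨i, (hP i).2 ⟨h0, h1⟩, rfl⟩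

theorem insert (hF : Frame D M e) (hE : Extremal D a b) {s t u : ℤ} {P : ℤ → Prop}
    (h : PathOn (fun x y => D.Adj (e x) (e y)) s t P) (hts : D.Adj (e t) (e s))
    (hu : 0 ≤ u ∧ u ≤ M + 1) (hP : ∀ x, P x ↔ 0 ≤ x ∧ x ≤ M + 1 ∧ x ≠ u) :
    D.Adj (e t) (e u) ∨ D.Adj (e u) (e s) := by
  refine hE.adj_or_adj (h.map (fun x y hx hy => ?_)) hts (fun x => ?_)
  · have := (hP x).1 hx
    have := (hP y).1 hy
    exact hF.inj x y (by omega) (by omega) (by omega) (by omega)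
  · constructor
    · rintro ⟨i, hi, rfl⟩ hiu
      have := (hP i).1 hi
      exact this.2.2 (hF.inj i u (by omega) (by omega) (by omega) (by omega) hiu)
    · intro hx
      obtain ⟨i, h0, h1, rfl⟩ := hF.surj x
      exact ⟨i, (hP i).2 ⟨h0, h1, fun h => hx (by rw [h])⟩, rfl⟩

theorem M_eq (hF : Frame D M e) (hE : Extremal D a b) : M = a + b - 1 := by
  have := hF.card
  have := hE.card
  omega

/-- Each vertex has at least `a` out-neighbours among `a + b + 1` vertices; the bound `b + 1`
includes `e i` itself. -/
theorem card_nonout (hF : Frame D M e) (hE : Extremal D a b) (i : ℤ) {T : Finset ℤ}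
    (hT : ∀ k ∈ T, 0 ≤ k ∧ k ≤ M + 1 ∧ ¬ D.Adj (e i) (e k)) : (T.card : ℤ) ≤ b + 1 := by
  classical
  have h1 := card_out_add_card_not D (e i)
  have h2 : T.card ≤ {w | ¬ D.Adj (e i) w}.ncard := by
    rw [← Finset.card_image_of_injOn (s := T) (f := e), ← Set.ncard_coe_finset]
    · refine Set.ncard_le_ncard (fun x hx => ?_) (Set.toFinite _)
      rw [Finset.mem_coe, Finset.mem_image] at hx
      obtain ⟨k, hk, rfl⟩ := hx
      exact (hT k hk).2.2
    · intro x hx y hy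
      exact hF.inj x y (hT x hx).1 (hT x hx).2.1 (hT y hy).1 (hT y hy).2.1
  have h3 := hE.out (e i)
  have h4 := hE.card
  omega

/-- The successors of `A \ Y` and the indices in `X` are distinct non-out-neighbours of `e i`, so `b
- |Y| + |X| ≤ b + 1`. It serves to refute configurations with `|X| = |Y| + 2`, with `A` the
in-neighbours of an end of the frame. -/
theorem out_bound (hF : Frame D M e) (hE : Extremal D a b) (i : ℤ) {A : Finset ℤ}
    (hA : (A.card : ℤ) = b) (X Y : List ℤ) (hX : X.Nodup)
    (h1 : ∀ k ∈ X, (0 ≤ k ∧ k ≤ M + 1) ∧ ¬ D.Adj (e i) (e k) ∧ (k - 1 ∈ A → k - 1 ∈ Y))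
    (h2 : ∀ k ∈ A, k ∉ Y → (0 ≤ k + 1 ∧ k + 1 ≤ M + 1) ∧ ¬ D.Adj (e i) (e (k + 1))) :
    X.length ≤ Y.length + 1 := by
  classical
  have h3 := length_add_card_le (Z := A.image (· + 1)) (Y := Y.map (· + 1))
    (T := (Finset.Icc 0 (M + 1)).filter (fun k => ¬ D.Adj (e i) (e k))) hX
    (by
      intro k hk
      obtain ⟨h3, h4, h5⟩ := h1 k hk
      refine ⟨by simpa using ⟨h3, h4⟩, fun hk' => ?_⟩
      obtain ⟨l, hl, rfl⟩ := Finset.mem_image.1 hk'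
      simp only [add_sub_cancel_right] at h5
      exact List.mem_map_of_mem (h5 hl))
    (by
      intro k hk hk'
      obtain ⟨l, hl, rfl⟩ := Finset.mem_image.1 hk
      obtain ⟨h3, h4⟩ := h2 l hl (fun h => hk' (List.mem_map_of_mem h))
      simp only [Finset.mem_filter, Finset.mem_Icc]
      exact ⟨h3, h4⟩)
  have h4 := hF.card_nonout hE i
    (T := (Finset.Icc 0 (M + 1)).filter (fun k => ¬ D.Adj (e i) (e k)))
    (by
      intro k hk
      simp only [Finset.mem_filter, Finset.mem_Icc] at hk
      exact ⟨hk.1.1, hk.1.2, hk.2⟩)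
  rw [Finset.card_image_of_injective _ (add_left_injective 1), List.length_map] at h3
  omega

/-- The frame of the reversed digraph. -/
theorem reverse (hF : Frame D M e) : Frame (rev D) M (fun i => e (M + 1 - i)) where
  pos := hF.pos
  inj i j h1 h2 h3 h4 h := by
    have := hF.inj _ _ (by omega) (by omega) (by omega) (by omega) h
    omega
  card := hF.card
  step i h1 h2 := by
    have := hF.step (M + 1 - (i + 1)) (by omega) (by omega)
    rwa [show M + 1 - (i + 1) + 1 = M + 1 - i by ring] at this
  last := by
    have := hF.first
    simpa [rev] using this
  first := by
    have := hF.last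
    simpa [rev] using this

/-- The in-degree analogue of `out_bound`: a vertex has at most `a + 1` non-in-neighbours, so `a - 1
- |Y| + |X| ≤ a + 1`. Here `Z` is not shifted. -/
theorem in_bound (hF : Frame D M e) (hE : Extremal D a b) (i : ℤ) {Z : Finset ℤ}
    (hZ : (Z.card : ℤ) = a - 1) (X Y : List ℤ) (hX : X.Nodup)
    (h1 : ∀ k ∈ X, (0 ≤ k ∧ k ≤ M + 1) ∧ ¬ D.Adj (e k) (e i) ∧ (k ∈ Z → k ∈ Y))
    (h2 : ∀ k ∈ Z, k ∉ Y → (0 ≤ k ∧ k ≤ M + 1) ∧ ¬ D.Adj (e k) (e i)) :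
    X.length ≤ Y.length + 2 := by
  classical
  have h3 := length_add_card_le (Z := Z) (Y := Y)
    (T := (Finset.Icc 0 (M + 1)).filter (fun k => ¬ D.Adj (e k) (e i))) hX
    (by
      intro k hk
      obtain ⟨h3, h4, h5⟩ := h1 k hk
      exact ⟨by simpa using ⟨h3, h4⟩, h5⟩)
    (by
      intro k hk hk'
      obtain ⟨h3, h4⟩ := h2 k hk hk'
      simpa using ⟨h3, h4⟩)
  have h4 := hF.reverse.card_nonout hE.rev (M + 1 - i)
    (T := ((Finset.Icc 0 (M + 1)).filter (fun k => ¬ D.Adj (e k) (e i))).image (fun k => M + 1 - k))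
    (by
      intro k hk
      simp only [Finset.mem_image, Finset.mem_filter, Finset.mem_Icc] at hk
      obtain ⟨l, ⟨⟨h1, h2⟩, h3⟩, rfl⟩ := hk
      refine ⟨by omega, by omega, ?_⟩
      simpa [rev] using h3)
  rw [Finset.card_image_of_injective _ (sub_right_injective)] at h4
  omega

/-- Exchanging the two extreme vertices. -/
theorem swap (hF : Frame D M e) :
    Frame D M (fun i => if i = 0 then e (M + 1) else if i = M + 1 then e 0 else e i) := by
  have hpos := hF.pos
  have key : (fun i => if i = 0 then e (M + 1) else if i = M + 1 then e 0 else e i) =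
      e ∘ (fun i => if i = 0 then M + 1 else if i = M + 1 then 0 else i) := by
    funext i; simp only [Function.comp]; split_ifs <;> rfl
  refine ⟨hpos, ?_, hF.card, ?_, ?_, ?_⟩
  · intro i j h1 h2 h3 h4 h
    have h := (congrFun key i).symm.trans (h.trans (congrFun key j))
    have := hF.inj _ _ (by dsimp only; split_ifs <;> omega) (by dsimp only; split_ifs <;> omega)
      (by dsimp only; split_ifs <;> omega) (by dsimp only; split_ifs <;> omega) h
    dsimp only at this
    split_ifs at this <;> omega
  · intro i h1 h2
    rcases eq_or_ne i 0 with rfl | h0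
    · rw [if_pos rfl, if_neg (by omega), if_neg (by omega)]
      exact hF.first
    · rcases eq_or_ne i M with rfl | hM
      · rw [if_neg (by omega), if_neg (by omega), if_neg (by omega), if_pos rfl]
        exact hF.last
      · rw [if_neg (by omega), if_neg (by omega), if_neg (by omega), if_neg (by omega)]
        exact hF.step i h1 h2
  · rw [if_neg (by omega), if_neg (by omega), if_pos rfl]
    exact hF.step M (by omega) le_rfl
  · rw [if_neg (by omega), if_pos rfl, if_neg (by omega), if_neg (by omega)]
    exact hF.step 0 le_rfl (by omega)

/-- The arc would close the Hamilton cycle `e 0, e (M + 1), e 1, …, e M`. -/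
theorem not_adj_zero_last (hF : Frame D M e) (hE : Extremal D a b) :
    ¬ D.Adj (e 0) (e (M + 1)) := by
  have hM := hF.pos
  intro h
  refine hF.ham hE (((PathOn.single _ 0).app (PathOn.single _ (M + 1)) h (by intro x; omega)).app
    (hF.seg (i := 1) (j := M) (by omega) (by omega) (by omega)) hF.first (by intro x; omega))
    (by intro x; omega) hF.last

theorem not_adj_last_zero (hF : Frame D M e) (hE : Extremal D a b) :
    ¬ D.Adj (e (M + 1)) (e 0) := by
  have h := hF.swap.not_adj_zero_last hE
  have := hF.pos
  simpa [show M + 1 ≠ 0 by omega] using h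

/-- The cycle `e (i + 1), …, e M, e 0, …, e i` misses only `e (M + 1)`. With both arcs this vertex
could be inserted between `e i` and `e (i + 1)`; having neither is excluded by
`Extremal.adj_or_adj`. -/
theorem adj_last_iff (hF : Frame D M e) (hE : Extremal D a b) {i : ℤ} (h0 : 0 ≤ i) (hi : i < M) :
    D.Adj (e i) (e (M + 1)) ↔ ¬ D.Adj (e (M + 1)) (e (i + 1)) := by
  have h := (hF.seg (i := i + 1) (j := M) (by omega) (by omega) (by omega)).app
    (hF.seg (i := 0) (j := i) (by omega) (by omega) (by omega)) hF.last (by intro x; omega)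
  constructor
  · intro h1
    exact hF.ham hE (h.app (PathOn.single _ (M + 1)) h1 (by intro x; omega)) (by intro x; omega)
  · intro h1
    exact (hF.insert hE h (hF.step i h0 (by omega)) (u := M + 1) (by omega)
      (by intro x; omega)).resolve_right h1

theorem adj_zero_iff (hF : Frame D M e) (hE : Extremal D a b) {i : ℤ} (h0 : 1 ≤ i) (hi : i < M) :
    D.Adj (e i) (e 0) ↔ ¬ D.Adj (e 0) (e (i + 1)) := by
  have h := hF.swap.adj_last_iff hE (i := i) (by omega) hi
  simpa [show i ≠ 0 by omega, show i ≠ M + 1 by omega, show i + 1 ≠ 0 by omega,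
    show M + 1 ≠ 0 by omega, show i ≠ M by omega] using h

open Classical in
/-- The indices `i` in `[1, M]` with an arc from `e i` to `e u`. -/
noncomputable def inIdx (D : Digraph V) (M : ℤ) (e : ℤ → V) (u : ℤ) : Finset ℤ :=
  (Finset.Icc 1 M).filter (fun i => D.Adj (e i) (e u))

open Classical in
/-- The indices `i` in `[1, M]` without an arc from `e i` to `e u`. -/
noncomputable def noninIdx (D : Digraph V) (M : ℤ) (e : ℤ → V) (u : ℤ) : Finset ℤ :=
  (Finset.Icc 1 M).filter (fun i => ¬ D.Adj (e i) (e u))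

omit [Fintype V] in
theorem mem_inIdx {u k : ℤ} : k ∈ inIdx D M e u ↔ (1 ≤ k ∧ k ≤ M) ∧ D.Adj (e k) (e u) := by
  simp [inIdx]

omit [Fintype V] in
theorem mem_noninIdx {u k : ℤ} :
    k ∈ noninIdx D M e u ↔ (1 ≤ k ∧ k ≤ M) ∧ ¬ D.Adj (e k) (e u) := by
  simp [noninIdx]

theorem card_inIdx_add (hF : Frame D M e) (u : ℤ) :
    ((inIdx D M e u).card : ℤ) + (noninIdx D M e u).card = M := by
  classical
  have h := Finset.card_filter_add_card_filter_not (s := Finset.Icc 1 M)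
    (fun i => D.Adj (e i) (e u))
  rw [Int.card_Icc] at h
  have := hF.pos
  unfold inIdx noninIdx
  zify at h
  convert h using 1
  omega

/-- All in-neighbours of `e (M + 1)` have index in `[1, M]`, so there are at least `b`. Conversely
their successors, together with `e 0` and `e (M + 1)`, are non-out-neighbours of `e (M + 1)`, of
which there are at most `b + 1`; only `M + 1` may be counted twice, as the successor of `M`. -/
theorem card_inIdx_last (hF : Frame D M e) (hE : Extremal D a b) :
    ((inIdx D M e (M + 1)).card : ℤ) = b := by
  classical
  have hM := hF.M_eq hE
  have hpos := hF.pos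
  have h1 := card_in_add_card_not D (e (M + 1))
  have hin : b ≤ (inIdx D M e (M + 1)).card := by
    have h2 := hE.inn (e (M + 1))
    have h3 : inDegree D (e (M + 1)) ≤ (inIdx D M e (M + 1)).card := by
      rw [inDegree, ← Finset.card_image_of_injOn (s := inIdx D M e (M + 1)) (f := e),
        ← Set.ncard_coe_finset]
      · refine Set.ncard_le_ncard (fun x hx => ?_) (Set.toFinite _)
        obtain ⟨i, h3, h4, rfl⟩ := hF.surj x
        rw [Finset.mem_coe, Finset.mem_image]
        refine ⟨i, mem_inIdx.2 ⟨⟨?_, ?_⟩, hx⟩, rfl⟩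
        · by_contra hlt
          obtain rfl : i = 0 := by omega
          exact hF.not_adj_zero_last hE hx
        · by_contra hlt
          obtain rfl : i = M + 1 := by omega
          exact hE.irrefl _ hx
      · intro x hx y hy
        rw [Finset.mem_coe, mem_inIdx] at hx hy
        exact hF.inj x y (by omega) (by omega) (by omega) (by omega)
    omega
  have hcard := hF.card_inIdx_add (M + 1)
  have hnon : a - 1 ≤ (noninIdx D M e (M + 1)).card := by
    have hA : (((inIdx D M e (M + 1)).card : ℤ) = b) ∨ ((inIdx D M e (M + 1)).card : ℤ) > b := by
      omega
    have h2 := length_add_card_le (Z := (inIdx D M e (M + 1)).image (· + 1)) (X := [M + 1, 0])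
      (Y := [M + 1]) (T := (Finset.Icc 0 (M + 1)).filter (fun k => ¬ D.Adj (e (M + 1)) (e k)))
      (by simp; omega)
      (by
        intro k hk
        simp only [List.mem_cons, List.not_mem_nil, or_false] at hk
        rcases hk with rfl | rfl
        · simp only [Finset.mem_filter, Finset.mem_Icc]
          exact ⟨⟨by omega, hE.irrefl _⟩, by simp⟩
        · simp only [Finset.mem_filter, Finset.mem_Icc]
          refine ⟨⟨by omega, hF.not_adj_last_zero hE⟩, ?_⟩
          intro h
          obtain ⟨l, hl, hl'⟩ := Finset.mem_image.1 h
          rw [mem_inIdx] at hl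
          omega)
      (by
        intro k hk hk'
        obtain ⟨l, hl, rfl⟩ := Finset.mem_image.1 hk
        rw [mem_inIdx] at hl
        simp only [List.mem_cons, List.not_mem_nil, or_false] at hk'
        simp only [Finset.mem_filter, Finset.mem_Icc]
        exact ⟨by omega, (hF.adj_last_iff hE (by omega) (by omega)).1 hl.2⟩)
    have h3 := hF.card_nonout hE (M + 1)
      (T := (Finset.Icc 0 (M + 1)).filter (fun k => ¬ D.Adj (e (M + 1)) (e k)))
      (by
        intro k hk
        simp only [Finset.mem_filter, Finset.mem_Icc] at hk
        exact ⟨hk.1.1, hk.1.2, hk.2⟩)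
    rw [Finset.card_image_of_injective _ (add_left_injective 1)] at h2
    simp only [List.length_cons, List.length_nil] at h2
    omega
  omega

theorem card_noninIdx_last (hF : Frame D M e) (hE : Extremal D a b) :
    ((noninIdx D M e (M + 1)).card : ℤ) = a - 1 := by
  have := hF.card_inIdx_last hE
  have := hF.card_inIdx_add (M + 1)
  have := hF.M_eq hE
  omega

theorem card_inIdx_zero (hF : Frame D M e) (hE : Extremal D a b) :
    ((inIdx D M e 0).card : ℤ) = b := by
  rw [← hF.swap.card_inIdx_last hE]
  have hpos := hF.pos
  congr 2
  ext k
  rw [mem_inIdx, mem_inIdx]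
  refine and_congr_right (fun hk => ?_)
  simp [show k ≠ 0 by omega, show k ≠ M + 1 by omega, show M + 1 ≠ 0 by omega]

theorem card_noninIdx_zero (hF : Frame D M e) (hE : Extremal D a b) :
    ((noninIdx D M e 0).card : ℤ) = a - 1 := by
  have := hF.card_inIdx_zero hE
  have := hF.card_inIdx_add 0
  have := hF.M_eq hE
  omega

/-- The rotation of the cycle `e 0, …, e M` for which `e q` becomes the initial vertex. -/
theorem rotate (hF : Frame D M e) (hE : Extremal D a b) {q : ℤ} (h1 : 1 ≤ q) (hq : q < M)
    (hin : D.Adj (e (q - 1)) (e (M + 1))) (hnot : ¬ D.Adj (e q) (e (M + 1))) :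
    ∃ e', Frame D M e' ∧ (∀ i ≤ M - q, e' i = e (q + i)) ∧
      (∀ i, M - q < i → i ≤ M → e' i = e (q + i - (M + 1))) ∧ e' (M + 1) = e (M + 1) := by
  have key : (fun i => if i ≤ M - q then e (q + i) else if i ≤ M then e (q + i - (M + 1))
      else e i) = e ∘ (fun i => if i ≤ M - q then q + i else if i ≤ M then q + i - (M + 1)
      else i) := by
    funext i; simp only [Function.comp]; split_ifs <;> rfl
  obtain ⟨e', he'⟩ : ∃ e', e' = fun i => if i ≤ M - q then e (q + i) else if i ≤ M then
    e (q + i - (M + 1)) else e i := ⟨_, rfl⟩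
  have c1 : ∀ i ≤ M - q, e' i = e (q + i) := fun i hi => by rw [he']; exact if_pos hi
  have c2 : ∀ i, M - q < i → i ≤ M → e' i = e (q + i - (M + 1)) := fun i hi hi' => by
    rw [he']; dsimp only; rw [if_neg (by omega), if_pos hi']
  have c3 : e' (M + 1) = e (M + 1) := by
    rw [he']; dsimp only; rw [if_neg (by omega), if_neg (by omega)]
  refine ⟨e', ⟨hF.pos, ?_, hF.card, ?_, ?_, ?_⟩, c1, c2, c3⟩
  · intro i j h1 h2 h3 h4 h
    rw [he', key] at h
    have := hF.inj _ _ (by dsimp only; split_ifs <;> omega) (by dsimp only; split_ifs <;> omega)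
      (by dsimp only; split_ifs <;> omega) (by dsimp only; split_ifs <;> omega) h
    dsimp only at this
    split_ifs at this <;> omega
  · intro i h2 h3
    by_cases d1 : i + 1 ≤ M - q
    · rw [c1 i (by omega), c1 _ d1, ← add_assoc]
      exact hF.step (q + i) (by omega) (by omega)
    · by_cases d2 : i = M - q
      · rw [c1 i (by omega), c2 _ (by omega) (by omega), show q + i = M by omega,
          show q + (i + 1) - (M + 1) = 0 by omega]
        exact hF.last
      · by_cases d3 : i = M
        · rw [d3, c2 _ (by omega) (by omega), c3, show q + M - (M + 1) = q - 1 by omega]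
          exact hin
        · rw [c2 _ (by omega) (by omega), c2 _ (by omega) (by omega),
            show q + (i + 1) - (M + 1) = q + i - (M + 1) + 1 by omega]
          exact hF.step _ (by omega) (by omega)
  · rw [c1 0 (by omega), c2 _ (by omega) le_rfl, show q + M - (M + 1) = q - 1 by omega]
    have := hF.step (q - 1) (by omega) (by omega)
    rwa [show q - 1 + 1 = q + 0 by omega] at this
  -- The new initial vertex is `e q`, so the arc needed is `e (M + 1) → e (q + 1)`; `adj_last_iff`
  -- supplies it from `hnot`.
  · rw [c3, c1 1 (by omega)]
    by_contra h
    exact hnot ((hF.adj_last_iff hE (by omega) hq).2 h)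

/-- Replacing `e (j + 1)` by `e 0` in the cycle `e 1, …, e (M + 1)` and rotating it. -/
theorem shift (hF : Frame D M e) (hE : Extremal D a b) {j : ℤ} (h1 : 1 ≤ j)
    (hin : D.Adj (e j) (e 0)) (hnot : ¬ D.Adj (e (j + 1)) (e 0)) (hj : j + 1 < M) :
    ∃ e', Frame D M e' ∧ (∀ i, 0 ≤ i → i ≤ M - j → e' i = e (j + 1 + i)) ∧
      (∀ i, M - j < i → i ≤ M → e' i = e (i - (M - j))) ∧ e' (M + 1) = e 0 := by
  obtain ⟨e', hF', c1, c2, c3⟩ := hF.swap.rotate hE (q := j + 1) (by omega) (by omega)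
    (by simpa [show M + 1 ≠ 0 by omega, show j ≠ 0 by omega, show j ≠ M + 1 by omega] using hin)
    (by simpa [show M + 1 ≠ 0 by omega, show j + 1 ≠ 0 by omega, show j ≠ M by omega] using hnot)
  refine ⟨e', hF', fun i h2 h3 => ?_, fun i h2 h3 => ?_, ?_⟩
  · by_cases h4 : i = M - j
    · rw [c2 i (by omega) (by omega), if_pos (by omega), show j + 1 + i = M + 1 by omega]
    · rw [c1 i (by omega), if_neg (by omega), if_neg (by omega)]
  · rw [c2 i (by omega) (by omega), if_neg (by omega), if_neg (by omega),
      show j + 1 + i - (M + 1) = i - (M - j) by omega]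
  · rw [c3, if_neg (by omega), if_pos rfl]

end Frame

end HamiltonDigraph
-- Frames without the arc from `e 1` to `e (M + 1)`
namespace HamiltonDigraph
variable {V : Type*} [Fintype V] {D : Digraph V} {a b M : ℤ} {e : ℤ → V}
namespace Frame

theorem two_le (hF : Frame D M e) (h1 : ¬ D.Adj (e 1) (e (M + 1))) : 2 ≤ M := by
  have hpos := hF.pos
  by_contra h
  obtain rfl : M = 1 := by omega
  exact h1 (hF.step 1 (by omega) (by omega))

/-- By `adj_zero_iff`, `e 0 → e (j + 1)`. The arc `e j → e (i + 1)` would then give the Hamilton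
cycle `e 1, …, e j, e (i + 1), …, e M, e 0, e (j + 1), …, e i, e (M + 1)`. -/
theorem not_adj_of_zero_last (hF : Frame D M e) (hE : Extremal D a b) {i j : ℤ} (hj : 1 ≤ j)
    (hji : j < i) (hi : i < M) (h0 : ¬ D.Adj (e j) (e 0)) (h : D.Adj (e i) (e (M + 1))) :
    ¬ D.Adj (e j) (e (i + 1)) := by
  intro hjk
  have h0' : D.Adj (e 0) (e (j + 1)) := by
    by_contra hc
    exact h0 ((hF.adj_zero_iff hE hj (by omega)).2 hc)
  exact hF.ham hE (((((hF.seg (i := 1) (j := j) (by omega) (by omega) (by omega)).app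
    (hF.seg (i := i + 1) (j := M) (by omega) (by omega) (by omega)) hjk (by intro x; omega)).app
    (PathOn.single _ 0) hF.last (by intro x; omega)).app
    (hF.seg (i := j + 1) (j := i) (by omega) (by omega) (by omega)) h0' (by intro x; omega)).app
    (PathOn.single _ (M + 1)) h (by intro x; omega)) (by intro x; omega) hF.first

/-- The cycle of `not_adj_of_zero_last` with the two ends of the frame exchanged. -/
theorem not_adj_of_last_zero (hF : Frame D M e) (hE : Extremal D a b) {i j : ℤ} (hj : 1 ≤ j)
    (hji : j < i) (hi : i < M) (h0 : ¬ D.Adj (e j) (e (M + 1))) (h : D.Adj (e i) (e 0)) :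
    ¬ D.Adj (e j) (e (i + 1)) := by
  intro hjk
  have h0' : D.Adj (e (M + 1)) (e (j + 1)) := by
    by_contra hc
    exact h0 ((hF.adj_last_iff hE (by omega) (by omega)).2 hc)
  have h01 : D.Adj (e 0) (e 1) := hF.step 0 le_rfl (by omega)
  exact hF.ham hE (((((hF.seg (i := 1) (j := j) (by omega) (by omega) (by omega)).app
    (hF.seg (i := i + 1) (j := M) (by omega) (by omega) (by omega)) hjk (by intro x; omega)).app
    (PathOn.single _ (M + 1)) (hF.step M (by omega) le_rfl) (by intro x; omega)).app
    (hF.seg (i := j + 1) (j := i) (by omega) (by omega) (by omega)) h0' (by intro x; omega)).app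
    (PathOn.single _ 0) h (by intro x; omega)) (by intro x; omega) h01

/-- Otherwise `e 1` has too many non-out-neighbours: `e 0`, `e 1`, `e (M + 1)` and, by
`not_adj_of_last_zero`, the successors of the `b - 1` in-neighbours of `e 0` other than `e M`, in
total `b + 2`. -/
theorem one_adj_zero (hF : Frame D M e) (hE : Extremal D a b)
    (h1 : ¬ D.Adj (e 1) (e (M + 1))) : D.Adj (e 1) (e 0) := by
  have hM := hF.two_le h1
  by_contra h0
  have := hF.out_bound hE 1 (hF.card_inIdx_zero hE) [0, 1, M + 1] [M] (by simp; omega)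
    (by
      intro k hk
      simp only [List.mem_cons, List.not_mem_nil, or_false] at hk ⊢
      rcases hk with rfl | rfl | rfl
      · exact ⟨by omega, h0, fun h => absurd (mem_inIdx.1 h).1 (by omega)⟩
      · exact ⟨by omega, hE.irrefl _, fun h => absurd (mem_inIdx.1 h).1 (by omega)⟩
      · exact ⟨by omega, h1, fun _ => by omega⟩)
    (by
      intro k hk hk'
      simp only [List.mem_cons, List.not_mem_nil, or_false] at hk'
      obtain ⟨hk1, hk2⟩ := mem_inIdx.1 hk
      have hk3 : k ≠ 1 := by rintro rfl; exact h0 hk2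
      exact ⟨by omega, hF.not_adj_of_last_zero hE le_rfl (by omega) (by omega) h1 hk2⟩)
  simp at this

/-- This is `one_adj_zero` in the reversed frame, where `e M` plays the part of `e 1`. -/
theorem not_adj_pred (hF : Frame D M e) (hE : Extremal D a b) (hM : 2 ≤ M)
    (h1 : D.Adj (e (M - 1)) (e (M + 1))) : ¬ D.Adj (e (M - 1)) (e 0) := by
  intro h0
  have h := hF.reverse.one_adj_zero hE.rev
    (by
      simp only [rev, sub_self]
      rw [show M + 1 - 1 = M - 1 + 1 by ring]
      exact (hF.adj_zero_iff hE (by omega) (by omega)).1 h0)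
  simp only [rev, sub_zero] at h
  rw [show M + 1 - 1 = M - 1 + 1 by ring] at h
  exact (hF.adj_last_iff hE (by omega) (by omega)).1 h1 h

section Star

variable (hF : Frame D M e) (hE : Extremal D a b) (h1 : ¬ D.Adj (e 1) (e (M + 1)))

include hF hE h1

theorem last_adj_two : D.Adj (e (M + 1)) (e 2) := by
  by_contra h
  exact h1 ((hF.adj_last_iff hE (by omega) (by have := hF.two_le h1; omega)).2 h)

/-- Otherwise `e 0 → e (j + 1)`, and `e (M + 1), e 2, …, e j, e 1, e 0, e (j + 1), …, e M` is a
Hamilton cycle. -/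
theorem adj_zero_of_adj_one {j : ℤ} (hj : 2 ≤ j) (hjM : j ≤ M) (h : D.Adj (e j) (e 1)) :
    D.Adj (e j) (e 0) := by
  by_contra h0
  have hjlt : j < M := by
    rcases hjM.eq_or_lt with rfl | h
    · exact absurd hF.last h0
    · exact h
  have h0' : D.Adj (e 0) (e (j + 1)) := by
    by_contra hc
    exact h0 ((hF.adj_zero_iff hE (by omega) (by omega)).2 hc)
  exact hF.ham hE (((((PathOn.single _ (M + 1)).app
    (hF.seg (i := 2) (j := j) (by omega) (by omega) (by omega)) (hF.last_adj_two hE h1)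
      (by intro x; omega)).app
    (PathOn.single _ 1) h (by intro x; omega)).app
    (PathOn.single _ 0) (hF.one_adj_zero hE h1) (by intro x; omega)).app
    (hF.seg (i := j + 1) (j := M) (by omega) (by omega) (by omega)) h0' (by intro x; omega))
    (by intro x; omega) (hF.step M (by omega) le_rfl)

/-- The vertices `e 1`, `e (M + 1)` and the successors of the in-neighbours of `e 0` other than `e
1` and `e M` are already `b` non-out-neighbours of `e 1`. The out-degree leaves room for one more.
-/
theorem eq_of_out_exceptions {i i' : ℤ} (hi : 2 ≤ i) (hiM : i < M) (hi' : 2 ≤ i') (hiM' : i' < M)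
    (h0 : ¬ D.Adj (e i) (e 0)) (h0' : ¬ D.Adj (e i') (e 0)) (h : ¬ D.Adj (e 1) (e (i + 1)))
    (h' : ¬ D.Adj (e 1) (e (i' + 1))) : i = i' := by
  by_contra hne
  have hM := hF.two_le h1
  have := hF.out_bound hE 1 (hF.card_inIdx_zero hE) [1, M + 1, i + 1, i' + 1] [1, M]
    (by simp; omega)
    (by
      intro k hk
      simp only [List.mem_cons, List.not_mem_nil, or_false] at hk ⊢
      rcases hk with rfl | rfl | rfl | rfl
      · exact ⟨by omega, hE.irrefl _, fun h => absurd (mem_inIdx.1 h).1 (by omega)⟩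
      · exact ⟨by omega, h1, fun _ => by omega⟩
      · refine ⟨by omega, h, fun hm => absurd (mem_inIdx.1 hm).2 ?_⟩
        rwa [add_sub_cancel_right]
      · refine ⟨by omega, h', fun hm => absurd (mem_inIdx.1 hm).2 ?_⟩
        rwa [add_sub_cancel_right])
    (by
      intro k hk hk'
      simp only [List.mem_cons, List.not_mem_nil, or_false, not_or] at hk'
      obtain ⟨hk1, hk2⟩ := mem_inIdx.1 hk
      exact ⟨by omega, hF.not_adj_of_last_zero hE le_rfl (by omega) (by omega) h1 hk2⟩)
  simp at this

/-- By `adj_zero_of_adj_one`, `e 1` and the `a - 1` vertices counted by `noninIdx` at `0` are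
non-in-neighbours of `e 1`. The in-degree leaves room for one more. -/
theorem eq_of_in_exceptions {j j' : ℤ} (hj : 2 ≤ j) (hjM : j ≤ M) (hj' : 2 ≤ j') (hjM' : j' ≤ M)
    (h0 : D.Adj (e j) (e 0)) (h0' : D.Adj (e j') (e 0)) (h : ¬ D.Adj (e j) (e 1))
    (h' : ¬ D.Adj (e j') (e 1)) : j = j' := by
  by_contra hne
  have hM := hF.two_le h1
  have h10 := hF.one_adj_zero hE h1
  have := hF.in_bound hE 1 (hF.card_noninIdx_zero hE) [1, j, j'] [] (by simp; omega)
    (by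
      intro k hk
      simp only [List.mem_cons, List.not_mem_nil, or_false] at hk ⊢
      rcases hk with rfl | rfl | rfl
      · exact ⟨by omega, hE.irrefl _, fun h => (mem_noninIdx.1 h).2 h10⟩
      · exact ⟨by omega, h, fun h => (mem_noninIdx.1 h).2 h0⟩
      · exact ⟨by omega, h', fun h => (mem_noninIdx.1 h).2 h0'⟩)
    (by
      intro k hk _
      obtain ⟨hk1, hk2⟩ := mem_noninIdx.1 hk
      have hk3 : k ≠ 1 := by rintro rfl; exact hk2 h10
      exact ⟨by omega, fun hc => hk2 (hF.adj_zero_of_adj_one hE h1 (by omega) (by omega) hc)⟩)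
  simp at this

/-- Put `u = e (j + 1)`. Neither `e 0 → u` nor `u → e 1` holds, so no cycle missing just `u` may use
the arc `e 0 → e 1`; the arc `e 1 → e (j + 2)` would create one. If `e j → e 1`, two further cycles
missing just `u`, and a Hamilton cycle excluding `u → e 2`, force `e 1 → u`, against
`not_adj_of_last_zero`. -/
theorem not_adj_of_descent {j : ℤ} (hj : 2 ≤ j) (hjM : j + 1 < M) (h : D.Adj (e j) (e 0))
    (h' : ¬ D.Adj (e (j + 1)) (e 0)) :
    ¬ D.Adj (e 1) (e (j + 2)) ∧ ¬ D.Adj (e j) (e 1) := by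
  have h10 := hF.one_adj_zero hE h1
  have h02 : D.Adj (e 0) (e (j + 2)) := by
    by_contra hc
    exact h' ((hF.adj_zero_iff hE (by omega) (by omega)).2
      (by rwa [show j + 1 + 1 = j + 2 by ring]))
  have h01 : D.Adj (e 0) (e 1) := hF.step 0 le_rfl (by omega)
  have hML : D.Adj (e M) (e (M + 1)) := hF.step M (by omega) le_rfl
  have hL2 := hF.last_adj_two hE h1
  have hu0 : ¬ D.Adj (e 0) (e (j + 1)) := (hF.adj_zero_iff hE (by omega) (by omega)).1 h
  have hu1 : ¬ D.Adj (e (j + 1)) (e 1) := fun hc =>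
    h' (hF.adj_zero_of_adj_one hE h1 (by omega) (by omega) hc)
  constructor
  · intro hc
    have := hF.insert hE (u := j + 1) (((((PathOn.single _ 1).app
      (hF.seg (i := j + 2) (j := M) (by omega) (by omega) (by omega)) hc (by intro x; omega)).app
      (PathOn.single _ (M + 1)) hML (by intro x; omega)).app
      (hF.seg (i := 2) (j := j) (by omega) (by omega) (by omega)) hL2 (by intro x; omega)).app
      (PathOn.single _ 0) h (by intro x; omega)) h01 (by omega) (by intro x; omega)
    exact this.elim hu0 hu1
  · intro hc
    have hv : D.Adj (e (M + 1)) (e (j + 1)) := by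
      have := hF.insert hE (u := j + 1) ((((hF.seg (i := 1) (j := j) (by omega) (by omega)
        (by omega)).app (PathOn.single _ 0) h (by intro x; omega)).app
        (hF.seg (i := j + 2) (j := M) (by omega) (by omega) (by omega)) h02
          (by intro x; omega)).app
        (PathOn.single _ (M + 1)) hML (by intro x; omega)) hF.first (by omega)
        (by intro x; omega)
      exact this.resolve_right hu1
    have hu2 : ¬ D.Adj (e (j + 1)) (e 2) := by
      exact hF.ham hE ((((((hF.seg (i := 2) (j := j) (by omega) (by omega) (by omega)).app
        (PathOn.single _ 1) hc (by intro x; omega)).app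
        (PathOn.single _ 0) h10 (by intro x; omega)).app
        (hF.seg (i := j + 2) (j := M) (by omega) (by omega) (by omega)) h02
          (by intro x; omega)).app
        (PathOn.single _ (M + 1)) hML (by intro x; omega)).app
        (PathOn.single _ (j + 1)) hv (by intro x; omega)) (by intro x; omega)
    have h1u : D.Adj (e 1) (e (j + 1)) := by
      have := hF.insert hE (u := j + 1) (((((hF.seg (i := 2) (j := j) (by omega) (by omega)
        (by omega)).app (PathOn.single _ 0) h (by intro x; omega)).app
        (hF.seg (i := j + 2) (j := M) (by omega) (by omega) (by omega)) h02
          (by intro x; omega)).app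
        (PathOn.single _ (M + 1)) hML (by intro x; omega)).app
        (PathOn.single _ 1) hF.first (by intro x; omega))
        (hF.step 1 (by omega) (by omega)) (by omega) (by intro x; omega)
      exact this.resolve_right hu2
    exact hF.not_adj_of_last_zero hE le_rfl (by omega) (by omega) h1 h h1u

/-- Every descent `j` makes `j + 1` an exception in the sense of `eq_of_out_exceptions`. So from
index 2 up to `M - 1` the in-neighbours of `e 0` stop at most once. -/
theorem descent_unique {j j' : ℤ} (hj : 2 ≤ j) (hjM : j + 1 < M) (h : D.Adj (e j) (e 0))
    (h' : ¬ D.Adj (e (j + 1)) (e 0)) (hj' : 2 ≤ j') (hjM' : j' + 1 < M) (hh : D.Adj (e j') (e 0))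
    (hh' : ¬ D.Adj (e (j' + 1)) (e 0)) : j = j' := by
  have := hF.eq_of_out_exceptions hE h1 (i := j + 1) (i' := j' + 1) (by omega) hjM (by omega) hjM'
    h' hh' (by rw [add_assoc]; exact (hF.not_adj_of_descent hE h1 hj hjM h h').1)
    (by rw [add_assoc]; exact (hF.not_adj_of_descent hE h1 hj' hjM' hh hh').1)
  omega

/-- The count of `one_adj_zero`, now at `e 2` and with the successors of the in-neighbours of `e (M
+ 1)`. -/
theorem two_adj_last (hM : 3 ≤ M) (h2 : ¬ D.Adj (e 2) (e 0)) : D.Adj (e 2) (e (M + 1)) := by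
  by_contra hc
  have := hF.out_bound hE 2 (hF.card_inIdx_last hE) [0, 2, M + 1] [M] (by simp; omega)
    (by
      intro k hk
      simp only [List.mem_cons, List.not_mem_nil, or_false] at hk ⊢
      rcases hk with rfl | rfl | rfl
      · exact ⟨by omega, h2, fun h => absurd (mem_inIdx.1 h).1 (by omega)⟩
      · exact ⟨by omega, hE.irrefl _, fun h => absurd (mem_inIdx.1 h).2 h1⟩
      · exact ⟨by omega, hc, fun _ => by omega⟩)
    (by
      intro k hk hk'
      simp only [List.mem_cons, List.not_mem_nil, or_false] at hk'
      obtain ⟨hk1, hk2⟩ := mem_inIdx.1 hk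
      have hk3 : k ≠ 1 := by rintro rfl; exact h1 hk2
      have hk4 : k ≠ 2 := by rintro rfl; exact hc hk2
      exact ⟨by omega, hF.not_adj_of_zero_last hE (by omega) (by omega) (by omega) h2 hk2⟩)
  simp at this

/-- One direction is `not_adj_of_zero_last`. For the other, `e 0`, `e 1`, `e 2` and the successors
of the in-neighbours of `e (M + 1)` other than `e 2` and `e M` already make up all `b + 1` permitted
non-out-neighbours of `e 2`. -/
theorem two_adj_iff (h2 : ¬ D.Adj (e 2) (e 0)) {i : ℤ} (hi : 3 ≤ i) (hiM : i < M) :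
    D.Adj (e 2) (e (i + 1)) ↔ ¬ D.Adj (e i) (e (M + 1)) := by
  have h2L := hF.two_adj_last hE h1 (by omega) h2
  constructor
  · intro h hc
    exact hF.not_adj_of_zero_last hE (by omega) (by omega) hiM h2 hc h
  · intro h
    by_contra hc
    have := hF.out_bound hE 2 (hF.card_inIdx_last hE) [0, 1, 2, i + 1] [2, M] (by simp; omega)
      (by
        intro k hk
        simp only [List.mem_cons, List.not_mem_nil, or_false] at hk ⊢
        rcases hk with rfl | rfl | rfl | rfl
        · exact ⟨by omega, h2, fun h => absurd (mem_inIdx.1 h).1 (by omega)⟩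
        · exact ⟨by omega, fun h => h2 (hF.adj_zero_of_adj_one hE h1 le_rfl (by omega) h),
            fun h => absurd (mem_inIdx.1 h).1 (by omega)⟩
        · exact ⟨by omega, hE.irrefl _, fun h => absurd (mem_inIdx.1 h).2 h1⟩
        · refine ⟨by omega, hc, fun hm => absurd (mem_inIdx.1 hm).2 ?_⟩
          rwa [add_sub_cancel_right])
      (by
        intro k hk hk'
        simp only [List.mem_cons, List.not_mem_nil, or_false, not_or] at hk'
        obtain ⟨hk1, hk2⟩ := mem_inIdx.1 hk
        have hk3 : k ≠ 1 := by rintro rfl; exact h1 hk2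
        exact ⟨by omega, hF.not_adj_of_zero_last hE (by omega) (by omega) (by omega) h2 hk2⟩)
    simp at this

/-- The two arcs would give the Hamilton cycle `e 0, e 3, …, e j, e 1, e 2, e (M + 1), e (j + 1), …,
e M`. -/
theorem not_adj_one_and_last_adj (h2 : ¬ D.Adj (e 2) (e 0)) {j : ℤ} (hj : 3 ≤ j) (hjM : j < M) :
    ¬ (D.Adj (e j) (e 1) ∧ D.Adj (e (M + 1)) (e (j + 1))) := by
  rintro ⟨ha, hb⟩
  have h03 : D.Adj (e 0) (e 3) := by
    by_contra hc
    exact h2 ((hF.adj_zero_iff hE (by omega) (by omega)).2 hc)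
  exact hF.ham hE (((((PathOn.single _ 0).app
    (hF.seg (i := 3) (j := j) (by omega) (by omega) (by omega)) h03 (by intro x; omega)).app
    (hF.seg (i := 1) (j := 2) (by omega) (by omega) (by omega)) ha (by intro x; omega)).app
    (PathOn.single _ (M + 1)) (hF.two_adj_last hE h1 (by omega) h2) (by intro x; omega)).app
    (hF.seg (i := j + 1) (j := M) (by omega) (by omega) (by omega)) hb (by intro x; omega))
    (by intro x; omega) hF.last

/-- The two arcs would give the Hamilton cycle `e 0, e 3, …, e j, e 2, e (M + 1), e 1, e (j + 1), …,
e M`. -/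
theorem not_adj_two_and_one_adj (h2 : ¬ D.Adj (e 2) (e 0)) {j : ℤ} (hj : 3 ≤ j) (hjM : j < M) :
    ¬ (D.Adj (e j) (e 2) ∧ D.Adj (e 1) (e (j + 1))) := by
  rintro ⟨ha, hb⟩
  have h03 : D.Adj (e 0) (e 3) := by
    by_contra hc
    exact h2 ((hF.adj_zero_iff hE (by omega) (by omega)).2 hc)
  exact hF.ham hE ((((((PathOn.single _ 0).app
    (hF.seg (i := 3) (j := j) (by omega) (by omega) (by omega)) h03 (by intro x; omega)).app
    (PathOn.single _ 2) ha (by intro x; omega)).app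
    (PathOn.single _ (M + 1)) (hF.two_adj_last hE h1 (by omega) h2) (by intro x; omega)).app
    (PathOn.single _ 1) hF.first (by intro x; omega)).app
    (hF.seg (i := j + 1) (j := M) (by omega) (by omega) (by omega)) hb (by intro x; omega))
    (by intro x; omega) hF.last

theorem adj_last_of_adj_one (h2 : ¬ D.Adj (e 2) (e 0)) {j : ℤ} (hj : 3 ≤ j) (hjM : j < M)
    (h : D.Adj (e j) (e 1)) : D.Adj (e j) (e (M + 1)) := by
  by_contra hc
  refine hF.not_adj_one_and_last_adj hE h1 h2 hj hjM ⟨h, ?_⟩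
  by_contra hd
  exact hc ((hF.adj_last_iff hE (by omega) hjM).2 hd)

end Star

end Frame
end HamiltonDigraph
-- Frames without that arc have `M = 3` or `M = 5`
namespace HamiltonDigraph
variable {V : Type*} [Fintype V] {D : Digraph V} {a b M : ℤ} {e : ℤ → V}
namespace Frame

/-- The vertices of odd index are the in-neighbours of the last vertex. -/
def Alternating (D : Digraph V) (M : ℤ) (e : ℤ → V) : Prop :=
  ∀ i, 1 ≤ i → i ≤ M → (D.Adj (e i) (e (M + 1)) ↔ i % 2 = 1)

section Star

variable (hF : Frame D M e) (hE : Extremal D a b) (h1 : ¬ D.Adj (e 1) (e (M + 1)))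

include hF hE h1

theorem three_adj_zero (hM : 4 ≤ M) (h2 : ¬ D.Adj (e 2) (e 0)) : D.Adj (e 3) (e 0) := by
  by_contra h3
  have h10 := hF.one_adj_zero hE h1
  have h2L := hF.two_adj_last hE h1 (by omega) h2
  have h31 : ¬ D.Adj (e 3) (e 1) := fun h =>
    h3 (hF.adj_zero_of_adj_one hE h1 (by omega) (by omega) h)
  have h3L : D.Adj (e 3) (e (M + 1)) := by
    by_contra hc
    have := hF.out_bound hE 3 (hF.card_inIdx_last hE) [0, 1, 3, M + 1] [2, M] (by simp; omega)
      (by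
        intro k hk
        simp only [List.mem_cons, List.not_mem_nil, or_false] at hk ⊢
        rcases hk with rfl | rfl | rfl | rfl
        · exact ⟨by omega, h3, fun h => absurd (mem_inIdx.1 h).1 (by omega)⟩
        · exact ⟨by omega, h31, fun h => absurd (mem_inIdx.1 h).1 (by omega)⟩
        · exact ⟨by omega, hE.irrefl _, fun _ => by omega⟩
        · exact ⟨by omega, hc, fun _ => by omega⟩)
      (by
        intro k hk hk'
        simp only [List.mem_cons, List.not_mem_nil, or_false, not_or] at hk'
        obtain ⟨hk1, hk2⟩ := mem_inIdx.1 hk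
        have hk3 : k ≠ 1 := by rintro rfl; exact h1 hk2
        have hk4 : k ≠ 3 := by rintro rfl; exact hc hk2
        exact ⟨by omega, hF.not_adj_of_zero_last hE (by omega) (by omega) (by omega) h3 hk2⟩)
    simp at this
  -- Shifting makes `e 2` the initial, `e 3` the next and `e 0` the last vertex; there
  -- `one_adj_zero` applies because of `h3`.
  have h32 : D.Adj (e 3) (e 2) := by
    obtain ⟨e', hF', c1, c2, c3⟩ := hF.shift hE le_rfl h10 h2 (by omega)
    have := hF'.one_adj_zero hE (by rw [c3, c1 1 (by omega) (by omega)]; exact h3)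
    rwa [c1 1 (by omega) (by omega), c1 0 (by omega) (by omega)] at this
  have h14 : ¬ D.Adj (e 1) (e 4) := fun h =>
    hF.not_adj_two_and_one_adj hE h1 h2 (j := 3) le_rfl (by omega) ⟨h32, h⟩
  -- Index 3 already is the single exception allowed by `eq_of_out_exceptions`, so a descent could
  -- only occur at `j = 2`, which is not an in-neighbour of `e 0`.
  have hdesc : ∀ j, 2 ≤ j → j + 1 < M → D.Adj (e j) (e 0) → D.Adj (e (j + 1)) (e 0) := by
    intro j hj hjM hj0
    by_contra hj1
    have := hF.eq_of_out_exceptions hE h1 (i := 3) (i' := j + 1) (by omega) (by omega) (by omega)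
      (by omega) h3 hj1 h14 (by rw [add_assoc]; exact (hF.not_adj_of_descent hE h1 hj hjM hj0 hj1).1)
    obtain rfl : j = 2 := by omega
    exact h2 hj0
  have hup : ∀ j, 2 ≤ j → D.Adj (e j) (e 0) → ∀ k, j ≤ k → k < M → D.Adj (e k) (e 0) := by
    intro j hj hj0 k hjk hk
    by_contra hk0
    obtain ⟨l, hl1, hl2, hl3, hl4⟩ := exists_descent (p := fun i => D.Adj (e i) (e 0)) hjk hj0 hk0
    exact hl4 (hdesc l (by omega) (by omega) hl3)
  have hzeros := hF.card_inIdx_zero hE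
  have hlasts := hF.card_inIdx_last hE
  have hML : D.Adj (e M) (e (M + 1)) := hF.step M (by omega) le_rfl
  -- Otherwise `hup` leaves only `e 1` and `e M` as in-neighbours of `e 0`, so `b ≤ 2`, while `e 2`,
  -- `e 3`, `e M` are in-neighbours of `e (M + 1)`.
  have hM1 : D.Adj (e (M - 1)) (e 0) := by
    by_contra hc
    have u1 := card_le_length (Z := inIdx D M e 0) (Y := [1, M]) (by
      intro k hk
      simp only [List.mem_cons, List.not_mem_nil, or_false]
      obtain ⟨hk1, hk2⟩ := mem_inIdx.1 hk
      by_contra hk3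
      exact hc (hup k (by omega) hk2 (M - 1) (by omega) (by omega)))
    have u2 := length_le_card (Z := inIdx D M e (M + 1)) (X := [2, 3, M]) (by simp; omega) (by
      intro k hk
      simp only [List.mem_cons, List.not_mem_nil, or_false] at hk
      rcases hk with rfl | rfl | rfl
      · exact mem_inIdx.2 ⟨by omega, h2L⟩
      · exact mem_inIdx.2 ⟨by omega, h3L⟩
      · exact mem_inIdx.2 ⟨by omega, hML⟩)
    simp only [List.length_cons, List.length_nil] at u1 u2
    omega
  have hM5 : 5 ≤ M := by
    by_contra hc
    obtain rfl : M = 4 := by omega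
    exact h3 hM1
  have hM1L : ¬ D.Adj (e (M - 1)) (e (M + 1)) := fun hc => hF.not_adj_pred hE (by omega) hc hM1
  have hLM : D.Adj (e (M + 1)) (e M) := by
    by_contra hc
    exact hM1L ((hF.adj_last_iff hE (by omega) (by omega)).2 (by rwa [sub_add_cancel]))
  have hM11 : ¬ D.Adj (e (M - 1)) (e 1) := fun hc =>
    hM1L (hF.adj_last_of_adj_one hE h1 h2 (by omega) (by omega) hc)
  -- Here `e (M - 1)` is the single exception allowed by `eq_of_in_exceptions`, so `e k → e 1`.
  have himp : ∀ k, 3 ≤ k → k < M - 1 → D.Adj (e k) (e 0) → D.Adj (e k) (e (M + 1)) := by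
    intro k hk hkM hk0
    refine hF.adj_last_of_adj_one hE h1 h2 hk (by omega) ?_
    by_contra hc
    have := hF.eq_of_in_exceptions hE h1 (j := k) (j' := M - 1) (by omega) (by omega) (by omega)
      (by omega) hk0 hM1 hc hM11
    omega
  have h40 : D.Adj (e 4) (e 0) := by
    by_contra h40
    have hM4 : 4 < M - 1 := by
      by_contra hc
      obtain rfl : M = 5 := by omega
      exact h40 hM1
    have h4L : D.Adj (e 4) (e (M + 1)) := by
      by_contra h4L
      have := hF.out_bound hE 4 (hF.card_inIdx_zero hE) [0, 1, 4, M + 1] [1, M] (by simp; omega)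
        (by
          intro k hk
          simp only [List.mem_cons, List.not_mem_nil, or_false] at hk ⊢
          rcases hk with rfl | rfl | rfl | rfl
          · exact ⟨by omega, h40, fun h => absurd (mem_inIdx.1 h).1 (by omega)⟩
          · exact ⟨by omega, fun h => h40 (hF.adj_zero_of_adj_one hE h1 (by omega) (by omega) h),
              fun h => absurd (mem_inIdx.1 h).1 (by omega)⟩
          · exact ⟨by omega, hE.irrefl _, fun h => absurd (mem_inIdx.1 h).2 h3⟩
          · exact ⟨by omega, h4L, fun _ => by omega⟩)
        (by
          intro k hk hk'
          simp only [List.mem_cons, List.not_mem_nil, or_false, not_or] at hk'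
          obtain ⟨hk1, hk2⟩ := mem_inIdx.1 hk
          have hk3 : k ≠ 2 := by rintro rfl; exact h2 hk2
          have hk4 : k ≠ 3 := by rintro rfl; exact h3 hk2
          have hk5 : k ≠ 4 := by rintro rfl; exact h40 hk2
          exact ⟨by omega, hF.not_adj_of_last_zero hE (by omega) (by omega) (by omega) h4L hk2⟩)
      simp at this
    -- Passing from the in-neighbours of `e 0` to those of `e (M + 1)` loses at most `e 1`, `e (M -
    -- 1)` and gains `e 2`, `e 3`, `e 4`, although both sets have `b` elements.
    have u := length_add_card_le (Z := inIdx D M e 0) (X := [2, 3, 4]) (Y := [1, M - 1])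
      (T := inIdx D M e (M + 1)) (by simp) (by
        intro k hk
        simp only [List.mem_cons, List.not_mem_nil, or_false] at hk
        rcases hk with rfl | rfl | rfl
        · exact ⟨mem_inIdx.2 ⟨by omega, h2L⟩, fun h => absurd (mem_inIdx.1 h).2 h2⟩
        · exact ⟨mem_inIdx.2 ⟨by omega, h3L⟩, fun h => absurd (mem_inIdx.1 h).2 h3⟩
        · exact ⟨mem_inIdx.2 ⟨by omega, h4L⟩, fun h => absurd (mem_inIdx.1 h).2 h40⟩)
      (by
        intro k hk hk'
        simp only [List.mem_cons, List.not_mem_nil, or_false, not_or] at hk'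
        obtain ⟨hk1, hk2⟩ := mem_inIdx.1 hk
        refine mem_inIdx.2 ⟨hk1, ?_⟩
        rcases eq_or_ne k M with rfl | hkM
        · exact hML
        · have hk3 : k ≠ 2 := by rintro rfl; exact h2 hk2
          exact himp k (by omega) (by omega) hk2)
    simp only [List.length_cons, List.length_nil] at u
    omega
  have ha : a ≤ 3 := by
    have u1 := card_le_length (Z := noninIdx D M e 0) (Y := [2, 3]) (by
      intro k hk
      simp only [List.mem_cons, List.not_mem_nil, or_false]
      obtain ⟨hk1, hk2⟩ := mem_noninIdx.1 hk
      have hk3 : k ≠ 1 := by rintro rfl; exact hk2 h10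
      have hk4 : k ≠ M := by rintro rfl; exact hk2 hF.last
      by_contra hk5
      exact hk2 (hup 4 (by omega) h40 k (by omega) (by omega)))
    have u2 := hF.card_noninIdx_zero hE
    simp only [List.length_cons, List.length_nil] at u1
    omega
  -- The only candidates for non-in-neighbours of `e 0` in `[1, M]` are `e 2` and `e 3`, so `a + 1 ≤
  -- 4`; without this arc `e 4` would have five non-in-neighbours.
  have hM4 : D.Adj (e M) (e 4) := by
    by_contra hc
    have := hF.in_bound hE 4 (hF.card_noninIdx_zero hE) [1, 2, 4, M, M + 1] [2, 3]
      (by simp; omega)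
      (by
        intro k hk
        simp only [List.mem_cons, List.not_mem_nil, or_false] at hk ⊢
        rcases hk with rfl | rfl | rfl | rfl | rfl
        · exact ⟨by omega, h14, fun h => absurd h10 (mem_noninIdx.1 h).2⟩
        · exact ⟨by omega, fun h => (hF.two_adj_iff hE h1 h2 (i := 3) (by omega) (by omega)).1 h h3L,
            fun _ => by omega⟩
        · exact ⟨by omega, hE.irrefl _, fun h => absurd h40 (mem_noninIdx.1 h).2⟩
        · exact ⟨by omega, hc, fun h => absurd hF.last (mem_noninIdx.1 h).2⟩
        · exact ⟨by omega, (hF.adj_last_iff hE (i := 3) (by omega) (by omega)).1 h3L,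
            fun h => absurd (mem_noninIdx.1 h).1 (by omega)⟩)
      (by
        intro k hk hk'
        simp only [List.mem_cons, List.not_mem_nil, or_false, not_or] at hk'
        obtain ⟨hk1, hk2⟩ := mem_noninIdx.1 hk
        have hk3 : k ≠ 1 := by rintro rfl; exact hk2 h10
        have hk4 : k ≠ M := by rintro rfl; exact hk2 hF.last
        exact absurd (hup 4 (by omega) h40 k (by omega) (by omega)) hk2)
    simp at this
  -- The Hamilton cycle is `e 1, e 2, e 3, e (M + 1), e M, e 4, …, e (M - 1), e 0`.
  exact hF.ham hE (((((hF.seg (i := 1) (j := 3) (by omega) (by omega) (by omega)).app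
    (PathOn.single _ (M + 1)) h3L (by intro x; omega)).app
    (PathOn.single _ M) hLM (by intro x; omega)).app
    (hF.seg (i := 4) (j := M - 1) (by omega) (by omega) (by omega)) hM4 (by intro x; omega)).app
    (PathOn.single _ 0) hM1 (by intro x; omega)) (by intro x; omega)
    (hF.step 0 le_rfl (by omega))

/-- The in-neighbours of the initial vertex when the second vertex is not among them. -/
theorem exists_adj_zero_pattern (hM : 4 ≤ M) (h2 : ¬ D.Adj (e 2) (e 0)) :
    ∃ j, 3 ≤ j ∧ j + 1 < M ∧ (∀ k, 3 ≤ k → k ≤ j → D.Adj (e k) (e 0)) ∧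
      ∀ k, j < k → k < M → ¬ D.Adj (e k) (e 0) := by
  have h10 := hF.one_adj_zero hE h1
  have h30 := hF.three_adj_zero hE h1 hM h2
  -- Otherwise `e (M - 1)` uses up the exception of `eq_of_in_exceptions`, there is no descent, and
  -- only `e 2` misses `e 0`, so `a - 1 ≤ 1`; but both `e 1` and `e (M - 1)` miss `e (M + 1)`.
  have hM1 : ¬ D.Adj (e (M - 1)) (e 0) := by
    intro hc
    have hM1L : ¬ D.Adj (e (M - 1)) (e (M + 1)) := fun h => hF.not_adj_pred hE (by omega) h hc
    have hM11 : ¬ D.Adj (e (M - 1)) (e 1) := fun h =>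
      hM1L (hF.adj_last_of_adj_one hE h1 h2 (by omega) (by omega) h)
    have hall : ∀ k, 3 ≤ k → k < M → D.Adj (e k) (e 0) := by
      intro k hk hkM
      by_contra hk0
      obtain ⟨j, hj1, hj2, hj3, hj4⟩ :=
        exists_descent (p := fun i => D.Adj (e i) (e 0)) hk h30 hk0
      have := hF.eq_of_in_exceptions hE h1 (j := j) (j' := M - 1) (by omega) (by omega) (by omega)
        (by omega) hj3 hc (hF.not_adj_of_descent hE h1 (by omega) (by omega) hj3 hj4).2 hM11
      omega
    have u1 := card_le_length (Z := noninIdx D M e 0) (Y := [2]) (by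
      intro k hk
      simp only [List.mem_cons, List.not_mem_nil, or_false]
      obtain ⟨hk1, hk2⟩ := mem_noninIdx.1 hk
      have hk3 : k ≠ 1 := by rintro rfl; exact hk2 h10
      have hk4 : k ≠ M := by rintro rfl; exact hk2 hF.last
      by_contra hk5
      exact hk2 (hall k (by omega) (by omega)))
    have u2 := length_le_card (Z := noninIdx D M e (M + 1)) (X := [1, M - 1]) (by simp; omega) (by
      intro k hk
      simp only [List.mem_cons, List.not_mem_nil, or_false] at hk
      rcases hk with rfl | rfl
      · exact mem_noninIdx.2 ⟨by omega, h1⟩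
      · exact mem_noninIdx.2 ⟨by omega, hM1L⟩)
    have u3 := hF.card_noninIdx_zero hE
    have u4 := hF.card_noninIdx_last hE
    simp only [List.length_cons, List.length_nil] at u1 u2
    omega
  obtain ⟨j, hj1, hj2, hj3, hj4⟩ :=
    exists_descent (p := fun i => D.Adj (e i) (e 0)) (k := M - 1) (by omega) h30 hM1
  refine ⟨j, hj1, by omega, fun k hk hkj => ?_, fun k hk hkM hk0 => ?_⟩
  · by_contra hk0
    obtain ⟨l, hl1, hl2, hl3, hl4⟩ := exists_descent (p := fun i => D.Adj (e i) (e 0)) hk h30 hk0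
    have := hF.descent_unique hE h1 (j := j) (j' := l) (by omega) (by omega) hj3 hj4 (by omega)
      (by omega) hl3 hl4
    omega
  · obtain ⟨l, hl1, hl2, hl3, hl4⟩ :=
      exists_descent (p := fun i => D.Adj (e i) (e 0)) (i := k) (k := M - 1) (by omega) hk0 hM1
    have := hF.descent_unique hE h1 (j := j) (j' := l) (by omega) (by omega) hj3 hj4 (by omega)
      (by omega) hl3 hl4
    omega

/-- Shift the frame at the descent `j` of the in-neighbours of `e 0`, making `e (j + 1)` initial and
`e 0` last. If `e (j + 2) → e 0`, the counts of non-in-neighbours clash. Otherwise the new frame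
again lacks the arc from its vertex 1 to its last vertex, and its only descent from index 2 on is at
`M - j`, the place of `e (M + 1)`. This leaves 1, 3, `M` as in-neighbours of the new initial vertex,
so `b ≤ 3`; then `j = 2` and `M = 5`. -/
theorem alternating_of_two_adj_zero (h20 : D.Adj (e 2) (e 0)) :
    M = 5 ∧ ∃ e', Frame D M e' ∧ Alternating D M e' := by
  have h10 := hF.one_adj_zero hE h1
  have hM2 := hF.two_le h1
  have u3 := hF.card_noninIdx_zero hE
  have u4 := hF.card_noninIdx_last hE
  have hexz : ∃ k, 3 ≤ k ∧ k < M ∧ ¬ D.Adj (e k) (e 0) := by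
    by_contra hcon
    push Not at hcon
    have u1 := card_le_length (Z := noninIdx D M e 0) (Y := []) (by
      intro k hk
      obtain ⟨hk1, hk2⟩ := mem_noninIdx.1 hk
      have hk3 : k ≠ 1 := by rintro rfl; exact hk2 h10
      have hk5 : k ≠ 2 := by rintro rfl; exact hk2 h20
      have hk4 : k ≠ M := by rintro rfl; exact hk2 hF.last
      exact absurd (hcon k (by omega) (by omega)) hk2)
    have u2 := length_le_card (Z := noninIdx D M e (M + 1)) (X := [1]) (by simp) (by
      intro k hk
      simp only [List.mem_cons, List.not_mem_nil, or_false] at hk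
      subst hk
      exact mem_noninIdx.2 ⟨by omega, h1⟩)
    simp only [List.length_cons, List.length_nil] at u1 u2
    omega
  obtain ⟨k, hk3, hkM, hk0⟩ := hexz
  obtain ⟨j, hj1, hj2, hj3, hj4⟩ :=
    exists_descent (p := fun i => D.Adj (e i) (e 0)) (i := 2) (k := k) (by omega) h20 hk0
  have hlow : ∀ k, 1 ≤ k → k ≤ j → D.Adj (e k) (e 0) := by
    intro k hk hkj
    rcases eq_or_ne k 1 with rfl | hk1
    · exact h10
    by_contra hk0
    obtain ⟨l, hl1, hl2, hl3, hl4⟩ :=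
      exists_descent (p := fun i => D.Adj (e i) (e 0)) (i := 2) (k := k) (by omega) h20 hk0
    have := hF.descent_unique hE h1 (j := j) (j' := l) (by omega) (by omega) hj3 hj4 (by omega)
      (by omega) hl3 hl4
    omega
  obtain ⟨e', hF', c1, c2, c3⟩ := hF.shift hE (j := j) (by omega) hj3 hj4 (by omega)
  have v0 : e' 0 = e (j + 1) := by rw [c1 0 le_rfl (by omega), add_zero]
  have hx1 : ¬ D.Adj (e' (M - j + 1)) (e' 0) := by
    rw [c2 (M - j + 1) (by omega) (by omega), v0, add_sub_cancel_left]
    intro h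
    exact hF.not_adj_of_last_zero hE le_rfl (by omega) (by omega) h1 hj3 h
  have hv : D.Adj (e' (M - j)) (e' 0) := by
    refine (hF'.adj_zero_iff hE (by omega) (by omega)).2 ?_
    rw [c2 (M - j + 1) (by omega) (by omega), v0, add_sub_cancel_left]
    intro h
    exact hj4 (hF.adj_zero_of_adj_one hE h1 (by omega) (by omega) h)
  have vL : e' (M - j) = e (M + 1) := by
    rw [c1 _ (by omega) (by omega)]; congr 1; ring
  have hpred : D.Adj (e (j + 1)) (e (M + 1)) → ¬ D.Adj (e' (M - j - 1)) (e' 0) := by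
    intro h h'
    refine (hF'.adj_zero_iff hE (by omega) (by omega)).1 h' ?_
    rwa [sub_add_cancel, v0, vL]
  by_cases hj20 : D.Adj (e (j + 2)) (e 0)
  · exfalso
    have hhigh : ∀ k, j + 2 ≤ k → k < M → D.Adj (e k) (e 0) := by
      intro k hk hkM
      by_contra hk0
      obtain ⟨l, hl1, hl2, hl3, hl4⟩ :=
        exists_descent (p := fun i => D.Adj (e i) (e 0)) (i := j + 2) (k := k) hk hj20 hk0
      have := hF.descent_unique hE h1 (j := j) (j' := l) (by omega) (by omega) hj3 hj4 (by omega)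
        (by omega) hl3 hl4
      omega
    have u1 := card_le_length (Z := noninIdx D M e 0) (Y := [j + 1]) (by
      intro k hk
      simp only [List.mem_cons, List.not_mem_nil, or_false]
      obtain ⟨hk1, hk2⟩ := mem_noninIdx.1 hk
      have hk4 : k ≠ M := by rintro rfl; exact hk2 hF.last
      by_contra hk5
      rcases lt_or_gt_of_ne hk5 with h | h
      · exact hk2 (hlow k (by omega) (by omega))
      · exact hk2 (hhigh k (by omega) (by omega)))
    have hjL : D.Adj (e (j + 1)) (e (M + 1)) := by
      by_contra hc
      have u2 := length_le_card (Z := noninIdx D M e (M + 1)) (X := [1, j + 1])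
        (by simp; omega) (by
        intro k hk
        simp only [List.mem_cons, List.not_mem_nil, or_false] at hk
        rcases hk with rfl | rfl
        · exact mem_noninIdx.2 ⟨by omega, h1⟩
        · exact mem_noninIdx.2 ⟨by omega, hc⟩)
      simp only [List.length_cons, List.length_nil] at u1 u2
      omega
    have u2 := length_le_card (Z := noninIdx D M e' 0) (X := [M - j - 1, M - j + 1])
      (by simp; omega) (by
      intro k hk
      simp only [List.mem_cons, List.not_mem_nil, or_false] at hk
      rcases hk with rfl | rfl
      · exact mem_noninIdx.2 ⟨by omega, hpred hjL⟩
      · exact mem_noninIdx.2 ⟨by omega, hx1⟩)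
    have u5 := hF'.card_noninIdx_zero hE
    simp only [List.length_cons, List.length_nil] at u1 u2
    omega
  · have hj2M : j + 2 < M := by
      have : j + 2 ≠ M := by rintro rfl; exact hj20 hF.last
      omega
    have h1' : ¬ D.Adj (e' 1) (e' (M + 1)) := by
      rw [c3, c1 1 (by omega) (by omega), add_assoc]; exact hj20
    have h10' := hF'.one_adj_zero hE h1'
    have huniq : ∀ l, 2 ≤ l → l + 1 < M → D.Adj (e' l) (e' 0) → ¬ D.Adj (e' (l + 1)) (e' 0) →
        l = M - j := fun l hl hlM ha hb =>
      hF'.descent_unique hE h1' hl hlM ha hb (by omega) (by omega) hv hx1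
    have hd := hF'.not_adj_of_descent hE h1' (j := M - j) (by omega) (by omega) hv hx1
    have hjL : D.Adj (e (j + 1)) (e (M + 1)) := by
      refine (hF.adj_last_iff hE (by omega) (by omega)).2 ?_
      have := hd.2
      rw [c1 1 (by omega) (by omega)] at this
      rwa [← vL]
    have hp := hpred hjL
    have hne : M - j - 1 ≠ 1 := by intro h; rw [h] at hp; exact hp h10'
    have hz2 : ¬ D.Adj (e' 2) (e' 0) := by
      intro h
      obtain ⟨l, hl1, hl2, hl3, hl4⟩ := exists_descent (p := fun i => D.Adj (e' i) (e' 0))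
        (i := 2) (k := M - j - 1) (by omega) h hp
      have := huniq l hl1 (by omega) hl3 hl4
      omega
    have h3' := hF'.three_adj_zero hE h1' (by omega) hz2
    have hMj : M = j + 3 := by
      by_contra hne'
      obtain ⟨l, hl1, hl2, hl3, hl4⟩ := exists_descent (p := fun i => D.Adj (e' i) (e' 0))
        (i := 3) (k := M - j - 1) (by omega) h3' hp
      have := huniq l (by omega) (by omega) hl3 hl4
      omega
    have hlastz : ¬ D.Adj (e' (M - 1)) (e' 0) := by
      refine hF'.not_adj_pred hE (by omega) ?_
      rw [c3, c2 _ (by omega) (by omega)]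
      exact hlow _ (by omega) (by omega)
    have hrest : ∀ k, 4 ≤ k → k < M → ¬ D.Adj (e' k) (e' 0) := by
      intro k hk hkM hk0
      obtain ⟨l, hl1, hl2, hl3, hl4⟩ := exists_descent (p := fun i => D.Adj (e' i) (e' 0))
        (i := k) (k := M - 1) (by omega) hk0 hlastz
      have := huniq l (by omega) (by omega) hl3 hl4
      omega
    have hb : b ≤ 3 := by
      have u1 := card_le_length (Z := inIdx D M e' 0) (Y := [1, 3, M]) (by
        intro k hk
        simp only [List.mem_cons, List.not_mem_nil, or_false]
        obtain ⟨hk1, hk2⟩ := mem_inIdx.1 hk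
        by_contra hk3
        have hk4 : k ≠ 2 := by rintro rfl; exact hz2 hk2
        exact hrest k (by omega) (by omega) hk2)
      have := hF'.card_inIdx_zero hE
      simp only [List.length_cons, List.length_nil] at u1
      omega
    have hj2' : j = 2 := by
      by_contra hne'
      have u1 := length_le_card (Z := inIdx D M e 0) (X := [1, 2, 3, M]) (by simp; omega) (by
        intro k hk
        simp only [List.mem_cons, List.not_mem_nil, or_false] at hk
        rcases hk with rfl | rfl | rfl | rfl
        · exact mem_inIdx.2 ⟨by omega, h10⟩
        · exact mem_inIdx.2 ⟨by omega, h20⟩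
        · exact mem_inIdx.2 ⟨by omega, hlow 3 (by omega) (by omega)⟩
        · exact mem_inIdx.2 ⟨by omega, hF.last⟩)
      have := hF.card_inIdx_zero hE
      simp only [List.length_cons, List.length_nil] at u1
      omega
    obtain rfl : M = 5 := by omega
    refine ⟨rfl, _, hF'.swap, fun i hi1 hi2 => ?_⟩
    rw [if_neg (by omega), if_neg (by omega), if_neg (by omega), if_pos rfl]
    have h4' := hrest 4 le_rfl (by omega)
    have h5' := hF'.last
    obtain rfl | rfl | rfl | rfl | rfl : i = 1 ∨ i = 2 ∨ i = 3 ∨ i = 4 ∨ i = 5 := by omega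
    all_goals simp [h10', hz2, h3', h4', h5']

/-- The in-neighbours of `e 0` are now 1, `3, …, j` and `M`; shift at `j`. If `j + 2 < M`, the new
frame again lacks the arc from its vertex 1 to its last vertex; either `alternating_of_two_adj_zero`
applies to it or the two patterns contradict `two_adj_iff`. If `j + 2 = M`, counting forces `j = 3`.
-/
theorem alternating_of_not_two_adj_zero (hM : 4 ≤ M) (h2 : ¬ D.Adj (e 2) (e 0)) :
    M = 5 ∧ ∃ e', Frame D M e' ∧ Alternating D M e' := by
  have h10 := hF.one_adj_zero hE h1
  obtain ⟨j, hj3, hjM, hlow, hhigh⟩ := hF.exists_adj_zero_pattern hE h1 hM h2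
  have hj0 := hlow j hj3 le_rfl
  have hj1 := hhigh (j + 1) (by omega) hjM
  obtain ⟨e', hF', c1, c2, c3⟩ := hF.shift hE (j := j) (by omega) hj0 hj1 (by omega)
  have v0 : e' 0 = e (j + 1) := by rw [c1 0 le_rfl (by omega), add_zero]
  have vL : e' (M - j) = e (M + 1) := by
    rw [c1 _ (by omega) (by omega)]; congr 1; ring
  have hx1 : ¬ D.Adj (e' (M - j + 1)) (e' 0) := by
    rw [c2 (M - j + 1) (by omega) (by omega), v0, add_sub_cancel_left]
    intro h
    exact hF.not_adj_of_last_zero hE le_rfl (by omega) (by omega) h1 hj0 h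
  by_cases hr : j + 2 < M
  · have h1' : ¬ D.Adj (e' 1) (e' (M + 1)) := by
      rw [c3, c1 1 (by omega) (by omega), add_assoc]; exact hhigh _ (by omega) (by omega)
    by_cases h2' : D.Adj (e' 2) (e' 0)
    · exact hF'.alternating_of_two_adj_zero hE h1' h2'
    exfalso
    have hMj : j + 3 = M := by
      have h := hF'.two_adj_last hE h1' (by omega) h2'
      rw [c3, c1 2 (by omega) (by omega)] at h
      by_contra hne
      exact hhigh (j + 1 + 2) (by omega) (by omega) h
    obtain ⟨j', hj'3, hj'M, hlow', hhigh'⟩ := hF'.exists_adj_zero_pattern hE h1' hM h2'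
    have h3' : D.Adj (e' 3) (e' 0) := hlow' 3 le_rfl hj'3
    have h4' : ¬ D.Adj (e' 4) (e' 0) := by
      rw [show M - j + 1 = 4 by omega] at hx1; exact hx1
    have hj'eq : j' = 3 := by
      by_contra hne
      exact h4' (hlow' 4 (by omega) (by omega))
    have h5' : ¬ D.Adj (e' 5) (e' 0) := hhigh' 5 (by omega) (by omega)
    rw [c2 5 (by omega) (by omega), v0, show 5 - (M - j) = 2 by omega,
      hF.two_adj_iff hE h1 h2 hj3 (by omega), not_not,
      hF.adj_last_iff hE (by omega) (by omega)] at h5'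
    rw [show (3 : ℤ) = M - j by omega, vL, v0] at h3'
    exact h5' h3'
  · obtain rfl : M = j + 2 := by omega
    -- For `j > 3` only `e 2` and `e (j + 1)` miss `e 0`, so `a - 1 ≤ 2`. In the shifted frame
    -- indices 3 and `M - 1` already miss the initial vertex, so 1 and 2 do not. Translated back, `e
    -- 1`, `e j` and `e (j + 1)` all miss `e (M + 1)`, which is one too many.
    have hj4 : j = 3 := by
      by_contra hne
      have h3z : ¬ D.Adj (e' (j + 2 - 1)) (e' 0) := by
        refine hF'.not_adj_pred hE (by omega) ?_
        rw [c3, c2 _ (by omega) (by omega)]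
        exact hlow _ (by omega) (by omega)
      have u1 := card_le_length (Z := noninIdx D (j + 2) e 0) (Y := [2, j + 1]) (by
        intro k hk
        simp only [List.mem_cons, List.not_mem_nil, or_false]
        obtain ⟨hk1, hk2⟩ := mem_noninIdx.1 hk
        have hk3 : k ≠ 1 := by rintro rfl; exact hk2 h10
        have hk4 : k ≠ j + 2 := by rintro rfl; exact hk2 hF.last
        by_contra hk5
        exact hk2 (hlow k (by omega) (by omega)))
      have u2 := hF.card_noninIdx_zero hE
      have u3 := hF'.card_noninIdx_zero hE
      have u4 := hF.card_noninIdx_last hE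
      have hx3 : ¬ D.Adj (e' 3) (e' 0) := by
        rw [show j + 2 - j + 1 = 3 by omega] at hx1; exact hx1
      have hothers : ∀ k, 1 ≤ k → k ≤ 2 → D.Adj (e' k) (e' 0) := by
        intro k hk1 hk2
        by_contra hk0
        have u5 := length_le_card (Z := noninIdx D (j + 2) e' 0) (X := [k, 3, j + 2 - 1])
          (by simp; omega) (by
          intro i hi
          simp only [List.mem_cons, List.not_mem_nil, or_false] at hi
          rcases hi with rfl | rfl | rfl
          · exact mem_noninIdx.2 ⟨by omega, hk0⟩
          · exact mem_noninIdx.2 ⟨by omega, hx3⟩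
          · exact mem_noninIdx.2 ⟨by omega, h3z⟩)
        simp only [List.length_cons, List.length_nil] at u1 u5
        omega
      have hv := hothers 2 (by omega) le_rfl
      have hM0 := hothers 1 le_rfl (by omega)
      rw [show (2 : ℤ) = j + 2 - j by omega, vL, v0] at hv
      have hjL : ¬ D.Adj (e j) (e (j + 2 + 1)) := fun h =>
        (hF.adj_last_iff hE (by omega) (by omega)).1 h hv
      have hj1L : ¬ D.Adj (e (j + 1)) (e (j + 2 + 1)) := by
        have := (hF'.adj_zero_iff hE (i := 1) le_rfl (by omega)).1 hM0
        rwa [show (1 : ℤ) + 1 = j + 2 - j by omega, vL, v0] at this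
      have u5 := length_le_card (Z := noninIdx D (j + 2) e (j + 2 + 1)) (X := [1, j, j + 1])
        (by simp; omega) (by
        intro i hi
        simp only [List.mem_cons, List.not_mem_nil, or_false] at hi
        rcases hi with rfl | rfl | rfl
        · exact mem_noninIdx.2 ⟨by omega, h1⟩
        · exact mem_noninIdx.2 ⟨by omega, hjL⟩
        · exact mem_noninIdx.2 ⟨by omega, hj1L⟩)
      simp only [List.length_cons, List.length_nil] at u1 u5
      omega
    subst hj4
    refine ⟨rfl, _, hF.swap, fun i hi1 hi2 => ?_⟩
    rw [if_neg (by omega), if_neg (by omega), if_neg (by omega), if_pos rfl]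
    have h5 := hF.last
    norm_num at hi2 hj1 h5
    obtain rfl | rfl | rfl | rfl | rfl : i = 1 ∨ i = 2 ∨ i = 3 ∨ i = 4 ∨ i = 5 := by omega
    all_goals simp [*]

theorem alternating_of_star :
    (M = 3 ∨ M = 5) ∧ ∃ e', Frame D M e' ∧ Alternating D M e' := by
  by_cases h2 : D.Adj (e 2) (e 0)
  · have := hF.alternating_of_two_adj_zero hE h1 h2
    exact ⟨Or.inr this.1, this.2⟩
  by_cases hM : 4 ≤ M
  · have := hF.alternating_of_not_two_adj_zero hE h1 hM h2
    exact ⟨Or.inr this.1, this.2⟩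
  have hM2 := hF.two_le h1
  have hM3 : M ≠ 2 := by rintro rfl; exact h2 hF.last
  obtain rfl : M = 3 := by omega
  refine ⟨Or.inl rfl, _, hF.swap, fun i hi1 hi2 => ?_⟩
  rw [if_neg (by omega), if_neg (by omega), if_neg (by omega), if_pos rfl]
  have h10 := hF.one_adj_zero hE h1
  have h3 := hF.last
  obtain rfl | rfl | rfl : i = 1 ∨ i = 2 ∨ i = 3 := by omega
  all_goals simp [*]

end Star

end Frame
end HamiltonDigraph
-- Alternating frames and independent joins
namespace HamiltonDigraph
variable {V : Type*} [Fintype V] {D : Digraph V} {a b M : ℤ} {e : ℤ → V}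

omit [Fintype V] in
theorem isomorphic_of_bijective {W : Type*} {H : Digraph W} (φ : W → V)
    (hφ : Function.Bijective φ) (h : ∀ x y, D.Adj (φ x) (φ y) ↔ H.Adj x y) : Isomorphic D H :=
  ⟨RelIso.symm ⟨Equiv.ofBijective φ hφ, h _ _⟩⟩

namespace Frame

/-- Since `e (M - 1) → e (M + 1)` excludes `e (M + 1) → e M`, exchanging the ends and reversing
gives a frame to which `alternating_of_star` applies. -/
theorem alternating_of_pred (hF : Frame D M e) (hE : Extremal D a b) (hM : 2 ≤ M)
    (h : D.Adj (e (M - 1)) (e (M + 1))) :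
    (M = 3 ∨ M = 5) ∧ ∃ e', Frame D M e' ∧ Alternating D M e' := by
  obtain ⟨hM35, e', hF', hA⟩ := hF.swap.reverse.alternating_of_star hE.rev (by
    simp only [rev]
    rw [if_pos (by omega), if_neg (by omega), if_neg (by omega), add_sub_cancel_right]
    have := (hF.adj_last_iff hE (i := M - 1) (by omega) (by omega)).1 h
    rwa [sub_add_cancel] at this)
  refine ⟨hM35, _, hF'.reverse.swap, fun i hi1 hi2 => ?_⟩
  have hG : Frame D M _ := hF'.reverse.swap
  rcases eq_or_ne i M with rfl | hiM
  · have h1 := hG.step i (by omega) le_rfl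
    have h2 : i % 2 = 1 := by omega
    exact iff_of_true h1 h2
  · have h1 := hG.adj_last_iff hE (i := i) (by omega) (by omega)
    rw [h1, if_neg (by omega), if_pos rfl, if_neg (by omega), if_neg (by omega)]
    have h2 := hA (M + 1 - (i + 1)) (by omega) (by omega)
    simp only [rev] at h2
    rw [sub_zero, h2]
    omega

/-- The pattern of arcs into `e (M + 1)` is absent at 0 and present at `M`, so if it does not
alternate then two consecutive entries agree. A frame can be rotated wherever a present entry is
followed by an absent one. This moves two present entries to `M - 1`, `M`, or two absent ones to 0,
1. -/
theorem alternating_of_not_alternating (hF : Frame D M e) (hE : Extremal D a b)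
    (h : ¬ Alternating D M e) :
    (M = 3 ∨ M = 5) ∧ ∃ e', Frame D M e' ∧ Alternating D M e' := by
  have h0 := hF.not_adj_zero_last hE
  have hM := hF.step M (by have := hF.pos; omega) le_rfl
  have hpos := hF.pos
  by_cases h1 : D.Adj (e 1) (e (M + 1))
  swap
  · exact hF.alternating_of_star hE h1
  obtain ⟨i, hi0, hiM, hi⟩ : ∃ i, 0 ≤ i ∧ i < M ∧
      (D.Adj (e i) (e (M + 1)) ↔ D.Adj (e (i + 1)) (e (M + 1))) := by
    by_contra hcon
    push Not at hcon
    refine h fun i hi hiM => ?_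
    have key : ∀ i, 0 ≤ i → i ≤ M → (D.Adj (e i) (e (M + 1)) ↔ i % 2 = 1) := by
      intro i hi
      induction i, hi using Int.leInduction with
      | base => intro _; simpa using h0
      | succ i hi ih =>
        intro hiM
        have h2 := ih (by omega)
        have h3 := hcon i hi (by omega)
        have h4 : (i + 1) % 2 = 1 ↔ ¬ i % 2 = 1 := by omega
        rw [h4]
        tauto
    exact key i (by omega) hiM
  by_cases hi' : D.Adj (e i) (e (M + 1))
  · have hi1 := hi.1 hi'
    have hi0' : i ≠ 0 := by rintro rfl; exact h0 hi'
    by_cases hM1 : D.Adj (e (M - 1)) (e (M + 1))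
    · exact hF.alternating_of_pred hE (by omega) hM1
    obtain ⟨j, hj1, hj2, ⟨hj3, hj4⟩, hj5⟩ := exists_descent
      (p := fun x => D.Adj (e x) (e (M + 1)) ∧ D.Adj (e (x + 1)) (e (M + 1)))
      (i := i) (k := M - 1) (by omega) ⟨hi', hi1⟩ (fun hc => hM1 hc.1)
    have hj6 : ¬ D.Adj (e (j + 2)) (e (M + 1)) := fun hc =>
      hj5 ⟨hj4, by rwa [add_assoc]⟩
    have hj7 : j + 2 ≠ M := by intro hc; rw [hc] at hj6; exact hj6 hM
    obtain ⟨e', hF', c1, c2, c3⟩ := hF.rotate hE (q := j + 2) (by omega) (by omega)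
      (by rwa [show j + 2 - 1 = j + 1 by ring]) hj6
    refine hF'.alternating_of_pred hE (by omega) ?_
    rw [c3, c2 _ (by omega) (by omega), show j + 2 + (M - 1) - (M + 1) = j by ring]
    exact hj3
  · have hi1 : ¬ D.Adj (e (i + 1)) (e (M + 1)) := fun hc => hi' (hi.2 hc)
    obtain ⟨j, hj1, hj2, hj3, hj4⟩ := exists_descent
      (p := fun x => D.Adj (e x) (e (M + 1)) ∨ D.Adj (e (x + 1)) (e (M + 1)))
      (i := 0) (k := i) (by omega) (Or.inr (by simpa using h1)) (not_or.2 ⟨hi', hi1⟩)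
    rw [not_or] at hj4
    have hj5 := hj3.resolve_right hj4.1
    obtain ⟨e', hF', c1, c2, c3⟩ := hF.rotate hE (q := j + 1) (by omega) (by omega)
      (by rwa [add_sub_cancel_right]) hj4.1
    refine hF'.alternating_of_star hE ?_
    rw [c3, c1 1 (by omega)]
    exact hj4.2

theorem isIndependentJoin (hF : Frame D M e) (hE : Extremal D a b) (hM : M % 2 = 1)
    (h : ∀ u x, 0 ≤ u → u ≤ M + 1 → u % 2 = 0 → 0 ≤ x → x ≤ M + 1 →
      (D.Adj (e x) (e u) ↔ x % 2 = 1) ∧ (D.Adj (e u) (e x) ↔ x % 2 = 1)) :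
    IsIndependentJoin D := by
  have hpos := hF.pos
  obtain ⟨k, hk⟩ : ∃ k : ℕ, M = 2 * k - 1 := ⟨((M + 1) / 2).toNat, by omega⟩
  refine ⟨k, by omega, ⟨fun i j => D.Adj (e (2 * (i : ℕ) + 1)) (e (2 * (j : ℕ) + 1))⟩,
    fun v => hE.irrefl _, ?_⟩
  refine isomorphic_of_bijective
    (Sum.elim (fun i : Fin (k + 1) => e (2 * (i : ℕ))) (fun i : Fin k => e (2 * (i : ℕ) + 1)))
    ?_ ?_
  · rw [Fintype.bijective_iff_injective_and_card]
    constructor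
    · rintro (i | i) (j | j) hij <;> simp only [Sum.elim_inl, Sum.elim_inr] at hij <;>
        have := hF.inj _ _ (by omega) (by omega) (by omega) (by omega) hij
      · congr 1; omega
      · omega
      · omega
      · congr 1; omega
    · have := hF.card
      simp only [Fintype.card_sum, Fintype.card_fin]
      omega
  · rintro (i | i) (j | j) <;> simp only [Sum.elim_inl, Sum.elim_inr, independentJoin]
    · rw [(h _ _ (by omega) (by omega) (by omega) (by omega) (by omega)).2, iff_false]
      omega
    · rw [(h _ _ (by omega) (by omega) (by omega) (by omega) (by omega)).2, iff_true]
      omega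
    · rw [(h _ _ (by omega) (by omega) (by omega) (by omega) (by omega)).1, iff_true]
      omega

theorem adj_last_iff_odd (hF : Frame D M e) (hE : Extremal D a b) (hA : Alternating D M e)
    {x : ℤ} (hx : 0 ≤ x) (hxM : x ≤ M + 1) :
    (D.Adj (e x) (e (M + 1)) ↔ x % 2 = 1) ∧ (D.Adj (e (M + 1)) (e x) ↔ x % 2 = 1) := by
  have hpos := hF.pos
  have hM := (hA M (by omega) le_rfl).1 (hF.step M (by omega) le_rfl)
  rcases eq_or_ne x 0 with rfl | hx0
  · exact ⟨iff_of_false (hF.not_adj_zero_last hE) (by omega),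
      iff_of_false (hF.not_adj_last_zero hE) (by omega)⟩
  rcases eq_or_ne x (M + 1) with rfl | hxM1
  · exact ⟨iff_of_false (hE.irrefl _) (by omega), iff_of_false (hE.irrefl _) (by omega)⟩
  refine ⟨hA x (by omega) (by omega), ?_⟩
  rcases eq_or_ne x 1 with rfl | hx1
  · exact iff_of_true hF.first (by omega)
  have h1 := hA (x - 1) (by omega) (by omega)
  have h2 := hF.adj_last_iff hE (i := x - 1) (by omega) (by omega)
  rw [sub_add_cancel] at h2
  rw [← not_iff_not, ← h2, h1]
  omega

/-- An even vertex `e u` between the ends follows an in-neighbour of `e (M + 1)` and is not one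
itself, so a rotation makes it initial. The rotated frame alternates too, hence `e u` is joined both
ways to exactly the odd vertices. Rotation preserves parity as `M` is odd. -/
theorem isIndependentJoin_of_forall (hF : Frame D M e) (hE : Extremal D a b)
    (hall : ∀ e', Frame D M e' → Alternating D M e') : IsIndependentJoin D := by
  have hpos := hF.pos
  have hM := (hall e hF M (by omega) le_rfl).1 (hF.step M (by omega) le_rfl)
  have hlast : ∀ e', Frame D M e' → ∀ x, 0 ≤ x → x ≤ M + 1 →
      (D.Adj (e' x) (e' (M + 1)) ↔ x % 2 = 1) ∧ (D.Adj (e' (M + 1)) (e' x) ↔ x % 2 = 1) :=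
    fun e' hF' x hx hxM => hF'.adj_last_iff_odd hE (hall e' hF') hx hxM
  have hzero : ∀ e', Frame D M e' → ∀ x, 0 ≤ x → x ≤ M + 1 →
      (D.Adj (e' x) (e' 0) ↔ x % 2 = 1) ∧ (D.Adj (e' 0) (e' x) ↔ x % 2 = 1) := by
    intro e' hF' x hx hxM
    rcases eq_or_ne x 0 with rfl | hx0
    · exact ⟨iff_of_false (hE.irrefl _) (by omega), iff_of_false (hE.irrefl _) (by omega)⟩
    rcases eq_or_ne x (M + 1) with rfl | hxM1
    · have := hlast e' hF' 0 le_rfl (by omega)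
      exact ⟨iff_of_false (hF'.not_adj_last_zero hE) (by omega),
        iff_of_false (hF'.not_adj_zero_last hE) (by omega)⟩
    have := hlast _ hF'.swap x hx hxM
    rwa [if_neg hx0, if_neg hxM1, if_neg (by omega), if_pos rfl] at this
  refine hF.isIndependentJoin hE hM (fun u x hu huM hu2 hx hxM => ?_)
  rcases eq_or_ne u 0 with rfl | hu0
  · exact hzero e hF x hx hxM
  rcases eq_or_ne u (M + 1) with rfl | huM1
  · exact hlast e hF x hx hxM
  obtain ⟨e', hF', c1, c2, c3⟩ := hF.rotate hE (q := u) (by omega) (by omega)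
    ((hlast e hF (u - 1) (by omega) (by omega)).1.2 (by omega))
    (fun hc => by have := (hlast e hF u (by omega) (by omega)).1.1 hc; omega)
  have hz := hzero e' hF'
  have h0 : e' 0 = e u := by rw [c1 0 (by omega), add_zero]
  rw [h0] at hz
  rcases eq_or_ne x (M + 1) with rfl | hxM1
  · rw [← c3]; exact hz _ (by omega) le_rfl
  by_cases hxu : u ≤ x
  · have := hz (x - u) (by omega) (by omega)
    rw [c1 _ (by omega), add_sub_cancel] at this
    rw [this.1, this.2]
    omega
  · have := hz (x - u + (M + 1)) (by omega) (by omega)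
    rw [c2 _ (by omega) (by omega), show u + (x - u + (M + 1)) - (M + 1) = x by ring] at this
    rw [this.1, this.2]
    omega

theorem sum_eq_card (hF : Frame D M e) (hE : Extremal D a b) (p : ℤ → Prop) [DecidablePred p]
    (hp : ∀ i, p i ↔ D.Adj (e i) (e 0)) :
    ∑ i ∈ Finset.Icc 1 M, (if p i then (1 : ℤ) else 0) = b := by
  rw [← hF.card_inIdx_zero hE, Finset.sum_boole]
  congr 2
  ext i
  simp [mem_inIdx, hp]

end Frame
end HamiltonDigraph
-- The frames with `M = 3` and `M = 5`
namespace HamiltonDigraph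
variable {V : Type*} [Fintype V] {D : Digraph V} {a b M : ℤ} {e : ℤ → V}
namespace Frame

open Classical in
theorem sum_adj_zero_three (hF : Frame D 3 e) (hE : Extremal D a b) :
    (if D.Adj (e 1) (e 0) then (1 : ℤ) else 0) + (if D.Adj (e 2) (e 0) then 1 else 0) + 1 = b := by
  have h := hF.sum_eq_card hE (fun i => D.Adj (e i) (e 0)) (fun _ => Iff.rfl)
  rw [show Finset.Icc (1 : ℤ) 3 = {1, 2, 3} by decide] at h
  have := hF.last
  simp [this, -Finset.sum_boole] at h
  linarith

open Classical in
theorem sum_adj_zero_five (hF : Frame D 5 e) (hE : Extremal D a b) :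
    (if D.Adj (e 1) (e 0) then (1 : ℤ) else 0) + (if D.Adj (e 2) (e 0) then 1 else 0) +
      (if D.Adj (e 3) (e 0) then 1 else 0) + (if D.Adj (e 4) (e 0) then 1 else 0) + 1 = b := by
  have h := hF.sum_eq_card hE (fun i => D.Adj (e i) (e 0)) (fun _ => Iff.rfl)
  rw [show Finset.Icc (1 : ℤ) 5 = {1, 2, 3, 4, 5} by decide] at h
  have := hF.last
  simp [this, -Finset.sum_boole] at h
  linarith

theorem isFourVertexJoinOne (hF : Frame D 3 e) (hE : Extremal D a b)
    (hlast : ∀ x, 0 ≤ x → x ≤ 4 →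
      (D.Adj (e x) (e 4) ↔ x % 2 = 1) ∧ (D.Adj (e 4) (e x) ↔ x % 2 = 1))
    (h10 : ¬ D.Adj (e 1) (e 0)) (h03 : ¬ D.Adj (e 0) (e 3)) (h32 : ¬ D.Adj (e 3) (e 2))
    (h21 : ¬ D.Adj (e 2) (e 1)) (h02 : D.Adj (e 0) (e 2)) (h20 : D.Adj (e 2) (e 0)) :
    IsFourVertexJoinOne D := by
  have h01 : D.Adj (e 0) (e 1) := hF.step 0 (by omega) (by omega)
  have h12 : D.Adj (e 1) (e 2) := hF.step 1 (by omega) (by omega)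
  have h23 : D.Adj (e 2) (e 3) := hF.step 2 (by omega) (by omega)
  have h30 : D.Adj (e 3) (e 0) := hF.last
  have l0 := hlast 0 (by omega) (by omega)
  have l1 := hlast 1 (by omega) (by omega)
  have l2 := hlast 2 (by omega) (by omega)
  have l3 := hlast 3 (by omega) (by omega)
  norm_num at l0 l1 l2 l3
  have hirr := fun i => hE.irrefl (e i)
  -- The arcs between `e 3` and `e 1` are unconstrained and are recorded in `E`; the vertices `v₀,
  -- v₁, 2, 3` become `e 3, e 1, e 0, e 2`.
  refine ⟨{p | (p = (0, 1) ∧ D.Adj (e 3) (e 1)) ∨ (p = (1, 0) ∧ D.Adj (e 1) (e 3))}, ?_, ?_⟩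
  · rintro p (hp | hp)
    · exact Or.inl hp.1
    · exact Or.inr hp.1
  have hφ : ∀ x : Fin 4 ⊕ Fin 1, 0 ≤ Sum.elim ![(3 : ℤ), 1, 0, 2] ![4] x ∧
      Sum.elim ![(3 : ℤ), 1, 0, 2] ![4] x ≤ 3 + 1 := by decide
  have hinj : ∀ x y : Fin 4 ⊕ Fin 1, Sum.elim ![(3 : ℤ), 1, 0, 2] ![4] x =
      Sum.elim ![(3 : ℤ), 1, 0, 2] ![4] y → x = y := by decide
  refine isomorphic_of_bijective (fun x => e (Sum.elim ![3, 1, 0, 2] ![4] x)) ?_ ?_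
  · rw [Fintype.bijective_iff_injective_and_card]
    constructor
    · intro x y hxy
      exact hinj x y (hF.inj _ _ (hφ x).1 (hφ x).2 (hφ y).1 (hφ y).2 hxy)
    · have := hF.card
      simp only [Fintype.card_sum, Fintype.card_fin]
      omega
  · rintro (x | x) (y | y) <;> fin_cases x <;> fin_cases y <;>
      simp [fourVertexJoin, fourVertex, complete, *]

/-- Since `b = 2`, exactly one of `e 1`, `e 2` sends an arc to `e 0`. Rotating by two makes `e 2`
initial, and the relations `adj_zero_iff` in both frames settle all remaining arcs except those
between `e 1` and `e 3`. -/
theorem exceptional_of_three (hF : Frame D 3 e) (hE : Extremal D a b)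
    (hA : Alternating D 3 e) : IsIndependentJoin D ∨ IsFourVertexJoinOne D := by
  have hlast : ∀ x, 0 ≤ x → x ≤ 4 →
      (D.Adj (e x) (e 4) ↔ x % 2 = 1) ∧ (D.Adj (e 4) (e x) ↔ x % 2 = 1) :=
    fun x h0 h4 => hF.adj_last_iff_odd hE hA h0 (by omega)
  have h01 : D.Adj (e 0) (e 1) := hF.step 0 (by omega) (by omega)
  have h12 : D.Adj (e 1) (e 2) := hF.step 1 (by omega) (by omega)
  have h23 : D.Adj (e 2) (e 3) := hF.step 2 (by omega) (by omega)
  have h30 : D.Adj (e 3) (e 0) := hF.last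
  have hb : b = 2 := by
    have h := hF.swap.sum_adj_zero_three hE
    simp [hlast] at h
    omega
  subst hb
  have s0 := hF.sum_adj_zero_three hE
  have t1 := hF.adj_zero_iff hE (i := 1) (by omega) (by omega)
  have t2 := hF.adj_zero_iff hE (i := 2) (by omega) (by omega)
  obtain ⟨e', hF', c1, c2, -⟩ := hF.rotate hE (q := 2) (by omega) (by omega)
    ((hlast 1 (by omega) (by omega)).1.2 (by omega))
    (fun hc => absurd ((hlast 2 (by omega) (by omega)).1.1 hc) (by omega))
  have t3 := hF'.adj_zero_iff hE (i := 1) (by omega) (by omega)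
  have t4 := hF'.adj_zero_iff hE (i := 2) (by omega) (by omega)
  have d0 : e' 0 = e 2 := c1 0 (by omega)
  have d1 : e' 1 = e 3 := c1 1 (by omega)
  have d2 : e' 2 = e 0 := c2 2 (by omega) (by omega)
  have d3 : e' 3 = e 1 := c2 3 (by omega) (by omega)
  norm_num [d0, d1, d2, d3] at t1 t2 t3 t4 s0
  by_cases h10 : D.Adj (e 1) (e 0)
  · have h20 : ¬ D.Adj (e 2) (e 0) := by
      intro h; simp [h10, h] at s0
    have h02 := t1.1 h10
    have h03 : D.Adj (e 0) (e 3) := by tauto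
    have h32 : D.Adj (e 3) (e 2) := by tauto
    have h21 : D.Adj (e 2) (e 1) := by tauto
    left
    refine hF.isIndependentJoin hE (by omega) (fun u x hu hu4 hu2 hx hx4 => ?_)
    have hirr := fun i => hE.irrefl (e i)
    have l0 := hlast 0 (by omega) (by omega)
    have l2 := hlast 2 (by omega) (by omega)
    norm_num at l0 l2
    obtain rfl | rfl | rfl : u = 0 ∨ u = 2 ∨ u = 4 := by omega
    · obtain rfl | rfl | rfl | rfl | rfl : x = 0 ∨ x = 1 ∨ x = 2 ∨ x = 3 ∨ x = 4 := by omega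
      all_goals simp [*]
    · obtain rfl | rfl | rfl | rfl | rfl : x = 0 ∨ x = 1 ∨ x = 2 ∨ x = 3 ∨ x = 4 := by omega
      all_goals simp [*]
    · exact hlast x hx hx4
  · have h20 : D.Adj (e 2) (e 0) := by
      by_contra h; simp [h10, h] at s0
    right
    have h02 : D.Adj (e 0) (e 2) := by tauto
    exact hF.isFourVertexJoinOne hE hlast h10 (by tauto) (by tauto) (by tauto) h02 h20

theorem not_heptagon (hF : Frame D 5 e) (hE : Extremal D a b) {p q r s t u v : ℤ}
    (hnd : [p, q, r, s, t, u, v].Nodup)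
    (hx : ∀ x, x ∈ [p, q, r, s, t, u, v] ↔ 0 ≤ x ∧ x ≤ 5 + 1) (h1 : D.Adj (e p) (e q))
    (h2 : D.Adj (e q) (e r)) (h3 : D.Adj (e r) (e s)) (h4 : D.Adj (e s) (e t))
    (h5 : D.Adj (e t) (e u)) (h6 : D.Adj (e u) (e v)) : ¬ D.Adj (e v) (e p) := by
  refine hF.ham hE (P := fun x => x ∈ [p, q, r, s, t, u, v])
    ⟨[p, q, r, s, t, u, v], hnd, ?_, rfl, rfl, fun x => Iff.rfl⟩ hx
  simp [*]

/-- Three Hamilton cycles exclude `e 3 → e 1`, `e 5 → e 3` and `e 1 → e 5`. Each of `e 1`, `e 3`, `e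
5` then has `b + 1 = 4` non-out-neighbours including itself, which forces the opposite triangle. -/
theorem isomorphic_sevenVertex (hF : Frame D 5 e) (hE : Extremal D a 3)
    (hlast : ∀ x, 0 ≤ x → x ≤ 6 →
      (D.Adj (e x) (e 6) ↔ x % 2 = 1) ∧ (D.Adj (e 6) (e x) ↔ x % 2 = 1))
    (h02 : D.Adj (e 0) (e 2)) (h04 : D.Adj (e 0) (e 4)) (h20 : D.Adj (e 2) (e 0))
    (h24 : D.Adj (e 2) (e 4)) (h40 : D.Adj (e 4) (e 0)) (h42 : D.Adj (e 4) (e 2))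
    (h10 : ¬ D.Adj (e 1) (e 0)) (h14 : ¬ D.Adj (e 1) (e 4)) (h30 : ¬ D.Adj (e 3) (e 0))
    (h32 : ¬ D.Adj (e 3) (e 2)) (h52 : ¬ D.Adj (e 5) (e 2)) (h54 : ¬ D.Adj (e 5) (e 4))
    (h03 : ¬ D.Adj (e 0) (e 3)) (h05 : ¬ D.Adj (e 0) (e 5)) (h21 : ¬ D.Adj (e 2) (e 1))
    (h25 : ¬ D.Adj (e 2) (e 5)) (h41 : ¬ D.Adj (e 4) (e 1)) (h43 : ¬ D.Adj (e 4) (e 3)) :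
    Isomorphic D sevenVertex := by
  have h01 : D.Adj (e 0) (e 1) := hF.step 0 (by omega) (by omega)
  have h12 : D.Adj (e 1) (e 2) := hF.step 1 (by omega) (by omega)
  have h23 : D.Adj (e 2) (e 3) := hF.step 2 (by omega) (by omega)
  have h34 : D.Adj (e 3) (e 4) := hF.step 3 (by omega) (by omega)
  have h45 : D.Adj (e 4) (e 5) := hF.step 4 (by omega) (by omega)
  have h50 : D.Adj (e 5) (e 0) := hF.last
  have l0 := hlast 0 (by omega) (by omega)
  have l1 := hlast 1 (by omega) (by omega)
  have l2 := hlast 2 (by omega) (by omega)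
  have l3 := hlast 3 (by omega) (by omega)
  have l4 := hlast 4 (by omega) (by omega)
  have l5 := hlast 5 (by omega) (by omega)
  norm_num at l0 l1 l2 l3 l4 l5
  have hirr := fun i => hE.irrefl (e i)
  have h31 : ¬ D.Adj (e 3) (e 1) := fun h =>
    hF.not_heptagon hE (p := 3) (q := 1) (r := 6) (s := 5) (t := 0) (u := 4) (v := 2) (by decide)
      (by intro x; simp; omega) h l1.1 l5.2 h50 h04 h42 h23
  have h53 : ¬ D.Adj (e 5) (e 3) := fun h =>
    hF.not_heptagon hE (p := 5) (q := 3) (r := 6) (s := 1) (t := 2) (u := 0) (v := 4) (by decide)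
      (by intro x; simp; omega) h l3.1 l1.2 h12 h20 h04 h45
  have h15 : ¬ D.Adj (e 1) (e 5) := fun h =>
    hF.not_heptagon hE (p := 1) (q := 5) (r := 6) (s := 3) (t := 4) (u := 2) (v := 0) (by decide)
      (by intro x; simp; omega) h l5.1 l3.2 h34 h42 h20 h01
  have hcount : ∀ i p q r s t : ℤ, [p, q, r, s, t].Nodup →
      (∀ x ∈ [p, q, r, s, t], 0 ≤ x ∧ x ≤ 5 + 1) → ¬ D.Adj (e i) (e p) → ¬ D.Adj (e i) (e q) →
      ¬ D.Adj (e i) (e r) → ¬ D.Adj (e i) (e s) → D.Adj (e i) (e t) := by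
    intro i p q r s t hnd hx h1 h2 h3 h4
    by_contra h5
    have := hF.card_nonout hE i (T := [p, q, r, s, t].toFinset) (by
      intro k hk
      rw [List.mem_toFinset] at hk
      have hk' := hx k hk
      simp only [List.mem_cons, List.not_mem_nil, or_false] at hk
      rcases hk with rfl | rfl | rfl | rfl | rfl <;> exact ⟨hk'.1, hk'.2, by assumption⟩)
    rw [List.toFinset_card_of_nodup hnd] at this
    simp at this
  have h13 := hcount 1 0 1 4 5 3 (by decide) (by decide) h10 (hirr 1) h14 h15
  have h35 := hcount 3 0 1 2 3 5 (by decide) (by decide) h30 h31 h32 (hirr 3)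
  have h51 := hcount 5 2 3 4 5 1 (by decide) (by decide) h52 h53 h54 (hirr 5)
  have hφ : ∀ x : Fin 7, 0 ≤ ![(6 : ℤ), 1, 3, 5, 2, 4, 0] x ∧
      ![(6 : ℤ), 1, 3, 5, 2, 4, 0] x ≤ 5 + 1 := by decide
  have hinj : ∀ x y : Fin 7, ![(6 : ℤ), 1, 3, 5, 2, 4, 0] x = ![(6 : ℤ), 1, 3, 5, 2, 4, 0] y →
      x = y := by decide
  refine isomorphic_of_bijective (fun x => e (![6, 1, 3, 5, 2, 4, 0] x)) ?_ ?_
  · rw [Fintype.bijective_iff_injective_and_card]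
    constructor
    · intro x y hxy
      exact hinj x y (hF.inj _ _ (hφ x).1 (hφ x).2 (hφ y).1 (hφ y).2 hxy)
    · have := hF.card
      simp only [Fintype.card_fin]
      omega
  · intro x y
    fin_cases x <;> fin_cases y <;> simp [sevenVertex, *]

/-- Rotations make `e 0`, `e 2` and `e 4` initial in turn; the relations `adj_zero_iff` express the
arcs between an even vertex below 6 and the rest of the 6-cycle through six of them. The in-degree
counts at `e 0` and `e 2` and four forbidden Hamilton cycles leave two solutions. -/
theorem exceptional_of_five (hF : Frame D 5 e) (hE : Extremal D a b)
    (hA : Alternating D 5 e) : IsIndependentJoin D ∨ Isomorphic D sevenVertex := by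
  have hlast : ∀ x, 0 ≤ x → x ≤ 6 →
      (D.Adj (e x) (e 6) ↔ x % 2 = 1) ∧ (D.Adj (e 6) (e x) ↔ x % 2 = 1) :=
    fun x h0 h4 => hF.adj_last_iff_odd hE hA h0 (by omega)
  have h01 : D.Adj (e 0) (e 1) := hF.step 0 (by omega) (by omega)
  have h12 : D.Adj (e 1) (e 2) := hF.step 1 (by omega) (by omega)
  have h23 : D.Adj (e 2) (e 3) := hF.step 2 (by omega) (by omega)
  have h34 : D.Adj (e 3) (e 4) := hF.step 3 (by omega) (by omega)
  have h45 : D.Adj (e 4) (e 5) := hF.step 4 (by omega) (by omega)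
  have h50 : D.Adj (e 5) (e 0) := hF.last
  have l0 := hlast 0 (by omega) (by omega)
  have l1 := hlast 1 (by omega) (by omega)
  have l2 := hlast 2 (by omega) (by omega)
  have l3 := hlast 3 (by omega) (by omega)
  have l4 := hlast 4 (by omega) (by omega)
  have l5 := hlast 5 (by omega) (by omega)
  norm_num at l0 l1 l2 l3 l4 l5
  have hb : b = 3 := by
    have h := hF.swap.sum_adj_zero_five hE
    simp [hlast] at h
    omega
  subst hb
  have s0 := hF.sum_adj_zero_five hE
  have t1 := hF.adj_zero_iff hE (i := 1) (by omega) (by omega)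
  have t2 := hF.adj_zero_iff hE (i := 2) (by omega) (by omega)
  have t3 := hF.adj_zero_iff hE (i := 3) (by omega) (by omega)
  have t4 := hF.adj_zero_iff hE (i := 4) (by omega) (by omega)
  norm_num at s0 t1 t2 t3 t4
  obtain ⟨e', hF', c1, c2, -⟩ := hF.rotate hE (q := 2) (by omega) (by omega) l1.1 l2.1
  have s2 := hF'.sum_adj_zero_five hE
  have t5 := hF'.adj_zero_iff hE (i := 1) (by omega) (by omega)
  have t6 := hF'.adj_zero_iff hE (i := 2) (by omega) (by omega)
  have t7 := hF'.adj_zero_iff hE (i := 3) (by omega) (by omega)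
  have t8 := hF'.adj_zero_iff hE (i := 4) (by omega) (by omega)
  norm_num [show e' 0 = e 2 from c1 0 (by omega), show e' 1 = e 3 from c1 1 (by omega),
    show e' 2 = e 4 from c1 2 (by omega), show e' 3 = e 5 from c1 3 (by omega),
    show e' 4 = e 0 from c2 4 (by omega) (by omega),
    show e' 5 = e 1 from c2 5 (by omega) (by omega)] at t5 t6 t7 t8
  rw [show e' 0 = e 2 from c1 0 (by omega), show e' 1 = e 3 from c1 1 (by omega),
    show e' 2 = e 4 from c1 2 (by omega), show e' 3 = e 5 from c1 3 (by omega),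
    show e' 4 = e 0 from c2 4 (by omega) (by omega)] at s2
  clear hF' c1 c2
  obtain ⟨e'', hF'', c1, c2, -⟩ := hF.rotate hE (q := 4) (by omega) (by omega) l3.1 l4.1
  have t9 := hF''.adj_zero_iff hE (i := 1) (by omega) (by omega)
  have t10 := hF''.adj_zero_iff hE (i := 2) (by omega) (by omega)
  have t11 := hF''.adj_zero_iff hE (i := 3) (by omega) (by omega)
  have t12 := hF''.adj_zero_iff hE (i := 4) (by omega) (by omega)
  norm_num [show e'' 0 = e 4 from c1 0 (by omega), show e'' 1 = e 5 from c1 1 (by omega),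
    show e'' 2 = e 0 from c2 2 (by omega) (by omega),
    show e'' 3 = e 1 from c2 3 (by omega) (by omega),
    show e'' 4 = e 2 from c2 4 (by omega) (by omega),
    show e'' 5 = e 3 from c2 5 (by omega) (by omega)] at t9 t10 t11 t12
  clear hF'' c1 c2
  have n2 := not_iff_comm.1 t2.symm
  have n3 := not_iff_comm.1 t3.symm
  have n4 := not_iff_comm.1 t4.symm
  have n1 := not_iff_comm.1 t1.symm
  have n5 := not_iff_comm.1 t5.symm
  have n6 := not_iff_comm.1 t6.symm
  have n8 := not_iff_comm.1 t8.symm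
  have n10 := not_iff_comm.1 t10.symm
  have n12 := not_iff_comm.1 t12.symm
  have g1 : D.Adj (e 1) (e 0) → D.Adj (e 3) (e 2) → D.Adj (e 3) (e 0) := by
    intro x1 y1
    by_contra x3
    exact hF.not_heptagon hE (p := 0) (q := 4) (r := 5) (s := 6) (t := 3) (u := 2) (v := 1)
      (by decide) (by intro x; simp; omega) (n3.1 x3) h45 l5.1 l3.2 y1 (n8.1 (t1.1 x1)) x1
  have g4 : D.Adj (e 1) (e 0) ∨ D.Adj (e 4) (e 2) := by
    by_contra hc
    exact hF.not_heptagon hE (p := 0) (q := 2) (r := 3) (s := 6) (t := 1) (u := 4) (v := 5)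
      (by decide) (by intro x; simp; omega) (n1.1 fun h => hc (Or.inl h)) h23 l3.1 l1.2
      (t11.2 fun h => hc (Or.inr h)) h45 h50
  have g5 : D.Adj (e 3) (e 0) → D.Adj (e 3) (e 2) := by
    intro x3
    by_contra y1
    exact hF.not_heptagon hE (p := 2) (q := 4) (r := 5) (s := 6) (t := 3) (u := 0) (v := 1)
      (by decide) (by intro x; simp; omega) (n5.1 y1) h45 l5.1 l3.2 x3 h01 h12
  have g6 : D.Adj (e 4) (e 0) → D.Adj (e 2) (e 0) := by
    intro x4
    by_contra x2
    exact hF.not_heptagon hE (p := 4) (q := 0) (r := 1) (s := 6) (t := 5) (u := 2) (v := 3)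
      (by decide) (by intro x; simp; omega) x4 h01 l1.1 l5.2 (t7.2 x2) h23 h34
  have key : (D.Adj (e 1) (e 0) ∧ ¬ D.Adj (e 2) (e 0) ∧ D.Adj (e 3) (e 0) ∧ ¬ D.Adj (e 4) (e 0) ∧
      D.Adj (e 3) (e 2) ∧ ¬ D.Adj (e 4) (e 2)) ∨
      (¬ D.Adj (e 1) (e 0) ∧ D.Adj (e 2) (e 0) ∧ ¬ D.Adj (e 3) (e 0) ∧ D.Adj (e 4) (e 0) ∧
      ¬ D.Adj (e 3) (e 2) ∧ D.Adj (e 4) (e 2)) := by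
    classical
    rw [if_congr t7 rfl rfl, if_congr n1.symm rfl rfl] at s2
    clear t1 t2 t3 t4 t5 t6 t7 t8 t9 t10 t11 t12 n1 n2 n3 n4 n5 n6 n8 n10 n12
    by_cases x1 : D.Adj (e 1) (e 0) <;> by_cases x2 : D.Adj (e 2) (e 0) <;>
    by_cases x3 : D.Adj (e 3) (e 0) <;> by_cases x4 : D.Adj (e 4) (e 0) <;>
    by_cases y1 : D.Adj (e 3) (e 2) <;> by_cases y2 : D.Adj (e 4) (e 2) <;>
    simp [x1, x2, x3, x4, y1, y2] at s0 s2 g1 g4 g5 g6 ⊢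
  rcases key with ⟨x1, x2, x3, x4, y1, y2⟩ | ⟨x1, x2, x3, x4, y1, y2⟩
  · left
    have h02 := t1.1 x1
    have h03 := n2.1 x2
    have h04 := t3.1 x3
    have h05 := n4.1 x4
    have h24 := t5.1 y1
    have h25 := n6.1 y2
    have h52 := t7.2 x2
    have h21 := n8.1 h02
    have h54 := t9.2 x4
    have h41 := n10.1 h04
    have h14 := t11.2 y2
    have h43 := n12.1 h24
    have hirr := fun i => hE.irrefl (e i)
    refine hF.isIndependentJoin hE (by omega) (fun u x hu hu4 hu2 hx hx4 => ?_)
    clear t1 t2 t3 t4 t5 t6 t7 t8 t9 t10 t11 t12 g1 g4 g5 g6 s0 s2 n1 n2 n3 n4 n5 n6 n8 n10 n12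
    obtain rfl | rfl | rfl | rfl : u = 0 ∨ u = 2 ∨ u = 4 ∨ u = 6 := by omega
    rotate_right
    · exact hlast x hx hx4
    all_goals
      obtain rfl | rfl | rfl | rfl | rfl | rfl | rfl :
        x = 0 ∨ x = 1 ∨ x = 2 ∨ x = 3 ∨ x = 4 ∨ x = 5 ∨ x = 6 := by omega
      all_goals simp [*]
  · right
    have h02 := n1.1 x1
    have h04 := n3.1 x3
    have h24 := n5.1 y1
    exact hF.isomorphic_sevenVertex hE hlast h02 h04 x2 h24 x4 y2 x1 (fun h => t11.1 h y2) x3 y1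
      (fun h => t7.1 h x2) (fun h => t9.1 h x4) (t2.1 x2) (t4.1 x4) (t8.1 h02) (t6.1 y2)
      (t10.1 h04) (t12.1 h24)

/-- A non-Hamiltonian digraph with a frame is exceptional. -/
theorem exceptional (hF : Frame D M e) (hE : Extremal D a b) :
    IsIndependentJoin D ∨ IsFourVertexJoinOne D ∨ Isomorphic D sevenVertex := by
  by_cases hall : ∀ e', Frame D M e' → Alternating D M e'
  · exact Or.inl (hF.isIndependentJoin_of_forall hE hall)
  push Not at hall
  obtain ⟨e₁, hF₁, hA₁⟩ := hall
  obtain ⟨rfl | rfl, e', hF', hA⟩ := hF₁.alternating_of_not_alternating hE hA₁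
  · have := hF'.exceptional_of_three hE hA
    tauto
  · have := hF'.exceptional_of_five hE hA
    tauto

end Frame
end HamiltonDigraph
-- A longest cycle and a path outside it
namespace HamiltonDigraph
variable {V : Type*} {D : Digraph V} {a b m l : ℤ} {c p w : ℤ → V}

/-- `w 1, …, w m` is a directed cycle. -/
structure IsCycle (D : Digraph V) (m : ℤ) (w : ℤ → V) : Prop where
  two_le : 2 ≤ m
  inj : ∀ i j, 1 ≤ i → i ≤ m → 1 ≤ j → j ≤ m → w i = w j → i = j
  step : ∀ i, 1 ≤ i → i < m → D.Adj (w i) (w (i + 1))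
  last : D.Adj (w m) (w 1)

/-- A cycle of length `m`, enumerated periodically by `c`, and a disjoint path `p 0, …, p l` that
cannot be extended at its ends outside the cycle. -/
structure CyclePath (D : Digraph V) (m l : ℤ) (c p : ℤ → V) : Prop where
  two_le : 2 ≤ m
  nonneg : 0 ≤ l
  per : ∀ i, c (i + m) = c i
  inj : ∀ i j, c i = c j → m ∣ i - j
  step : ∀ i, D.Adj (c i) (c (i + 1))
  pinj : ∀ i j, 0 ≤ i → i ≤ l → 0 ≤ j → j ≤ l → p i = p j → i = j
  pstep : ∀ i, 0 ≤ i → i < l → D.Adj (p i) (p (i + 1))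
  disj : ∀ i j, 0 ≤ j → j ≤ l → c i ≠ p j
  inn : ∀ x, D.Adj x (p 0) → (∃ i, c i = x) ∨ ∃ i, 0 ≤ i ∧ i ≤ l ∧ p i = x
  out : ∀ x, D.Adj (p l) x → (∃ i, c i = x) ∨ ∃ i, 0 ≤ i ∧ i ≤ l ∧ p i = x

theorem eq_of_dvd_sub {i j : ℤ} (h : m ∣ i - j) (h1 : i - j < m) (h2 : j - i < m) : i = j := by
  have := Int.eq_zero_of_abs_lt_dvd h (abs_lt.2 ⟨by omega, h1⟩)
  omega

namespace CyclePath

theorem inj_window (h : CyclePath D m l c p) {i j : ℤ} (h1 : i - j < m) (h2 : j - i < m)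
    (hij : c i = c j) : i = j :=
  eq_of_dvd_sub (h.inj i j hij) h1 h2

/-- Replacing `c (i + 1), …, c (k - 1)` by `p s, …, p t` gives a cycle of length `m - (k - i - 1) +
(t - s + 1)`, which must not exceed `m`. -/
theorem insert_le (h : CyclePath D m l c p) (hmax : ∀ m' w, IsCycle D m' w → m' ≤ m)
    {i k s t : ℤ} (h1 : 1 ≤ k - i) (h2 : k - i ≤ m) (hs : 0 ≤ s) (hst : s ≤ t) (ht : t ≤ l)
    (hi : D.Adj (c i) (p s)) (hk : D.Adj (p t) (c k)) : t - s + 2 ≤ k - i := by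
  have key := hmax (i + m - k + 1 + (t - s + 1))
    (fun x => if x ≤ i + m - k + 1 then c (k - 1 + x) else p (s + x - (i + m - k + 2)))
    ⟨by omega, ?_, ?_, ?_⟩
  · omega
  · intro x y hx hx' hy hy' hxy
    split_ifs at hxy
    · have := h.inj_window (by omega) (by omega) hxy
      omega
    · exact absurd hxy (h.disj _ _ (by omega) (by omega))
    · exact absurd hxy.symm (h.disj _ _ (by omega) (by omega))
    · have := h.pinj _ _ (by omega) (by omega) (by omega) (by omega) hxy
      omega
  · intro x hx hx'
    by_cases c1 : x + 1 ≤ i + m - k + 1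
    · rw [if_pos (by omega), if_pos c1, ← add_assoc]
      exact h.step _
    · by_cases c2 : x = i + m - k + 1
      · rw [if_pos (by omega), if_neg c1, show k - 1 + x = i + m by omega, h.per,
          show s + (x + 1) - (i + m - k + 2) = s by omega]
        exact hi
      · rw [if_neg (by omega), if_neg c1,
          show s + (x + 1) - (i + m - k + 2) = s + x - (i + m - k + 2) + 1 by omega]
        exact h.pstep _ (by omega) (by omega)
  · rw [if_neg (by omega), if_pos (by omega),
      show s + (i + m - k + 1 + (t - s + 1)) - (i + m - k + 2) = t by omega,
      show k - 1 + 1 = k by omega]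
    exact hk

theorem shift (h : CyclePath D m l c p) (k : ℤ) : CyclePath D m l (fun i => c (i + k)) p where
  two_le := h.two_le
  nonneg := h.nonneg
  per i := by rw [show i + m + k = i + k + m by ring, h.per]
  inj i j hij := by have := h.inj _ _ hij; rwa [add_sub_add_right_eq_sub] at this
  step i := by rw [show i + 1 + k = i + k + 1 by ring]; exact h.step _
  pinj := h.pinj
  pstep := h.pstep
  disj i := h.disj (i + k)
  inn x hx := (h.inn x hx).imp_left fun ⟨i, hi⟩ => ⟨i - k, by rw [sub_add_cancel, hi]⟩
  out x hx := (h.out x hx).imp_left fun ⟨i, hi⟩ => ⟨i - k, by rw [sub_add_cancel, hi]⟩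

theorem reverse (h : CyclePath D m l c p) (k : ℤ) :
    CyclePath (rev D) m l (fun i => c (k - i)) (fun i => p (l - i)) where
  two_le := h.two_le
  nonneg := h.nonneg
  per i := by rw [← h.per, show k - (i + m) + m = k - i by ring]
  inj i j hij := by
    have := h.inj _ _ hij
    rw [show k - i - (k - j) = -(i - j) by ring] at this
    exact (dvd_neg).1 this
  step i := by
    have := h.step (k - (i + 1))
    rwa [show k - (i + 1) + 1 = k - i by ring] at this
  pinj i j h1 h2 h3 h4 hij := by
    have := h.pinj _ _ (by omega) (by omega) (by omega) (by omega) hij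
    omega
  pstep i h1 h2 := by
    have := h.pstep (l - (i + 1)) (by omega) (by omega)
    rwa [show l - (i + 1) + 1 = l - i by ring] at this
  disj i j h1 h2 := h.disj _ _ (by omega) (by omega)
  inn x hx := by
    rw [sub_zero] at hx
    rcases h.out x hx with ⟨i, hi⟩ | ⟨i, h1, h2, hi⟩
    · exact Or.inl ⟨k - i, by rw [sub_sub_cancel, hi]⟩
    · exact Or.inr ⟨l - i, by omega, by omega, by rw [sub_sub_cancel, hi]⟩
  out x hx := by
    rw [sub_self] at hx
    rcases h.inn x hx with ⟨i, hi⟩ | ⟨i, h1, h2, hi⟩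
    · exact Or.inl ⟨k - i, by rw [sub_sub_cancel, hi]⟩
    · exact Or.inr ⟨l - i, by omega, by omega, by rw [sub_sub_cancel, hi]⟩

theorem exists_window (h : CyclePath D m l c p) (q i : ℤ) :
    ∃ j, q ≤ j ∧ j < q + m ∧ c j = c i := by
  have hm := h.two_le
  have hz : ∀ (n : ℕ) (x : ℤ), c (x + n * m) = c x := by
    intro n
    induction n with
    | zero => intro x; simp
    | succ n ih =>
      intro x
      rw [show x + ((n + 1 : ℕ) : ℤ) * m = x + n * m + m by push_cast; ring, h.per, ih]
  refine ⟨q + (i - q) % m, ?_, ?_, ?_⟩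
  · have := Int.emod_nonneg (i - q) (show m ≠ 0 by omega); omega
  · have := Int.emod_lt_of_pos (i - q) (show 0 < m by omega); omega
  · have hdiv := Int.emod_add_mul_ediv (i - q) m
    rcases le_total 0 ((i - q) / m) with h0 | h0
    · obtain ⟨n, hn⟩ := Int.eq_ofNat_of_zero_le h0
      rw [← hz n, ← hn]
      congr 1
      linarith [mul_comm m ((i - q) / m)]
    · obtain ⟨n, hn⟩ := Int.eq_ofNat_of_zero_le (neg_nonneg.2 h0)
      rw [← hz n i, ← hn]
      congr 1
      linarith [mul_comm m ((i - q) / m), neg_mul ((i - q) / m) m]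

variable [Fintype V]

theorem le_card (h : CyclePath D m l c p) : m + l + 1 ≤ Fintype.card V := by
  classical
  have hm := h.two_le
  have hl := h.nonneg
  have hd : Disjoint ((Finset.Icc 1 m).image c) ((Finset.Icc 0 l).image p) := by
    rw [Finset.disjoint_left]
    intro x hx hx'
    obtain ⟨i, -, rfl⟩ := Finset.mem_image.1 hx
    obtain ⟨j, hj, hij⟩ := Finset.mem_image.1 hx'
    rw [Finset.mem_Icc] at hj
    exact h.disj i j hj.1 hj.2 hij.symm
  have h1 := Finset.card_le_univ ((Finset.Icc 1 m).image c ∪ (Finset.Icc 0 l).image p)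
  rw [Finset.card_union_of_disjoint hd, Finset.card_image_of_injOn, Finset.card_image_of_injOn,
    Int.card_Icc, Int.card_Icc] at h1
  · omega
  · intro i hi j hj hij
    simp only [Finset.coe_Icc, Set.mem_Icc] at hi hj
    exact h.pinj i j hi.1 hi.2 hj.1 hj.2 hij
  · intro i hi j hj hij
    simp only [Finset.coe_Icc, Set.mem_Icc] at hi hj
    exact h.inj_window (by omega) (by omega) hij

theorem cover (h : CyclePath D m l c p) (hcard : (Fintype.card V : ℤ) = m + l + 1) (x : V) :
    (∃ i, 1 ≤ i ∧ i ≤ m ∧ c i = x) ∨ ∃ i, 0 ≤ i ∧ i ≤ l ∧ p i = x := by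
  classical
  have hm := h.two_le
  have hl := h.nonneg
  have hd : Disjoint ((Finset.Icc 1 m).image c) ((Finset.Icc 0 l).image p) := by
    rw [Finset.disjoint_left]
    intro x hx hx'
    obtain ⟨i, -, rfl⟩ := Finset.mem_image.1 hx
    obtain ⟨j, hj, hij⟩ := Finset.mem_image.1 hx'
    rw [Finset.mem_Icc] at hj
    exact h.disj i j hj.1 hj.2 hij.symm
  have h1 : (Finset.Icc 1 m).image c ∪ (Finset.Icc 0 l).image p = Finset.univ := by
    apply Finset.eq_univ_of_card
    rw [Finset.card_union_of_disjoint hd, Finset.card_image_of_injOn, Finset.card_image_of_injOn,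
      Int.card_Icc, Int.card_Icc]
    · omega
    · intro i hi j hj hij
      simp only [Finset.coe_Icc, Set.mem_Icc] at hi hj
      exact h.pinj i j hi.1 hi.2 hj.1 hj.2 hij
    · intro i hi j hj hij
      simp only [Finset.coe_Icc, Set.mem_Icc] at hi hj
      exact h.inj_window (by omega) (by omega) hij
  have hx := Finset.mem_univ x
  rw [← h1, Finset.mem_union, Finset.mem_image, Finset.mem_image] at hx
  rcases hx with ⟨i, hi, hx⟩ | ⟨i, hi, hx⟩
  · rw [Finset.mem_Icc] at hi
    exact Or.inl ⟨i, hi.1, hi.2, hx⟩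
  · rw [Finset.mem_Icc] at hi
    exact Or.inr ⟨i, hi.1, hi.2, hx⟩

open Classical in
-- The in-neighbours on the cycle are indexed by their successors, so that this set can be compared
-- with the out-neighbours of `p l`.
theorem inDegree_le (h : CyclePath D m l c p) (hE : Extremal D a b) :
    inDegree D (p 0) ≤ ((Finset.Icc 1 m).filter (fun t => D.Adj (c (t - 1)) (p 0))).card +
      ((Finset.Icc 1 l).filter (fun t => D.Adj (p t) (p 0))).card := by
  refine le_trans ?_ (Nat.add_le_add (Finset.card_image_le (f := fun t => c (t - 1)))
    (Finset.card_image_le (f := p)))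
  refine le_trans ?_ (Finset.card_union_le _ _)
  rw [inDegree, ← Set.ncard_coe_finset]
  refine Set.ncard_le_ncard (fun x hx => ?_) (Set.toFinite _)
  change D.Adj x (p 0) at hx
  rw [Finset.mem_coe, Finset.mem_union, Finset.mem_image, Finset.mem_image]
  rcases h.inn x hx with ⟨i, rfl⟩ | ⟨i, h1, h2, rfl⟩
  · obtain ⟨j, h1, h2, h3⟩ := h.exists_window 0 i
    refine Or.inl ⟨j + 1, ?_, by rw [add_sub_cancel_right, h3]⟩
    rw [Finset.mem_filter, Finset.mem_Icc, add_sub_cancel_right, h3]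
    exact ⟨by omega, hx⟩
  · refine Or.inr ⟨i, ?_, rfl⟩
    rw [Finset.mem_filter, Finset.mem_Icc]
    have : i ≠ 0 := by rintro rfl; exact hE.irrefl _ hx
    exact ⟨by omega, hx⟩

open Classical in
theorem outDegree_le (h : CyclePath D m l c p) (hE : Extremal D a b) :
    outDegree D (p l) ≤ ((Finset.Icc 1 m).filter (fun t => D.Adj (p l) (c t))).card +
      (l).toNat := by
  have hcard : ((Finset.Icc 0 (l - 1)).image p).card ≤ l.toNat :=
    Finset.card_image_le.trans (by rw [Int.card_Icc]; omega)
  refine le_trans ?_ (Nat.add_le_add (Finset.card_image_le (f := c)) hcard)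
  refine le_trans ?_ (Finset.card_union_le _ _)
  rw [outDegree, ← Set.ncard_coe_finset]
  refine Set.ncard_le_ncard (fun x hx => ?_) (Set.toFinite _)
  change D.Adj (p l) x at hx
  rw [Finset.mem_coe, Finset.mem_union, Finset.mem_image, Finset.mem_image]
  rcases h.out x hx with ⟨i, rfl⟩ | ⟨i, h1, h2, rfl⟩
  · obtain ⟨j, h1, h2, h3⟩ := h.exists_window 1 i
    refine Or.inl ⟨j, ?_, h3⟩
    rw [Finset.mem_filter, Finset.mem_Icc, h3]
    exact ⟨by omega, hx⟩
  · refine Or.inr ⟨i, ?_, rfl⟩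
    rw [Finset.mem_Icc]
    have : i ≠ l := by rintro rfl; exact hE.irrefl _ hx
    omega

open Classical in
/-- The consequences of the equality case in the count of the neighbours of the ends of `p`. -/
theorem count (h : CyclePath D m l c p) (hmax : ∀ m' w, IsCycle D m' w → m' ≤ m)
    (hE : Extremal D a b) {j : ℤ} (hj : 1 ≤ j) (hjm : j ≤ m) (h0 : D.Adj (c 0) (p 0))
    (hb : D.Adj (p l) (c j)) (hno : ∀ t, 0 < t → t < j → ¬ D.Adj (c t) (p 0)) :
    l + 2 ≤ j ∧ m + l = a + b ∧
      (∀ t, 1 ≤ t → t ≤ m → D.Adj (c (t - 1)) (p 0) ∨ D.Adj (p l) (c t) ∨ (2 ≤ t ∧ t ≤ l + 1)) ∧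
      (∀ t, 1 ≤ t → t ≤ l → D.Adj (p t) (p 0)) ∧
      (((Finset.Icc 1 m).filter (fun t => D.Adj (p l) (c t))).card : ℤ) = a - l := by
  have hl := h.nonneg
  have hm := h.two_le
  have hjl : l + 2 ≤ j := by
    have := h.insert_le hmax (i := 0) (k := j) (by omega) (by omega) le_rfl hl le_rfl h0 hb
    omega
  set A := (Finset.Icc 1 m).filter (fun t => D.Adj (c (t - 1)) (p 0)) with hA
  set B := (Finset.Icc 1 m).filter (fun t => D.Adj (p l) (c t)) with hB
  set Q := (Finset.Icc 1 l).filter (fun t => D.Adj (p t) (p 0)) with hQ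
  -- A common `t` would allow the whole path to be inserted into the arc from `c (t - 1)` to `c t`.
  have hAB : Disjoint A B := by
    rw [Finset.disjoint_left]
    intro t ht ht'
    rw [hA, Finset.mem_filter] at ht
    rw [hB, Finset.mem_filter] at ht'
    have := h.insert_le hmax (i := t - 1) (k := t) (by omega) (by omega) le_rfl hl le_rfl ht.2 ht'.2
    omega
  -- The `l` positions `2, …, l + 1` are free: a member of `A` would contradict `hno`, a member of
  -- `B` would allow a longer cycle through `c 0 → p 0`. Hence `(b - l) + (a - l) + l ≤ m`, while `m
  -- + l ≤ a + b`.
  have hABG : Disjoint (A ∪ B) (Finset.Icc 2 (l + 1)) := by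
    rw [Finset.disjoint_left]
    intro t ht ht'
    rw [Finset.mem_Icc] at ht'
    rcases Finset.mem_union.1 ht with ht | ht
    · rw [hA, Finset.mem_filter] at ht
      exact hno (t - 1) (by omega) (by omega) ht.2
    · rw [hB, Finset.mem_filter] at ht
      have := h.insert_le hmax (i := 0) (k := t) (by omega) (by omega) le_rfl hl le_rfl h0 ht.2
      omega
  have hsub : A ∪ B ∪ Finset.Icc 2 (l + 1) ⊆ Finset.Icc 1 m := by
    intro t ht
    rw [Finset.mem_union, Finset.mem_union, hA, hB, Finset.mem_filter, Finset.mem_filter,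
      Finset.mem_Icc, Finset.mem_Icc] at ht
    rw [Finset.mem_Icc]
    omega
  have c1 := Finset.card_le_card hsub
  rw [Finset.card_union_of_disjoint hABG, Finset.card_union_of_disjoint hAB, Int.card_Icc,
    Int.card_Icc] at c1
  have c2 := h.inDegree_le hE
  have c3 := h.outDegree_le hE
  have c4 : Q.card ≤ l.toNat := by
    have := Finset.card_filter_le (Finset.Icc 1 l) (fun t => D.Adj (p t) (p 0))
    rw [Int.card_Icc] at this
    rw [hQ]; omega
  have c5 := hE.inn (p 0)
  have c6 := hE.out (p l)
  have c7 := h.le_card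
  have c8 := hE.card
  rw [← hA, ← hQ] at c2
  rw [← hB] at c3
  refine ⟨hjl, by omega, ?_, ?_, by omega⟩
  · have heq : A ∪ B ∪ Finset.Icc 2 (l + 1) = Finset.Icc 1 m := by
      apply Finset.eq_of_subset_of_card_le hsub
      rw [Finset.card_union_of_disjoint hABG, Finset.card_union_of_disjoint hAB, Int.card_Icc,
        Int.card_Icc]
      omega
    intro t h1 h2
    have ht : t ∈ Finset.Icc 1 m := Finset.mem_Icc.2 ⟨h1, h2⟩
    rw [← heq, Finset.mem_union, Finset.mem_union, hA, hB, Finset.mem_filter, Finset.mem_filter,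
      Finset.mem_Icc, Finset.mem_Icc] at ht
    tauto
  · have heq : Q = Finset.Icc 1 l := by
      have hQs : Q ⊆ Finset.Icc 1 l := by rw [hQ]; exact Finset.filter_subset _ _
      exact Finset.eq_of_subset_of_card_le hQs (by rw [Int.card_Icc]; omega)
    intro t h1 h2
    have ht : t ∈ Q := by rw [heq]; exact Finset.mem_Icc.2 ⟨h1, h2⟩
    exact (Finset.mem_filter.1 ht).2

/-- After a rotation, `c 0` sends an arc to `p 0` and `p l` sends an arc to `c (l + 2)`. -/
theorem exists_normal (h : CyclePath D m l c p) (hmax : ∀ m' w, IsCycle D m' w → m' ≤ m)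
    (hE : Extremal D a b) (hla : l < a) (hlb : l < b) :
    ∃ k, D.Adj (c k) (p 0) ∧ D.Adj (p l) (c (k + (l + 2))) := by
  classical
  have hl := h.nonneg
  have hm := h.two_le
  obtain ⟨i, hi⟩ : ∃ i, D.Adj (c i) (p 0) := by
    by_contra hcon
    push Not at hcon
    have c1 := h.inDegree_le hE
    rw [Finset.filter_false_of_mem (fun t _ => hcon _), Finset.card_empty] at c1
    have c2 := Finset.card_filter_le (Finset.Icc 1 l) (fun t => D.Adj (p t) (p 0))
    rw [Int.card_Icc] at c2
    have := hE.inn (p 0)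
    omega
  obtain ⟨j, hj⟩ : ∃ j, D.Adj (p l) (c j) := by
    by_contra hcon
    push Not at hcon
    have c1 := h.outDegree_le hE
    rw [Finset.filter_false_of_mem (fun t _ => hcon _), Finset.card_empty] at c1
    have := hE.out (p l)
    omega
  obtain ⟨i', hi1, hi2, hi3⟩ := h.exists_window (j - m) i
  rw [← hi3] at hi
  -- Take the last in-neighbour of `p 0` before an out-neighbour of `p l`. In the equality case of
  -- `count`, position `l + 2` after it can only be an out-neighbour of `p l`.
  obtain ⟨k, ⟨hk1, hk2⟩, hk3⟩ := Int.exists_greatest_of_bdd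
    (P := fun x => x < j ∧ D.Adj (c x) (p 0)) ⟨j, fun z hz => hz.1.le⟩ ⟨i', by omega, hi⟩
  have hki := hk3 i' ⟨by omega, hi⟩
  obtain ⟨d1, -, d3, -⟩ := (h.shift k).count hmax hE (j := j - k) (by omega) (by omega)
    (by simpa using hk2) (by simpa using hj)
    (fun t h1 h2 h3 => by have := hk3 (t + k) ⟨by omega, h3⟩; omega)
  refine ⟨k, hk2, ?_⟩
  rcases d3 (l + 2) (by omega) (by omega) with h3 | h3 | h3
  · have := hk3 (l + 2 - 1 + k) ⟨by omega, h3⟩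
    omega
  · rwa [add_comm]
  · omega

end CyclePath
end HamiltonDigraph
-- A path of positive length outside the cycle
namespace HamiltonDigraph
variable {V : Type*} {D : Digraph V} {a b m l : ℤ} {c p w : ℤ → V}

namespace IsCycle

theorem of_rev (h : IsCycle (rev D) m w) : IsCycle D m (fun i => w (m + 1 - i)) where
  two_le := h.two_le
  inj i j h1 h2 h3 h4 hij := by
    have := h.inj _ _ (by omega) (by omega) (by omega) (by omega) hij
    omega
  step i h1 h2 := by
    have := h.step (m - i) (by omega) (by omega)
    rw [show m + 1 - (i + 1) = m - i by ring, show m + 1 - i = m - i + 1 by ring]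
    exact this
  last := by
    have := h.last
    have h1 := h.two_le
    rw [show m + 1 - m = 1 by ring, show m + 1 - 1 = m by ring]
    exact this

theorem cyclePath (hw : IsCycle D m w) (hl : 0 ≤ l)
    (hinj : ∀ i j, 0 ≤ i → i ≤ l → 0 ≤ j → j ≤ l → p i = p j → i = j)
    (hstep : ∀ i, 0 ≤ i → i < l → D.Adj (p i) (p (i + 1)))
    (hdisj : ∀ i j, 1 ≤ i → i ≤ m → 0 ≤ j → j ≤ l → w i ≠ p j)
    (hinn : ∀ x, D.Adj x (p 0) → (∃ i, 1 ≤ i ∧ i ≤ m ∧ w i = x) ∨ ∃ i, 0 ≤ i ∧ i ≤ l ∧ p i = x)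
    (hout : ∀ x, D.Adj (p l) x → (∃ i, 1 ≤ i ∧ i ≤ m ∧ w i = x) ∨ ∃ i, 0 ≤ i ∧ i ≤ l ∧ p i = x) :
    CyclePath D m l (fun i => w ((i - 1) % m + 1)) p := by
  have hm := hw.two_le
  have hr : ∀ i : ℤ, 0 ≤ (i - 1) % m ∧ (i - 1) % m < m := fun i =>
    ⟨Int.emod_nonneg _ (by omega), Int.emod_lt_of_pos _ (by omega)⟩
  have hwin : ∀ i, 1 ≤ i → i ≤ m → w ((i - 1) % m + 1) = w i := fun i h1 h2 => by
    rw [Int.emod_eq_of_lt (by omega) (by omega), sub_add_cancel]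
  refine ⟨hm, hl, fun i => ?_, fun i j hij => ?_, fun i => ?_, hinj, hstep, fun i j h1 h2 => ?_,
    fun x hx => (hinn x hx).imp_left fun ⟨i, h1, h2, hi⟩ => ⟨i, by rw [hwin i h1 h2, hi]⟩,
    fun x hx => (hout x hx).imp_left fun ⟨i, h1, h2, hi⟩ => ⟨i, by rw [hwin i h1 h2, hi]⟩⟩
  · rw [show i + m - 1 = i - 1 + m by ring, Int.add_emod_right]
  · have h1 := hr i
    have h2 := hr j
    have h3 := hw.inj _ _ (by omega) (by omega) (by omega) (by omega) hij
    have h4 : j - 1 ≡ i - 1 [ZMOD m] := by unfold Int.ModEq; omega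
    have h5 := h4.dvd
    rwa [sub_sub_sub_cancel_right] at h5
  · have h1 := hr i
    have h2 : (i + 1 - 1) % m = ((i - 1) % m + 1) % m := by
      rw [Int.emod_add_emod, sub_add_cancel, add_sub_cancel_right]
    rw [h2]
    by_cases h3 : (i - 1) % m + 1 = m
    · rw [h3, Int.emod_self]
      exact hw.last
    · rw [Int.emod_eq_of_lt (a := (i - 1) % m + 1) (by omega) (by omega)]
      exact hw.step _ (by omega) (by omega)
  · have h3 := hr i
    exact hdisj _ _ (by omega) (by omega) h1 h2

end IsCycle

namespace CyclePath

variable [Fintype V]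

/-- A Hamilton path on the vertices `c 1, …, c m, p 0, …, p l`, enumerated in this order by
`1, …, m + l + 1`, is not closed by an arc. -/
theorem ham (h : CyclePath D m l c p) (hE : Extremal D a b)
    (hcard : (Fintype.card V : ℤ) = m + l + 1) {f : ℤ → V} (hc : ∀ i, i ≤ m → f i = c i)
    (hp : ∀ i, 0 ≤ i → f (m + 1 + i) = p i) {s t : ℤ} {P : ℤ → Prop}
    (hP : PathOn (fun x y => D.Adj (f x) (f y)) s t P)
    (hP' : ∀ x, P x ↔ 1 ≤ x ∧ x ≤ m + l + 1) : ¬ D.Adj (f t) (f s) := by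
  have hm := h.two_le
  have hl := h.nonneg
  have hp' : ∀ i, m < i → f i = p (i - m - 1) := fun i hi => by
    rw [← hp _ (by omega)]; congr 1; omega
  intro hts
  refine hE.non ((hP.map (fun x y hx hy hxy => ?_)).hasHamiltonCycle hts ?_ (fun x => ?_))
  · have h1 := (hP' x).1 hx
    have h2 := (hP' y).1 hy
    rcases le_or_gt x m with c1 | c1 <;> rcases le_or_gt y m with c2 | c2
    · rw [hc x c1, hc y c2] at hxy
      exact h.inj_window (by omega) (by omega) hxy
    · rw [hc x c1, hp' y c2] at hxy
      exact absurd hxy (h.disj _ _ (by omega) (by omega))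
    · rw [hp' x c1, hc y c2] at hxy
      exact absurd hxy.symm (h.disj _ _ (by omega) (by omega))
    · rw [hp' x c1, hp' y c2] at hxy
      have := h.pinj _ _ (by omega) (by omega) (by omega) (by omega) hxy
      omega
  · intro h; rw [h] at hts; exact hE.irrefl _ hts
  · rcases h.cover hcard x with ⟨i, h1, h2, hi⟩ | ⟨i, h1, h2, hi⟩
    · exact ⟨i, (hP' i).2 (by omega), by rw [hc i h2, hi]⟩
    · exact ⟨m + 1 + i, (hP' _).2 (by omega), by rw [hp i h1, hi]⟩

/-- For `l ≥ 1` the neighbours of the ends of `p` on the cycle form two intervals. -/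
theorem intervals (h : CyclePath D m l c p) (hmax : ∀ m' w, IsCycle D m' w → m' ≤ m)
    (hE : Extremal D a b) (hl : 1 ≤ l) (hlm : l + 2 ≤ m) (h0 : D.Adj (c 0) (p 0))
    (hj : D.Adj (p l) (c (l + 2))) :
    m + l = a + b ∧ ∀ t, 1 ≤ t → t ≤ m →
      (D.Adj (c t) (p 0) ↔ a + 1 ≤ t) ∧ (D.Adj (p l) (c t) ↔ l + 2 ≤ t ∧ t ≤ a + 1) := by
  classical
  obtain ⟨-, d2, d3, -, d5⟩ := h.count hmax hE (j := l + 2) (by omega) hlm h0 hj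
    (fun t h1 h2 h3 => by
      have := h.insert_le hmax (i := t) (k := l + 2) (by omega) (by omega) le_rfl h.nonneg le_rfl
        h3 hj
      omega)
  have hB : ∀ t, 1 ≤ t → t ≤ m → D.Adj (p l) (c t) → l + 2 ≤ t := fun t h1 h2 h3 => by
    have := h.insert_le hmax (i := 0) (k := t) (by omega) (by omega) le_rfl h.nonneg le_rfl h0 h3
    omega
  obtain ⟨f, ⟨hfm, hf⟩, hf'⟩ := Int.exists_greatest_of_bdd
    (P := fun x => x ≤ m ∧ D.Adj (p l) (c x)) ⟨m, fun z hz => hz.1⟩ ⟨l + 2, hlm, hj⟩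
  have hfl := hf' (l + 2) ⟨hlm, hj⟩
  -- Take the last in-neighbour `c t` of `p 0` before the last out-neighbour `c f` of `p l`. By
  -- `count`, position `t + 2` is either preceded by an in-neighbour, or an out-neighbour, or in the
  -- initial gap; the first contradicts the choice of `t`, the others `insert_le`, because a gap of
  -- `l + 2 ≥ 3` is required.
  have hnoA : ∀ t, 0 < t → t < f → ¬ D.Adj (c t) (p 0) := by
    intro t0 h1 h2 h3
    obtain ⟨t, ⟨ht, htA⟩, ht'⟩ := Int.exists_greatest_of_bdd
      (P := fun x => x < f ∧ D.Adj (c x) (p 0)) ⟨f, fun z hz => hz.1.le⟩ ⟨t0, h2, h3⟩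
    have h4 := ht' t0 ⟨h2, h3⟩
    have h5 := h.insert_le hmax (i := t) (k := f) (by omega) (by omega) le_rfl h.nonneg le_rfl
      htA hf
    rcases d3 (t + 2) (by omega) (by omega) with h6 | h6 | h6
    · have := ht' (t + 2 - 1) ⟨by omega, h6⟩
      omega
    · have := h.insert_le hmax (i := t) (k := t + 2) (by omega) (by omega) le_rfl h.nonneg le_rfl
        htA h6
      omega
    · have := h.insert_le hmax (i := t) (k := l + 2) (by omega) (by omega) le_rfl h.nonneg le_rfl
        htA hj
      omega
  have hA : ∀ t, 1 ≤ t → t ≤ m → (D.Adj (c t) (p 0) ↔ f ≤ t) := by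
    intro t h1 h2
    refine ⟨fun h3 => by_contra fun h4 => hnoA t (by omega) (by omega) h3, fun h3 => ?_⟩
    rcases eq_or_lt_of_le h2 with h4 | h4
    · rw [h4, ← zero_add m, h.per]; exact h0
    · rcases d3 (t + 1) (by omega) (by omega) with h5 | h5 | h5
      · rwa [add_sub_cancel_right] at h5
      · have := hf' (t + 1) ⟨by omega, h5⟩
        omega
      · omega
  have hB' : ∀ t, 1 ≤ t → t ≤ m → (D.Adj (p l) (c t) ↔ l + 2 ≤ t ∧ t ≤ f) := by
    intro t h1 h2
    refine ⟨fun h3 => ⟨hB t h1 h2 h3, hf' t ⟨h2, h3⟩⟩, fun h3 => ?_⟩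
    rcases d3 t h1 h2 with h5 | h5 | h5
    · exact absurd h5 (hnoA (t - 1) (by omega) (by omega))
    · exact h5
    · omega
  have hfa : f = a + 1 := by
    have heq : (Finset.Icc 1 m).filter (fun t => D.Adj (p l) (c t)) = Finset.Icc (l + 2) f := by
      ext t
      rw [Finset.mem_filter, Finset.mem_Icc, Finset.mem_Icc]
      constructor
      · rintro ⟨⟨h1, h2⟩, h3⟩
        exact (hB' t h1 h2).1 h3
      · rintro ⟨h1, h2⟩
        exact ⟨by omega, (hB' t (by omega) (by omega)).2 ⟨h1, h2⟩⟩
    rw [heq, Int.card_Icc] at d5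
    omega
  rw [← hfa]
  exact ⟨d2, fun t h1 h2 => ⟨hA t h1 h2, hB' t h1 h2⟩⟩

/-- The path `p 0, …, p l` may be exchanged with the part `c 1, …, c (l + 1)` of the cycle. -/
theorem exists_swap (h : CyclePath D m l c p) (hcard : (Fintype.card V : ℤ) = m + l + 1)
    (hlm : l + 2 ≤ m) (h0 : D.Adj (c 0) (p 0)) (hj : D.Adj (p l) (c (l + 2))) :
    ∃ c', CyclePath D m l c' (fun i => c (i + 1)) ∧ (∀ i, l + 2 ≤ i → i ≤ m → c' i = c i) ∧
      c' 0 = c m := by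
  have hl := h.nonneg
  have hm := h.two_le
  set w : ℤ → V := fun t => if t ≤ l + 1 then p (t - 1) else c t with hw
  have hw1 : ∀ t, t ≤ l + 1 → w t = p (t - 1) := fun t ht => if_pos ht
  have hw2 : ∀ t, l + 1 < t → w t = c t := fun t ht => if_neg (by omega)
  have hcyc : IsCycle D m w := by
    refine ⟨hm, fun i j h1 h2 h3 h4 hij => ?_, fun i h1 h2 => ?_, ?_⟩
    · rcases le_or_gt i (l + 1) with c1 | c1 <;> rcases le_or_gt j (l + 1) with c2 | c2
      · rw [hw1 i c1, hw1 j c2] at hij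
        have := h.pinj _ _ (by omega) (by omega) (by omega) (by omega) hij
        omega
      · rw [hw1 i c1, hw2 j c2] at hij
        exact absurd hij.symm (h.disj _ _ (by omega) (by omega))
      · rw [hw2 i c1, hw1 j c2] at hij
        exact absurd hij (h.disj _ _ (by omega) (by omega))
      · rw [hw2 i c1, hw2 j c2] at hij
        exact h.inj_window (by omega) (by omega) hij
    · rcases lt_trichotomy i (l + 1) with c1 | c1 | c1
      · rw [hw1 _ (by omega), hw1 _ (by omega), show i + 1 - 1 = i - 1 + 1 by ring]
        exact h.pstep _ (by omega) (by omega)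
      · rw [hw1 _ (by omega), hw2 _ (by omega), c1, show l + 1 - 1 = l by ring,
          show l + 1 + 1 = l + 2 by ring]
        exact hj
      · rw [hw2 _ (by omega), hw2 _ (by omega)]
        exact h.step _
    · rw [hw2 _ (by omega), hw1 _ (by omega), ← zero_add m, h.per]
      exact h0
  have hcov : ∀ x, (∃ i, 1 ≤ i ∧ i ≤ m ∧ w i = x) ∨ ∃ i, 0 ≤ i ∧ i ≤ l ∧ c (i + 1) = x := by
    intro x
    rcases h.cover hcard x with ⟨i, h1, h2, hi⟩ | ⟨i, h1, h2, hi⟩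
    · by_cases c1 : i ≤ l + 1
      · exact Or.inr ⟨i - 1, by omega, by omega, by rw [sub_add_cancel, hi]⟩
      · exact Or.inl ⟨i, h1, h2, by rw [hw2 i (by omega), hi]⟩
    · exact Or.inl ⟨i + 1, by omega, by omega,
        by rw [hw1 _ (by omega), add_sub_cancel_right, hi]⟩
  have hcp := hcyc.cyclePath (p := fun i => c (i + 1)) hl
    (fun i j h1 h2 h3 h4 hij => by
      have := h.inj_window (by omega) (by omega) hij
      omega)
    (fun i h1 h2 => h.step _)
    (fun i j h1 h2 h3 h4 hij => by
      rcases le_or_gt i (l + 1) with c1 | c1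
      · rw [hw1 i c1] at hij
        exact h.disj _ _ (by omega) (by omega) hij.symm
      · rw [hw2 i c1] at hij
        have := h.inj_window (by omega) (by omega) hij
        omega)
    (fun x _ => hcov x) (fun x _ => hcov x)
  have hwin : ∀ i, l + 2 ≤ i → i ≤ m → w ((i - 1) % m + 1) = c i := fun i h1 h2 => by
    rw [Int.emod_eq_of_lt (by omega) (by omega), sub_add_cancel, hw2 i (by omega)]
  refine ⟨_, hcp, hwin, ?_⟩
  have := hcp.per 0
  rw [← this, zero_add, hwin m hlm le_rfl]

/-- Otherwise `a + 2 ≤ m`. The vertex `c (a + 2)` receives no arc from the path, nor from `c 1, …, c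
(l + 1)`, which may be exchanged with the path. Its in-degree then needs some `c j → c (a + 2)` with
`l + 2 ≤ j ≤ a`. The interval description after the exchange gives `c (l + 1) → c (j + 1)`, and
these arcs produce a Hamilton cycle. -/
theorem length_eq (h : CyclePath D m l c p) (hmax : ∀ m' w, IsCycle D m' w → m' ≤ m)
    (hE : Extremal D a b) (hl : 1 ≤ l) (hlm : l + 2 ≤ m) (h0 : D.Adj (c 0) (p 0))
    (hj : D.Adj (p l) (c (l + 2))) : m = a + 1 := by
  classical
  obtain ⟨d1, d2⟩ := h.intervals hmax hE hl hlm h0 hj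
  have hcard : (Fintype.card V : ℤ) = m + l + 1 := by have := hE.card; omega
  obtain ⟨c', h', hc', hc0⟩ := h.exists_swap hcard hlm h0 hj
  have h1 : c (m + 1) = c 1 := by rw [add_comm, h.per]
  obtain ⟨-, d2'⟩ := h'.intervals hmax hE hl hlm
    (by rw [hc0, zero_add, ← h1]; exact h.step m)
    (by rw [hc' _ le_rfl hlm, show l + 2 = l + 1 + 1 by ring]; exact h.step (l + 1))
  have hla : l + 2 ≤ a + 1 := (((d2 (l + 2) (by omega) hlm).2).1 hj).2
  have ham : a + 1 ≤ m :=
    ((d2 m (by omega) le_rfl).1).1 (by rw [← zero_add m, h.per]; exact h0)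
  by_contra hne
  have hA : D.Adj (c (a + 1)) (p 0) := ((d2 (a + 1) (by omega) ham).1).2 le_rfl
  obtain ⟨j, hj1, hj2, hj3⟩ : ∃ j, l + 2 ≤ j ∧ j ≤ a ∧ D.Adj (c j) (c (a + 2)) := by
    by_contra hcon
    push Not at hcon
    have hsub : {x | D.Adj x (c (a + 2))} ⊆
        ((insert (a + 1) (Finset.Icc (a + 3) m)).image c : Finset V) := by
      intro x hx
      change D.Adj x (c (a + 2)) at hx
      rw [Finset.mem_coe, Finset.mem_image]
      rcases h.cover hcard x with ⟨i, h2, h3, rfl⟩ | ⟨i, h2, h3, rfl⟩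
      · refine ⟨i, ?_, rfl⟩
        rw [Finset.mem_insert, Finset.mem_Icc]
        by_contra h4
        have h5 : i ≠ a + 2 := by rintro rfl; exact hE.irrefl _ hx
        by_cases h6 : i ≤ l + 1
        · have := h'.insert_le hmax (i := a + 1) (k := a + 2) (s := 0) (t := i - 1) (by omega)
            (by omega) le_rfl (by omega) (by omega)
            (((d2' (a + 1) (by omega) ham).1).2 le_rfl)
            (by rw [hc' _ (by omega) (by omega), sub_add_cancel]; exact hx)
          omega
        · exact hcon i (by omega) (by omega) hx
      · have := h.insert_le hmax (i := a + 1) (k := a + 2) (s := 0) (t := i) (by omega)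
          (by omega) le_rfl (by omega) (by omega) hA hx
        omega
    have h2 := Set.ncard_le_ncard hsub (Set.toFinite _)
    rw [Set.ncard_coe_finset] at h2
    have h3 := Finset.card_image_le (s := insert (a + 1) (Finset.Icc (a + 3) m)) (f := c)
    have h4 := Finset.card_insert_le (a + 1) (Finset.Icc (a + 3) m)
    rw [Int.card_Icc] at h4
    have h5 := hE.inn (c (a + 2))
    rw [inDegree] at h5
    omega
  set f : ℤ → V := fun i => if i ≤ m then c i else p (i - (m + 1)) with hf
  have hf1 : ∀ i, i ≤ m → f i = c i := fun i hi => if_pos hi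
  have hf2 : ∀ i, 0 ≤ i → f (m + 1 + i) = p i := fun i hi => by
    rw [hf]; dsimp only; rw [if_neg (by omega), add_sub_cancel_left]
  have hseg : ∀ i k, i ≤ k → k ≤ m →
      PathOn (fun x y => D.Adj (f x) (f y)) i k (fun x => i ≤ x ∧ x ≤ k) := fun i k h1 h2 =>
    PathOn.seg h1 (fun q h3 h4 => by rw [hf1 q (by omega), hf1 _ (by omega)]; exact h.step q)
  have hsegp : PathOn (fun x y => D.Adj (f x) (f y)) (m + 1) (m + 1 + l)
      (fun x => m + 1 ≤ x ∧ x ≤ m + 1 + l) :=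
    PathOn.seg (by omega) (fun q h3 h4 => by
      obtain ⟨r, rfl⟩ : ∃ r, q = m + 1 + r := ⟨q - (m + 1), by omega⟩
      rw [add_assoc (m + 1), hf2 _ (by omega), hf2 _ (by omega)]
      exact h.pstep _ (by omega) (by omega))
  have hp0 : f (m + 1) = p 0 := by have := hf2 0 le_rfl; rwa [add_zero] at this
  -- The order is `c (j + 1), …, c (a + 1), p 0, …, p l, c (l + 2), …, c j, c (a + 2), …, c m, c 1,
  -- …, c (l + 1)`.
  have hpath := ((((hseg (j + 1) (a + 1) (by omega) ham).app hsegp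
      (by rw [hf1 _ ham, hp0]; exact hA) (by intro x; omega)).app
      (hseg (l + 2) j hj1 (by omega))
      (by rw [hf2 l h.nonneg, hf1 _ hlm]; exact hj) (by intro x; omega)).app
      (hseg (a + 2) m (by omega) le_rfl)
      (by rw [hf1 j (by omega), hf1 _ (by omega)]; exact hj3) (by intro x; omega)).app
      (hseg 1 (l + 1) (by omega) (by omega))
      (by rw [hf1 m le_rfl, hf1 1 (by omega), ← h1]; exact h.step m) (by intro x; omega)
  refine h.ham hE hcard hf1 hf2 hpath (fun x => by omega) ?_
  have h6 := ((d2' (j + 1) (by omega) (by omega)).2).2 ⟨by omega, by omega⟩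
  rw [hc' _ (by omega) (by omega)] at h6
  rw [hf1 _ (by omega), hf1 _ (by omega)]
  exact h6

/-- Applying `length_eq` to `D` and to its reverse gives `m = a + 1 = b + 1`; combine with `m + l =
a + b`. -/
theorem eq_of_normal (h : CyclePath D m l c p) (hmax : ∀ m' w, IsCycle D m' w → m' ≤ m)
    (hE : Extremal D a b) (hl : 1 ≤ l) (hlm : l + 2 ≤ m) (h0 : D.Adj (c 0) (p 0))
    (hj : D.Adj (p l) (c (l + 2))) : m = l + 2 ∧ a = l + 1 ∧ b = l + 1 := by
  have h1 := h.length_eq hmax hE hl hlm h0 hj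
  have h2 := (h.reverse (l + 2)).length_eq (fun m' w hw => hmax m' _ hw.of_rev) hE.rev hl hlm
    (by rw [sub_zero, sub_zero]; exact hj) (by rw [sub_self, sub_self]; exact h0)
  have h3 := (h.intervals hmax hE hl hlm h0 hj).1
  omega

end CyclePath
end HamiltonDigraph
-- Recognizing glued complete digraphs; passing to a frame
namespace HamiltonDigraph

section GluedComplete

variable {n k : ℕ}

theorem gluedComplete_adj_inl_inl {i j : Fin n} :
    (gluedComplete n k).Adj (some (.inl i)) (some (.inl j)) ↔ i ≠ j := by
  simp [gluedComplete, complete, Option.exists]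

theorem gluedComplete_adj_inr_inr {i j : Fin k} :
    (gluedComplete n k).Adj (some (.inr i)) (some (.inr j)) ↔ i ≠ j := by
  simp [gluedComplete, complete, Option.exists]

theorem gluedComplete_adj_inl_inr {i : Fin n} {j : Fin k} :
    ¬ (gluedComplete n k).Adj (some (.inl i)) (some (.inr j)) := by
  simp [gluedComplete, complete, Option.exists]

theorem gluedComplete_adj_inr_inl {i : Fin k} {j : Fin n} :
    ¬ (gluedComplete n k).Adj (some (.inr i)) (some (.inl j)) := by
  simp [gluedComplete, complete, Option.exists]

theorem gluedComplete_adj_none_left {x : Fin n ⊕ Fin k} :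
    (gluedComplete n k).Adj none (some x) := by
  rcases x with x | x <;> simp [gluedComplete, complete, Option.exists]

theorem gluedComplete_adj_none_right {x : Fin n ⊕ Fin k} :
    (gluedComplete n k).Adj (some x) none := by
  rcases x with x | x <;> simp [gluedComplete, complete, Option.exists]

theorem gluedComplete_adj_none : ¬ (gluedComplete n k).Adj none none := by
  simp [gluedComplete, complete, Option.exists]

end GluedComplete

variable {V : Type*} {D : Digraph V} {a b m l : ℤ} {c p w : ℤ → V}

namespace CyclePath

variable [Fintype V]

/-- As `p l → p 0`, the path closes to a cycle and may start at any of its vertices. -/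
theorem rotate (h : CyclePath D m l c p) (hcard : (Fintype.card V : ℤ) = m + l + 1)
    (hlast : D.Adj (p l) (p 0)) {k : ℤ} (h1 : 1 ≤ k) (h2 : k ≤ l) :
    CyclePath D m l c (fun i => if i ≤ l - k then p (k + i) else p (i - (l - k) - 1)) := by
  set q : ℤ → V := fun i => if i ≤ l - k then p (k + i) else p (i - (l - k) - 1) with hq
  have hq1 : ∀ i, i ≤ l - k → q i = p (k + i) := fun i hi => if_pos hi
  have hq2 : ∀ i, l - k < i → q i = p (i - (l - k) - 1) := fun i hi => if_neg (by omega)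
  have hcov : ∀ x, (∃ i, c i = x) ∨ ∃ i, 0 ≤ i ∧ i ≤ l ∧ q i = x := by
    intro x
    rcases h.cover hcard x with ⟨i, h3, h4, hi⟩ | ⟨i, h3, h4, hi⟩
    · exact Or.inl ⟨i, hi⟩
    · by_cases c1 : k ≤ i
      · exact Or.inr ⟨i - k, by omega, by omega,
          by rw [hq1 _ (by omega), add_sub_cancel, hi]⟩
      · refine Or.inr ⟨i + (l - k) + 1, by omega, by omega, ?_⟩
        rw [hq2 _ (by omega), ← hi]
        congr 1
        ring
  refine ⟨h.two_le, h.nonneg, h.per, h.inj, h.step, fun i j h3 h4 h5 h6 hij => ?_,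
    fun i h3 h4 => ?_, fun i j h3 h4 => ?_, fun x _ => hcov x, fun x _ => hcov x⟩
  · rcases le_or_gt i (l - k) with c1 | c1 <;> rcases le_or_gt j (l - k) with c2 | c2
    · rw [hq1 i c1, hq1 j c2] at hij
      have := h.pinj _ _ (by omega) (by omega) (by omega) (by omega) hij
      omega
    · rw [hq1 i c1, hq2 j c2] at hij
      have := h.pinj _ _ (by omega) (by omega) (by omega) (by omega) hij
      omega
    · rw [hq2 i c1, hq1 j c2] at hij
      have := h.pinj _ _ (by omega) (by omega) (by omega) (by omega) hij
      omega
    · rw [hq2 i c1, hq2 j c2] at hij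
      have := h.pinj _ _ (by omega) (by omega) (by omega) (by omega) hij
      omega
  · rcases lt_trichotomy i (l - k) with c1 | c1 | c1
    · rw [hq1 _ (by omega), hq1 _ (by omega), ← add_assoc]
      exact h.pstep _ (by omega) (by omega)
    · rw [hq1 _ (by omega), hq2 _ (by omega), c1, show k + (l - k) = l by ring,
        show l - k + 1 - (l - k) - 1 = 0 by ring]
      exact hlast
    · rw [hq2 _ (by omega), hq2 _ (by omega),
        show i + 1 - (l - k) - 1 = i - (l - k) - 1 + 1 by ring]
      exact h.pstep _ (by omega) (by omega)
  · rcases le_or_gt j (l - k) with c2 | c2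
    · rw [hq1 j c2]; exact h.disj _ _ (by omega) (by omega)
    · rw [hq2 j c2]; exact h.disj _ _ (by omega) (by omega)

/-- In the normalized situation with `m = l + 2`, every vertex of the path has the same
neighbours as its ends. -/
theorem adj_path (h : CyclePath D (l + 2) l c p)
    (hmax : ∀ m' w, IsCycle D m' w → m' ≤ l + 2) (hE : Extremal D (l + 1) (l + 1)) (hl : 1 ≤ l)
    (h0 : D.Adj (c 0) (p 0)) (hj : D.Adj (p l) (c (l + 2))) {k : ℤ} (h1 : 0 ≤ k) (h2 : k ≤ l) :
    (∀ i, 0 ≤ i → i ≤ l → i ≠ k → D.Adj (p i) (p k)) ∧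
      ∃ k', 0 ≤ k' ∧ k' ≤ l ∧ (k = 0 → k' = l) ∧ (k ≠ 0 → k' = k - 1) ∧
        ∀ t, 1 ≤ t → t ≤ l + 2 → (D.Adj (c t) (p k) ↔ t = l + 2) ∧
          (D.Adj (p k') (c t) ↔ t = l + 2) := by
  have hno : ∀ {q : ℤ → V}, CyclePath D (l + 2) l c q → D.Adj (c 0) (q 0) →
      D.Adj (q l) (c (l + 2)) → (∀ i, 1 ≤ i → i ≤ l → D.Adj (q i) (q 0)) ∧
        ∀ t, 1 ≤ t → t ≤ l + 2 → (D.Adj (c t) (q 0) ↔ t = l + 2) ∧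
          (D.Adj (q l) (c t) ↔ t = l + 2) := by
    intro q hq hq0 hql
    refine ⟨(hq.count hmax hE (j := l + 2) (by omega) le_rfl hq0 hql fun t h3 h4 h5 => ?_).2.2.2.1,
      fun t h3 h4 => ?_⟩
    · have := hq.insert_le hmax (i := t) (k := l + 2) (by omega) (by omega) le_rfl hq.nonneg le_rfl
        h5 hql
      omega
    · have := (hq.intervals hmax hE hl le_rfl hq0 hql).2 t h3 h4
      exact ⟨this.1.trans (by omega), this.2.trans (by omega)⟩
  obtain ⟨d1, d2⟩ := hno h h0 hj
  rcases eq_or_lt_of_le h1 with rfl | h3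
  · exact ⟨fun i h3 h4 h5 => d1 i (by omega) h4, l, by omega, le_rfl, by omega, by omega, d2⟩
  have hcard : (Fintype.card V : ℤ) = l + 2 + l + 1 := by have := hE.card; omega
  have hq := h.rotate hcard (d1 l hl le_rfl) h3 h2
  set q : ℤ → V := fun i => if i ≤ l - k then p (k + i) else p (i - (l - k) - 1) with hqd
  have hq1 : ∀ i, i ≤ l - k → q i = p (k + i) := fun i hi => if_pos hi
  have hq2 : ∀ i, l - k < i → q i = p (i - (l - k) - 1) := fun i hi => if_neg (by omega)
  have hq0 : q 0 = p k := by rw [hq1 0 (by omega), add_zero]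
  have hql : q l = p (k - 1) := by rw [hq2 l (by omega)]; congr 1; ring
  obtain ⟨f', hf1, hf2⟩ := hq.exists_normal hmax hE (by omega) (by omega)
  rw [h.per] at hf2
  obtain ⟨f, hf3, hf4, hf5⟩ := h.exists_window 1 f'
  rw [← hf5, hq0] at hf1
  rw [← hf5, hql] at hf2
  -- For `f < l + 2`, inserting `p k, …, p l` between `c f` and `c (l + 2)` requires `f ≤ k`, and
  -- inserting `p 0, …, p (k - 1)` between `c 0` and `c f` requires `k + 1 ≤ f`.
  have hf : f = l + 2 := by
    by_contra hne
    have h4 := h.insert_le hmax (i := f) (k := l + 2) (by omega) (by omega) (by omega) h2 le_rfl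
      hf1 hj
    have h5 := h.insert_le hmax (i := 0) (k := f) (by omega) (by omega) le_rfl
      (show 0 ≤ k - 1 by omega) (by omega) h0 hf2
    omega
  rw [hf] at hf1 hf2
  obtain ⟨d3, d4⟩ := hno hq (by rw [← h.per 0, zero_add, hq0]; exact hf1) (by rw [hql]; exact hf2)
  rw [hq0] at d3 d4
  rw [hql] at d4
  refine ⟨fun i h4 h5 h6 => ?_, k - 1, by omega, by omega, by omega, by omega, d4⟩
  rcases lt_or_ge i k with h7 | h7
  · have := d3 (i + (l - k) + 1) (by omega) (by omega)
    rwa [hq2 _ (by omega), show i + (l - k) + 1 - (l - k) - 1 = i by ring] at this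
  · have := d3 (i - k) (by omega) (by omega)
    rwa [hq1 _ (by omega), add_sub_cancel] at this

/-- By `adj_path` the path vertices span a complete digraph, joined to the cycle only at `c (l +
2)`, and there in both directions. All neighbours of `c 1, …, c (l + 1)` therefore lie among the
other `l + 1` cycle vertices, and the degree bounds `l + 1` make the cycle complete as well. -/
theorem isGluedCompleteEq (h : CyclePath D m l c p) (hmax : ∀ m' w, IsCycle D m' w → m' ≤ m)
    (hE : Extremal D a b) (hl : 1 ≤ l) (hlm : l + 2 ≤ m) (hla : l < a) (hlb : l < b) :
    IsGluedCompleteEq D := by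
  classical
  obtain ⟨k, hk1, hk2⟩ := h.exists_normal hmax hE hla hlb
  wlog hk : k = 0 generalizing c k
  · exact this (h.shift k) 0 (by simpa using hk1) (by simpa [add_comm] using hk2) rfl
  subst hk
  rw [zero_add] at hk2
  obtain ⟨rfl, rfl, rfl⟩ := h.eq_of_normal hmax hE hl hlm hk1 hk2
  have hcard : (Fintype.card V : ℤ) = l + 2 + l + 1 := by have := hE.card; omega
  have hpp : ∀ i j, 0 ≤ i → i ≤ l → 0 ≤ j → j ≤ l → i ≠ j → D.Adj (p i) (p j) :=
    fun i j h1 h2 h3 h4 h5 => (h.adj_path hmax hE hl hk1 hk2 h3 h4).1 i h1 h2 h5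
  have hcp : ∀ t j, 1 ≤ t → t ≤ l + 2 → 0 ≤ j → j ≤ l → (D.Adj (c t) (p j) ↔ t = l + 2) := by
    intro t j h1 h2 h3 h4
    obtain ⟨-, k', -, -, -, -, h5⟩ := h.adj_path hmax hE hl hk1 hk2 h3 h4
    exact (h5 t h1 h2).1
  have hpc : ∀ t j, 1 ≤ t → t ≤ l + 2 → 0 ≤ j → j ≤ l → (D.Adj (p j) (c t) ↔ t = l + 2) := by
    intro t j h1 h2 h3 h4
    rcases eq_or_lt_of_le h4 with rfl | h6
    · obtain ⟨-, k', -, -, h7, -, h5⟩ := h.adj_path hmax hE hl hk1 hk2 le_rfl h.nonneg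
      rw [h7 rfl] at h5
      exact (h5 t h1 h2).2
    · obtain ⟨-, k', -, -, -, h7, h5⟩ := h.adj_path hmax hE hl hk1 hk2
        (show 0 ≤ j + 1 by omega) (by omega)
      rw [h7 (by omega), add_sub_cancel_right] at h5
      exact (h5 t h1 h2).2
  have hsmall : ∀ {x y : ℤ}, 1 ≤ x → x ≤ l + 2 → 1 ≤ y → y ≤ l + 2 → x ≠ y →
      ((((Finset.Icc 1 (l + 2)).erase x).erase y).image c).card < l + 1 := by
    intro x y h1 h2 h3 h4 h5
    have h6 := Finset.card_image_le (s := ((Finset.Icc 1 (l + 2)).erase x).erase y) (f := c)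
    rw [Finset.card_erase_of_mem (Finset.mem_erase.2 ⟨h5.symm, Finset.mem_Icc.2 ⟨h3, h4⟩⟩),
      Finset.card_erase_of_mem (Finset.mem_Icc.2 ⟨h1, h2⟩), Int.card_Icc] at h6
    omega
  have hout : ∀ x y, 1 ≤ x → x ≤ l + 1 → 1 ≤ y → y ≤ l + 2 → x ≠ y → D.Adj (c x) (c y) := by
    intro x y h1 h2 h3 h4 h5
    by_contra hcon
    have hsub : {z | D.Adj (c x) z} ⊆
        ((((Finset.Icc 1 (l + 2)).erase x).erase y).image c : Finset V) := by
      intro z hz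
      change D.Adj (c x) z at hz
      rw [Finset.mem_coe, Finset.mem_image]
      rcases h.cover hcard z with ⟨i, h6, h7, rfl⟩ | ⟨i, h6, h7, rfl⟩
      · refine ⟨i, Finset.mem_erase.2 ⟨?_, Finset.mem_erase.2 ⟨?_, Finset.mem_Icc.2 ⟨h6, h7⟩⟩⟩, rfl⟩
        · rintro rfl; exact hcon hz
        · rintro rfl; exact hE.irrefl _ hz
      · have := (hcp x i h1 (by omega) h6 h7).1 hz
        omega
    have h6 := Set.ncard_le_ncard hsub (Set.toFinite _)
    rw [Set.ncard_coe_finset] at h6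
    have h7 := hE.out (c x)
    rw [outDegree] at h7
    have := hsmall h1 (by omega) h3 h4 h5
    omega
  have hinn : ∀ x y, 1 ≤ x → x ≤ l + 1 → 1 ≤ y → y ≤ l + 2 → x ≠ y → D.Adj (c y) (c x) := by
    intro x y h1 h2 h3 h4 h5
    by_contra hcon
    have hsub : {z | D.Adj z (c x)} ⊆
        ((((Finset.Icc 1 (l + 2)).erase x).erase y).image c : Finset V) := by
      intro z hz
      change D.Adj z (c x) at hz
      rw [Finset.mem_coe, Finset.mem_image]
      rcases h.cover hcard z with ⟨i, h6, h7, rfl⟩ | ⟨i, h6, h7, rfl⟩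
      · refine ⟨i, Finset.mem_erase.2 ⟨?_, Finset.mem_erase.2 ⟨?_, Finset.mem_Icc.2 ⟨h6, h7⟩⟩⟩, rfl⟩
        · rintro rfl; exact hcon hz
        · rintro rfl; exact hE.irrefl _ hz
      · have := (hpc x i h1 (by omega) h6 h7).1 hz
        omega
    have h6 := Set.ncard_le_ncard hsub (Set.toFinite _)
    rw [Set.ncard_coe_finset] at h6
    have h7 := hE.inn (c x)
    rw [inDegree] at h7
    have := hsmall h1 (by omega) h3 h4 h5
    omega
  obtain ⟨n, hn⟩ := Int.eq_ofNat_of_zero_le h.nonneg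
  let φ : Option (Fin (n + 1) ⊕ Fin (n + 1)) → V := fun x =>
    match x with
    | none => c (l + 2)
    | some (.inl i) => p i
    | some (.inr i) => c (i + 1)
  refine ⟨n + 1, by omega, isomorphic_of_bijective φ ⟨?_, ?_⟩ ?_⟩
  · rintro (_ | x | x) (_ | y | y) hxy
    · rfl
    · exact absurd hxy (h.disj _ _ (by omega) (by omega))
    · have := h.inj_window (by omega) (by omega) hxy
      omega
    · exact absurd hxy.symm (h.disj _ _ (by omega) (by omega))
    · have := h.pinj _ _ (by omega) (by omega) (by omega) (by omega) hxy
      rw [Fin.ext (by omega : (x : ℕ) = y)]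
    · exact absurd hxy.symm (h.disj _ _ (by omega) (by omega))
    · have := h.inj_window (by omega) (by omega) hxy
      omega
    · exact absurd hxy (h.disj _ _ (by omega) (by omega))
    · have := h.inj_window (by omega) (by omega) hxy
      rw [Fin.ext (by omega : (x : ℕ) = y)]
  · intro z
    rcases h.cover hcard z with ⟨i, h6, h7, rfl⟩ | ⟨i, h6, h7, rfl⟩
    · rcases eq_or_lt_of_le h7 with rfl | h8
      · exact ⟨none, rfl⟩
      · refine ⟨some (.inr ⟨(i - 1).toNat, by omega⟩), ?_⟩
        change c (((i - 1).toNat : ℤ) + 1) = c i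
        congr 1
        omega
    · refine ⟨some (.inl ⟨i.toNat, by omega⟩), ?_⟩
      change p ((i.toNat : ℕ) : ℤ) = p i
      congr 1
      omega
  · rintro (_ | x | x) (_ | y | y)
    · exact iff_of_false (hE.irrefl _) gluedComplete_adj_none
    · exact iff_of_true ((hcp _ _ (by omega) le_rfl (by omega) (by omega)).2 rfl)
        gluedComplete_adj_none_left
    · exact iff_of_true (hinn _ _ (by omega) (by omega) (by omega) le_rfl (by omega))
        gluedComplete_adj_none_left
    · exact iff_of_true ((hpc _ _ (by omega) le_rfl (by omega) (by omega)).2 rfl)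
        gluedComplete_adj_none_right
    · rw [gluedComplete_adj_inl_inl]
      constructor
      · rintro hxy rfl
        exact hE.irrefl _ hxy
      · intro hxy
        have := Fin.val_ne_of_ne hxy
        exact hpp _ _ (by omega) (by omega) (by omega) (by omega) (by omega)
    · refine iff_of_false (fun hxy => ?_) gluedComplete_adj_inl_inr
      have := (hpc _ _ (by omega) (by omega) (by omega) (by omega)).1 hxy
      omega
    · exact iff_of_true (hout _ _ (by omega) (by omega) (by omega) le_rfl (by omega))
        gluedComplete_adj_none_right
    · refine iff_of_false (fun hxy => ?_) gluedComplete_adj_inr_inl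
      have := (hcp _ _ (by omega) (by omega) (by omega) (by omega)).1 hxy
      omega
    · rw [gluedComplete_adj_inr_inr]
      constructor
      · rintro hxy rfl
        exact hE.irrefl _ hxy
      · intro hxy
        have := Fin.val_ne_of_ne hxy
        exact hout _ _ (by omega) (by omega) (by omega) (by omega) (by omega)

/-- The case of a single vertex outside the cycle. -/
theorem exists_frame (h : CyclePath D m 0 c p) (hmax : ∀ m' w, IsCycle D m' w → m' ≤ m)
    (hE : Extremal D a b) (ha : 0 < a) (hb : 0 < b) : ∃ M e, Frame D M e := by
  obtain ⟨k, hk1, hk2⟩ := h.exists_normal hmax hE ha hb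
  have hm := h.two_le
  have hcard : (Fintype.card V : ℤ) = m + 0 + 1 := by
    have h1 := (h.shift k).count hmax hE (j := 0 + 2)
      (by omega) (by omega) (by simpa using hk1) (by simpa [add_comm] using hk2)
      (fun t h1 h2 h3 => by
        have := (h.shift k).insert_le hmax (i := t) (k := 2) (by omega) (by omega) le_rfl le_rfl
          le_rfl h3 (by simpa [add_comm] using hk2)
        omega)
    have := hE.card
    omega
  -- Since `c k → p 0 → c (k + 2)`, the vertex `p 0` can replace `c (k + 1)`; these two become the
  -- ends of the frame.
  refine ⟨m - 1, fun i => if i < m then c (k + 1 + i) else p 0, by omega, ?_, by omega, ?_, ?_, ?_⟩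
  · intro i j h1 h2 h3 h4 hij
    split_ifs at hij
    · have := h.inj_window (by omega) (by omega) hij
      omega
    · exact absurd hij (h.disj _ _ le_rfl le_rfl)
    · exact absurd hij.symm (h.disj _ _ le_rfl le_rfl)
    · omega
  · intro i h1 h2
    by_cases h3 : i + 1 < m
    · rw [if_pos (by omega), if_pos h3, ← add_assoc]
      exact h.step _
    · rw [if_pos (by omega), if_neg h3, show k + 1 + i = k + m by omega, h.per]
      exact hk1
  · rw [if_pos (by omega), if_pos (by omega), show k + 1 + (m - 1) = k + m by ring, h.per, add_zero]
    exact h.step k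
  · rw [if_neg (by omega), if_pos (by omega), show k + 1 + 1 = k + (0 + 2) by ring]
    exact hk2

end CyclePath
end HamiltonDigraph
-- The exceptional digraphs have no Hamilton cycle
namespace HamiltonDigraph
variable {V : Type*} {D : Digraph V} {a b m l : ℤ} {c p w : ℤ → V}

section Exceptions

theorem Isomorphic.hasHamiltonCycle {W : Type*} {H : Digraph W} (h : Isomorphic D H)
    (hD : HasHamiltonCycle D) : HasHamiltonCycle H := by
  obtain ⟨φ⟩ := h
  obtain ⟨k, f, ⟨h2, hf, hadj⟩, hs⟩ := hD
  exact ⟨k, fun i => φ (f i), ⟨h2, φ.injective.comp hf, fun i => φ.map_rel_iff.2 (hadj i)⟩,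
    φ.surjective.comp hs⟩

theorem HasHamiltonCycle.exists_from [Fintype V] {n : ℕ} (h : HasHamiltonCycle D)
    (hn : Fintype.card V = n) (v : V) :
    ∃ g : ZMod n → V, Function.Bijective g ∧ g 0 = v ∧ ∀ i, D.Adj (g i) (g (i + 1)) := by
  obtain ⟨k, f, ⟨h2, hf, hadj⟩, hs⟩ := h
  have : NeZero k := ⟨by omega⟩
  have hk : k = n := by
    rw [← hn, ← Fintype.card_of_bijective ⟨hf, hs⟩, ZMod.card]
  subst hk
  obtain ⟨j, rfl⟩ := hs v
  exact ⟨fun i => f (j + i), Function.Bijective.comp ⟨hf, hs⟩ (Equiv.addLeft j).bijective,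
    congrArg f (add_zero j), fun i => by have := hadj (j + i); rwa [add_assoc] at this⟩

/-- A digraph with a cut vertex `v` has no Hamilton cycle. -/
theorem not_hasHamiltonCycle_of_cut [Fintype V] {v x y : V} {S : V → Prop} (hx : x ≠ v)
    (hy : y ≠ v) (hSx : S x) (hSy : ¬ S y)
    (hS : ∀ u w, u ≠ v → w ≠ v → D.Adj u w → (S u ↔ S w)) : ¬ HasHamiltonCycle D := by
  intro h
  obtain ⟨g, hg, h0, hadj⟩ := h.exists_from rfl v
  have : NeZero (Fintype.card V) := ⟨(Fintype.card_pos_iff.2 ⟨v⟩).ne'⟩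
  -- Once started at `v`, the Hamilton cycle never leaves the side of the cut that it enters first.
  have key : ∀ t : ℕ, 1 ≤ t → t < Fintype.card V →
      (S (g (1 : ℕ)) ↔ S (g (t : ZMod (Fintype.card V)))) := by
    intro t ht
    induction t, ht using Nat.le_induction with
    | base => exact fun _ => Iff.rfl
    | succ t ht ih =>
      intro h1
      refine (ih (by omega)).trans (hS _ _ ?_ ?_ (by push_cast; exact hadj _))
      · rw [← h0]
        intro h2
        have h3 := (ZMod.natCast_eq_zero_iff _ _).1 (hg.1 h2)
        exact absurd (Nat.le_of_dvd (by omega) h3) (by omega)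
      · rw [← h0]
        intro h2
        have h3 := (ZMod.natCast_eq_zero_iff _ _).1 (hg.1 h2)
        exact absurd (Nat.le_of_dvd (by omega) h3) (by omega)
  have key' : ∀ z, z ≠ v → (S (g (1 : ℕ)) ↔ S z) := by
    intro z hz
    obtain ⟨i, rfl⟩ := hg.2 z
    have h1 := key i.val (Nat.pos_of_ne_zero fun h2 => hz (by
      rw [(ZMod.val_eq_zero i).1 h2, h0])) (ZMod.val_lt i)
    rwa [ZMod.natCast_zmod_val] at h1
  exact hSy ((key' y hy).1 ((key' x hx).2 hSx))

theorem not_hasHamiltonCycle_gluedComplete {n : ℕ} (hn : 1 ≤ n) :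
    ¬ HasHamiltonCycle (gluedComplete n n) := by
  refine not_hasHamiltonCycle_of_cut (v := none) (x := some (.inl ⟨0, hn⟩))
    (y := some (.inr ⟨0, hn⟩)) (S := fun z => ∃ i, z = some (.inl i)) (by simp) (by simp)
    ⟨_, rfl⟩ (by simp) ?_
  rintro (_ | u | u) (_ | w | w) h1 h2 h3
  · exact absurd rfl h1
  · exact absurd rfl h1
  · exact absurd rfl h1
  · exact absurd rfl h2
  · simp
  · exact absurd h3 gluedComplete_adj_inl_inr
  · exact absurd rfl h2
  · exact absurd h3 gluedComplete_adj_inr_inl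
  · simp

/-- The successor on a Hamilton cycle would map the `n + 1` independent vertices injectively into
the other `n`. -/
theorem not_hasHamiltonCycle_independentJoin {n : ℕ} {H : Digraph (Fin n)} :
    ¬ HasHamiltonCycle (independentJoin n H) := by
  rintro ⟨k, f, ⟨-, hf, hadj⟩, hs⟩
  choose g hg using fun x : Fin (n + 1) => hs (.inl x)
  have h1 : ∀ x, ∃ y, f (g x + 1) = .inr y := by
    intro x
    have h2 := hadj (g x)
    rw [hg] at h2
    rcases h3 : f (g x + 1) with z | z
    · rw [h3] at h2
      exact h2.elim
    · exact ⟨z, rfl⟩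
  choose q hq using h1
  have hinj : Function.Injective q := by
    intro x y hxy
    have h2 : f (g x + 1) = f (g y + 1) := by rw [hq, hq, hxy]
    have h3 : f (g x) = f (g y) := by rw [add_right_cancel (hf h2)]
    rw [hg, hg] at h3
    exact Sum.inl_injective h3
  have := Fintype.card_le_of_injective q hinj
  rw [Fintype.card_fin, Fintype.card_fin] at this
  omega

instance : DecidableRel (fourVertexJoin 1 {(0, 1), (1, 0)}).Adj := fun x y =>
  match x, y with
  | .inl x, .inl y => inferInstanceAs (Decidable (
      (x, y) ∈ ([(0, 2), (2, 1), (1, 3), (3, 0), (2, 3), (3, 2)] : List (Fin 4 × Fin 4)) ∨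
      ((x, y) = (0, 1) ∨ (x, y) = (1, 0))))
  | .inl x, .inr _ => inferInstanceAs (Decidable (x = 0 ∨ x = 1))
  | .inr _, .inl y => inferInstanceAs (Decidable (y = 0 ∨ y = 1))
  | .inr x, .inr y => inferInstanceAs (Decidable (x ≠ y))

set_option synthInstance.maxSize 2000 in
set_option synthInstance.maxHeartbeats 200000 in
-- More arcs can only help, so the search is carried out with both optional arcs present, starting
-- from the fifth vertex.
theorem not_hasHamiltonCycle_fourVertexJoin_one {E : Set (Fin 4 × Fin 4)}
    (hE : E ⊆ {(0, 1), (1, 0)}) : ¬ HasHamiltonCycle (fourVertexJoin 1 E) := by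
  intro h
  obtain ⟨g, hg, h0, hadj⟩ := h.exists_from (n := 5) (by simp) (.inr 0)
  have hadj' : ∀ i, (fourVertexJoin 1 {(0, 1), (1, 0)}).Adj (g i) (g (i + 1)) := by
    intro i
    have h1 := hadj i
    revert h1
    generalize g i = x
    generalize g (i + 1) = y
    rcases x with x | x <;> rcases y with y | y
    · exact Or.imp_right fun h2 => hE h2
    all_goals exact id
  have key : ∀ x1, (fourVertexJoin 1 {(0, 1), (1, 0)}).Adj (.inr 0) x1 →
      ∀ x2, (fourVertexJoin 1 {(0, 1), (1, 0)}).Adj x1 x2 → x2 ≠ .inr 0 →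
      ∀ x3, (fourVertexJoin 1 {(0, 1), (1, 0)}).Adj x2 x3 → x3 ≠ .inr 0 → x3 ≠ x1 →
      ∀ x4, (fourVertexJoin 1 {(0, 1), (1, 0)}).Adj x3 x4 → x4 ≠ x1 → x4 ≠ x2 →
        ¬ (fourVertexJoin 1 {(0, 1), (1, 0)}).Adj x4 (.inr 0) := by
    decide
  rw [← h0] at key
  exact key (g 1) (hadj' 0) (g 2) (hadj' 1) (hg.1.ne (by decide)) (g 3) (hadj' 2)
    (hg.1.ne (by decide)) (hg.1.ne (by decide)) (g 4) (hadj' 3) (hg.1.ne (by decide))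
    (hg.1.ne (by decide)) (hadj' 4)

instance : DecidableRel sevenVertex.Adj := fun u v =>
  inferInstanceAs (Decidable ((u, v) ∈
    ([(0, 1), (1, 0), (0, 2), (2, 0), (0, 3), (3, 0),
      (1, 2), (2, 3), (3, 1),
      (4, 5), (5, 4), (5, 6), (6, 5), (4, 6), (6, 4),
      (1, 4), (4, 2), (2, 5), (5, 3), (3, 6), (6, 1)] : List (Fin 7 × Fin 7))))

theorem not_hasHamiltonCycle_sevenVertex : ¬ HasHamiltonCycle sevenVertex := by
  intro h
  obtain ⟨g, hg, h0, hadj⟩ := h.exists_from (n := 7) (by simp) 0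
  have key : ∀ x1, sevenVertex.Adj 0 x1 → ∀ x2, sevenVertex.Adj x1 x2 → x2 ≠ 0 →
      ∀ x3, sevenVertex.Adj x2 x3 → x3 ≠ 0 → x3 ≠ x1 →
      ∀ x4, sevenVertex.Adj x3 x4 → x4 ≠ 0 → x4 ≠ x1 → x4 ≠ x2 →
      ∀ x5, sevenVertex.Adj x4 x5 → x5 ≠ 0 → x5 ≠ x1 → x5 ≠ x2 → x5 ≠ x3 →
      ∀ x6, sevenVertex.Adj x5 x6 → x6 ≠ x1 → x6 ≠ x2 → x6 ≠ x3 → x6 ≠ x4 →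
        ¬ sevenVertex.Adj x6 0 := by
    decide +kernel
  rw [← h0] at key
  exact key (g 1) (hadj 0) (g 2) (hadj 1) (hg.1.ne (by decide)) (g 3) (hadj 2)
    (hg.1.ne (by decide)) (hg.1.ne (by decide)) (g 4) (hadj 3) (hg.1.ne (by decide))
    (hg.1.ne (by decide)) (hg.1.ne (by decide)) (g 5) (hadj 4) (hg.1.ne (by decide))
    (hg.1.ne (by decide)) (hg.1.ne (by decide)) (hg.1.ne (by decide)) (g 6) (hadj 5) (hg.1.ne (by decide))
    (hg.1.ne (by decide)) (hg.1.ne (by decide)) (hg.1.ne (by decide)) (hadj 6)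

end Exceptions

/-! ### Existence of long cycles, and conclusion -/

section LongestCycle

theorem IsCycle.hasHamiltonCycle (h : IsCycle D m w) (hs : ∀ x, ∃ i, 1 ≤ i ∧ i ≤ m ∧ w i = x) :
    HasHamiltonCycle D := by
  have h1 := h.two_le
  have hp := PathOn.map (R := D.Adj) (e := w)
    (PathOn.seg (r := fun x y => D.Adj (w x) (w y)) (i := 1) (j := m) (by omega)
      (fun k h2 h3 => h.step k h2 h3))
    (fun x y hx hy => h.inj x y hx.1 hx.2 hy.1 hy.2)
  refine hp.hasHamiltonCycle h.last (fun h2 => ?_) (fun x => ?_)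
  · have := h.inj 1 m le_rfl (by omega) (by omega) le_rfl h2
    omega
  · obtain ⟨i, h2, h3, h4⟩ := hs x
    exact ⟨i, ⟨h2, h3⟩, h4⟩

variable [Fintype V]

/-- A longest path in a nonempty set `S` of vertices. -/
theorem exists_maximal_path (D : Digraph V) {S : Set V} (hS : S.Nonempty) :
    ∃ (l : ℤ) (p : ℤ → V), 0 ≤ l ∧
      (∀ i j, 0 ≤ i → i ≤ l → 0 ≤ j → j ≤ l → p i = p j → i = j) ∧
      (∀ i, 0 ≤ i → i < l → D.Adj (p i) (p (i + 1))) ∧ (∀ i, 0 ≤ i → i ≤ l → p i ∈ S) ∧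
      (∀ x ∈ S, D.Adj x (p 0) → ∃ i, 0 ≤ i ∧ i ≤ l ∧ p i = x) ∧
      (∀ x ∈ S, D.Adj (p l) x → ∃ i, 0 ≤ i ∧ i ≤ l ∧ p i = x) := by
  classical
  obtain ⟨s, hs⟩ := hS
  obtain ⟨l, ⟨p, h1, h2, h3, h4⟩, hmax⟩ := Int.exists_greatest_of_bdd
    (P := fun l => ∃ p : ℤ → V, 0 ≤ l ∧
      (∀ i j, 0 ≤ i → i ≤ l → 0 ≤ j → j ≤ l → p i = p j → i = j) ∧
      (∀ i, 0 ≤ i → i < l → D.Adj (p i) (p (i + 1))) ∧ (∀ i, 0 ≤ i → i ≤ l → p i ∈ S))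
    ⟨Fintype.card V, fun l ⟨p, h1, h2, _⟩ => by
      have h3 := Finset.card_le_univ ((Finset.Icc 0 l).image p)
      rw [Finset.card_image_of_injOn, Int.card_Icc] at h3
      · omega
      · intro i hi j hj hij
        simp only [Finset.coe_Icc, Set.mem_Icc] at hi hj
        exact h2 i j hi.1 hi.2 hj.1 hj.2 hij⟩
    ⟨0, fun _ => s, le_rfl, fun i j _ _ _ _ _ => by omega, fun i _ _ => by omega, fun _ _ _ => hs⟩
  refine ⟨l, p, h1, h2, h3, h4, fun x hx hadj => ?_, fun x hx hadj => ?_⟩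
  · by_contra hcon
    push Not at hcon
    have := hmax (l + 1) ⟨fun i => if i = 0 then x else p (i - 1), by omega, ?_, ?_, ?_⟩
    · omega
    · intro i j h5 h6 h7 h8 hij
      dsimp only at hij
      split_ifs at hij
      · omega
      · exact absurd hij.symm (hcon _ (by omega) (by omega))
      · exact absurd hij (hcon _ (by omega) (by omega))
      · have := h2 _ _ (by omega) (by omega) (by omega) (by omega) hij
        omega
    · intro i h5 h6
      dsimp only
      rw [if_neg (show ¬ i + 1 = 0 by omega), add_sub_cancel_right]
      split_ifs with h7
      · rw [h7]; exact hadj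
      · have := h3 (i - 1) (by omega) (by omega)
        rwa [sub_add_cancel] at this
    · intro i h5 h6
      dsimp only
      split_ifs with h7
      · exact hx
      · exact h4 _ (by omega) (by omega)
  · by_contra hcon
    push Not at hcon
    have := hmax (l + 1) ⟨fun i => if i ≤ l then p i else x, by omega, ?_, ?_, ?_⟩
    · omega
    · intro i j h5 h6 h7 h8 hij
      dsimp only at hij
      split_ifs at hij
      · exact h2 _ _ (by omega) (by omega) (by omega) (by omega) hij
      · exact absurd hij (hcon _ (by omega) (by omega))
      · exact absurd hij.symm (hcon _ (by omega) (by omega))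
      · omega
    · intro i h5 h6
      dsimp only
      rw [if_pos (show i ≤ l by omega)]
      split_ifs with h7
      · exact h3 _ h5 (by omega)
      · rw [show i = l by omega]; exact hadj
    · intro i h5 h6
      dsimp only
      split_ifs with h7
      · exact h4 _ (by omega) (by omega)
      · exact hx

/-- A digraph of minimum out-degree at least `a` has a cycle of length at least `a + 1`. -/
theorem exists_isCycle_of_outDegree [Nonempty V] (hirr : ∀ v, ¬ D.Adj v v) (ha : 0 < a)
    (hout : ∀ v, a ≤ outDegree D v) : ∃ m w, IsCycle D m w ∧ a + 1 ≤ m := by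
  classical
  obtain ⟨l, p, h1, h2, h3, -, -, h4⟩ := exists_maximal_path D (Set.univ_nonempty (α := V))
  have h5 : ∀ x, D.Adj (p l) x → ∃ i, 0 ≤ i ∧ i ≤ l - 1 ∧ p i = x := fun x hx => by
    obtain ⟨i, h6, h7, rfl⟩ := h4 x trivial hx
    have : i ≠ l := by rintro rfl; exact hirr _ hx
    exact ⟨i, h6, by omega, rfl⟩
  obtain ⟨i₀, hi₀, hi₀'⟩ : ∃ i, 0 ≤ i ∧ D.Adj (p l) (p i) := by
    by_contra hcon
    push Not at hcon
    have h6 : {x | D.Adj (p l) x} = ∅ := by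
      rw [Set.eq_empty_iff_forall_notMem]
      intro x hx
      obtain ⟨i, h7, -, rfl⟩ := h5 x hx
      exact hcon i h7 hx
    have h7 := hout (p l)
    rw [outDegree, h6, Set.ncard_empty] at h7
    omega
  -- All out-neighbours of `p l` lie on the path. Closing up at the earliest of them gives a cycle
  -- containing `p l` and its out-neighbours, hence at least `a + 1` vertices.
  obtain ⟨i, ⟨hi1, hi2⟩, hi3⟩ := Int.exists_least_of_bdd
    (P := fun i => 0 ≤ i ∧ D.Adj (p l) (p i)) ⟨0, fun z hz => hz.1⟩ ⟨i₀, hi₀, hi₀'⟩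
  have hsub : {x | D.Adj (p l) x} ⊆ ((Finset.Icc i (l - 1)).image p : Finset V) := by
    intro x hx
    obtain ⟨j, h6, h7, rfl⟩ := h5 x hx
    rw [Finset.mem_coe, Finset.mem_image]
    exact ⟨j, Finset.mem_Icc.2 ⟨hi3 j ⟨h6, hx⟩, h7⟩, rfl⟩
  have h6 := Set.ncard_le_ncard hsub (Set.toFinite _)
  rw [Set.ncard_coe_finset] at h6
  have h7 := Finset.card_image_le (s := Finset.Icc i (l - 1)) (f := p)
  rw [Int.card_Icc] at h7
  have h8 := hout (p l)
  rw [outDegree] at h8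
  refine ⟨l - i + 1, fun t => p (i + t - 1), ⟨by omega, fun x y h9 h10 h11 h12 hxy => ?_,
    fun x h9 h10 => ?_, ?_⟩, by omega⟩
  · have := h2 _ _ (by omega) (by omega) (by omega) (by omega) hxy
    omega
  · rw [show i + (x + 1) - 1 = i + x - 1 + 1 by ring]
    exact h3 _ (by omega) (by omega)
  · rw [show i + (l - i + 1) - 1 = l by ring, add_sub_cancel_right]
    exact hi2

theorem IsCycle.le_card (h : IsCycle D m w) : m ≤ Fintype.card V := by
  classical
  have h1 := h.two_le
  have h2 := Finset.card_le_univ ((Finset.Icc 1 m).image w)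
  rw [Finset.card_image_of_injOn, Int.card_Icc] at h2
  · omega
  · intro i hi j hj hij
    simp only [Finset.coe_Icc, Set.mem_Icc] at hi hj
    exact h.inj i j hi.1 hi.2 hj.1 hj.2 hij

/-- The longest cycle has `m ≥ max a b + 1`, and `m + l ≤ a + b`; so `l < a`, `l < b` and `l + 2 ≤
m`. The outcome depends on whether the path off the cycle is a single vertex. The hypothesis on `a +
b` makes the larger of the two positive. -/
theorem Extremal.exceptional (hE : Extremal D a b) (hab : 1 ≤ a + b) :
    IsGluedCompleteEq D ∨ IsIndependentJoin D ∨ IsFourVertexJoinOne D ∨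
      Isomorphic D sevenVertex := by
  have hcard := hE.card
  have : Nonempty V := Fintype.card_pos_iff.1 (by omega)
  obtain ⟨m₀, w₀, hw₀, hm₀⟩ : ∃ m w, IsCycle D m w ∧ a + 1 ≤ m ∧ b + 1 ≤ m := by
    rcases le_total b a with h | h
    · obtain ⟨m, w, h1, h2⟩ := exists_isCycle_of_outDegree hE.irrefl (by omega) hE.out
      exact ⟨m, w, h1, h2, by omega⟩
    · obtain ⟨m, w, h1, h2⟩ := exists_isCycle_of_outDegree hE.rev.irrefl (by omega) hE.rev.out
      exact ⟨m, _, h1.of_rev, by omega, h2⟩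
  obtain ⟨m, ⟨w, hw⟩, hmax⟩ := Int.exists_greatest_of_bdd (P := fun m => ∃ w, IsCycle D m w)
    ⟨Fintype.card V, fun z ⟨w, hw⟩ => hw.le_card⟩ ⟨m₀, w₀, hw₀⟩
  have hm := hmax m₀ ⟨w₀, hw₀⟩
  obtain ⟨s, hs⟩ : ∃ s, ∀ i, 1 ≤ i → i ≤ m → w i ≠ s := by
    by_contra hcon
    push Not at hcon
    exact hE.non (hw.hasHamiltonCycle hcon)
  obtain ⟨l, p, h1, h2, h3, h4, h5, h6⟩ := exists_maximal_path D
    (S := {x | ∀ i, 1 ≤ i → i ≤ m → w i ≠ x}) ⟨s, hs⟩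
  have hcp := hw.cyclePath h1 h2 h3 (fun i j h7 h8 h9 h10 => h4 j h9 h10 i h7 h8)
    (fun x hx => or_iff_not_imp_left.2 fun h7 => h5 x (fun i h8 h9 h10 => h7 ⟨i, h8, h9, h10⟩) hx)
    (fun x hx => or_iff_not_imp_left.2 fun h7 => h6 x (fun i h8 h9 h10 => h7 ⟨i, h8, h9, h10⟩) hx)
  have hle := hcp.le_card
  have hmax' : ∀ m' w, IsCycle D m' w → m' ≤ m := fun m' w hw => hmax m' ⟨w, hw⟩
  rcases eq_or_lt_of_le h1 with rfl | hl
  · obtain ⟨M, e, hF⟩ := hcp.exists_frame hmax' hE (by omega) (by omega)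
    exact Or.inr (hF.exceptional hE)
  · exact Or.inl (hcp.isGluedCompleteEq hmax' hE (by omega) (by omega) (by omega) (by omega))

end LongestCycle

end HamiltonDigraph

theorem theorem5p1 {V : Type*} [Fintype V] (D : Digraph V) (hD : HamiltonDigraph.Simple D)
    (hV : 2 ≤ Fintype.card V)
    (hdeg : ∀ u v : V,
      Fintype.card V - 1 ≤ HamiltonDigraph.outDegree D u + HamiltonDigraph.inDegree D v) :
    HamiltonDigraph.HasHamiltonCycle D ↔
      ¬ (HamiltonDigraph.IsGluedCompleteEq D ∨ HamiltonDigraph.IsIndependentJoin D ∨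
        HamiltonDigraph.IsFourVertexJoinOne D ∨
        HamiltonDigraph.Isomorphic D HamiltonDigraph.sevenVertex) := by
  constructor
  · rintro h (⟨n, hn, h1⟩ | ⟨n, -, H, -, h1⟩ | ⟨E, hE, h1⟩ | h1)
    · exact HamiltonDigraph.not_hasHamiltonCycle_gluedComplete hn (h1.hasHamiltonCycle h)
    · exact HamiltonDigraph.not_hasHamiltonCycle_independentJoin (h1.hasHamiltonCycle h)
    · exact HamiltonDigraph.not_hasHamiltonCycle_fourVertexJoin_one hE (h1.hasHamiltonCycle h)
    · exact HamiltonDigraph.not_hasHamiltonCycle_sevenVertex (h1.hasHamiltonCycle h)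
  · intro hex
    by_contra hnon
    have : Nonempty V := Fintype.card_pos_iff.1 (by omega)
    -- With `a` the minimum out-degree, attained at `u`, the degree condition for `u` and each `v`
    -- is the in-degree bound `b`.
    obtain ⟨u, hu⟩ := Finite.exists_min (HamiltonDigraph.outDegree D)
    refine hex (HamiltonDigraph.Extremal.exceptional (D := D)
      (a := HamiltonDigraph.outDegree D u)
      (b := (Fintype.card V : ℤ) - 1 - HamiltonDigraph.outDegree D u)
      ⟨hD, by ring, fun v => by exact_mod_cast hu v, fun v => ?_, hnon⟩ (by omega))
    have := hdeg u v
    omega
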